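/- **Theorem (Energy of the MC ansatz).** Let $p,D\ge 1$, let $G=(V,E)$ be a finite simple $(D+1)$-regular graph with $m=|E|$ edges and girth $>2p+1$, and let $\gamma,\beta\in\mathbb R^p$ and $c_I,c_X,c_Y,c_Z\in\mathbb R$. Put one qubit on each vertex, with Pauli operators $X_v,Y_v,Z_v$, and let $$B=\sum_{v\in V}X_v,\qquad C_z=-\frac1{\sqrt D}\sum_{(u,v)\in E}Z_uZ_v,\qquad H=\sum_{(u,v)\in E}\bigl(c_I\,I_uI_v+c_X\,X_uX_v+c_Y\,Y_uY_v+c_Z\,Z_uZ_v\bigr),$$ $$|\gamma,\beta\rangle=e^{-i\beta_pB}e^{-i\gamma_pC_z}\cdots e^{-i\beta_1B}e^{-i\gamma_1C_z}\,|+\rangle^{\otimes V}.$$ Write $\langle O\rangle=\langle\gamma,\beta|O|\gamma,\beta\rangle$. Index strings $a\in\{\pm1\}^{2p+1}$ as $(a_1,\dots,a_p,a_0,a_{-p},\dots,a_{-1})$, let $ab$ be the entrywise product of $a$ and $b$, let $|{\pm1}\rangle$ be the single-qubit eigenvectors of $Z$ with eigenvalue $\pm1$ (with $X|a\rangle=|-a\rangle$),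 and put $$\Gamma=(\gamma_1,\dots,\gamma_p,0,-\gamma_p,\dots,-\gamma_1),$$ $$f(a)=\tfrac12\prod_{j=1}^{p-1}\langle a_j|e^{i\beta_jX}|a_{j+1}\rangle\cdot\langle a_p|e^{i\beta_pX}|a_0\rangle\,\langle a_0|e^{-i\beta_pX}|a_{-p}\rangle\cdot\prod_{j=1}^{p-1}\langle a_{-(j+1)}|e^{-i\beta_jX}|a_{-j}\rangle ,$$ let $f'(a)$ be the same expression with the factor $\langle a_p|e^{i\beta_pX}|a_0\rangle$ replaced by $\langle a_p|e^{i\beta_pX}|{-a_0}\rangle$, and let $H_D^{(0)}(a)=1$ and, for $j\ge1$, $$H_D^{(j)}(a)=\Bigl(\sum_b H_D^{(j-1)}(b)\,e^{-\frac{i}{\sqrt D}\Gamma\cdot(ab)}f(b)\Bigr)^{D}.$$ Then the following hold. 1. For every edge $(L,R)\in E$, $$\langle H\rangle=c_I\,m+m\bigl(c_X\langle X_LX_R\rangle+c_Y\langle Y_LY_R\rangle+c_Z\langle Z_LZ_R\rangle\bigr),$$ $$\langle X_LX_R\rangle=\sum_{a,b}f'(a)f'(b)H_D^{(p)}(a)H_D^{(p)}(b)\cos\!\Bigl[\tfrac{\Gamma\cdot(ab)}{\sqrt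 D}\Bigr],$$ $$\langle Y_LY_R\rangle=i\sum_{a,b}a_0b_0f'(a)f'(b)H_D^{(p)}(a)H_D^{(p)}(b)\sin\!\Bigl[\tfrac{\Gamma\cdot(ab)}{\sqrt D}\Bigr],$$ $$\langle Z_LZ_R\rangle=-i\sum_{a,b}a_0b_0f(a)f(b)H_D^{(p)}(a)H_D^{(p)}(b)\sin\!\Bigl[\tfrac{\Gamma\cdot(ab)}{\sqrt D}\Bigr].$$ 2. For all $j\ge1$ and all $a$, $\;H_D^{(j)}(a)=\Bigl(\sum_b H_D^{(j-1)}(b)\cos\bigl[\tfrac1{\sqrt D}\Gamma\cdot(ab)\bigr]f(b)\Bigr)^{D}$. 3. The iteration can be evaluated in time $O(p\,16^p)$ and space $O(16^p)$, with absolute constants, in the unit-cost arithmetic model. That is, there are a single program and a constant $K$ such that for all $p,D\ge1$, all $m\in\mathbb N$ and all real $c_I,c_X,c_Y,c_Z,\gamma_1,\dots,\gamma_p,\beta_1,\dots,\beta_p$, the program, on input of these data, outputs the values of the four right-hand sides in 1 (the last three being the sums, and the first being evaluated with these sums) and all the values $H_D^{(j)}(a)$, $0\le j\le p$, $a\in\{\pm1\}^{2p+1}$,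 in at most $K\,p\,16^p$ steps and with at most $K\,16^p$ complex memory cells. A program has a fixed number of integer registers (for loop bounds and addresses; operations $+$, truncated $-$, $\times$, quotient, remainder, test for zero, bounded loops), in which no integer larger than $K\,16^p$ is ever written, and a fixed number of arrays of complex numbers, addressed by the integer registers (operations: Gaussian-integer constants, $+,-,\times,\div$, $\exp$, and principal powers $x^y$). Each operation and each test costs one step. -/

import Mathlib

open scoped Matrix BigOperators

noncomputable section

namespace MCAnsatz

/-! ### Qubits, Pauli operators, and the ansatz

Computational basis states of a qubit are labelled by their Pauli-`Z` eigenvalue `z : ℤˣ`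
(that is, `z = 1` or `z = -1`). The Hilbert space of the qubits on a vertex set `V` is
`(V → ℤˣ) → ℂ`, and `M z w` is the matrix element `⟨z|M|w⟩` of an operator `M`. -/

/-- A `±1` label as a complex number. -/
def sgn (z : ℤˣ) : ℂ := ((z : ℤ) : ℂ)

/-- `X |w⟩ = |-w⟩`. -/
def pauliX : Matrix ℤˣ ℤˣ ℂ := Matrix.of fun z w => if z = -w then 1 else 0

/-- `Y |w⟩ = i w |-w⟩`. -/
def pauliY : Matrix ℤˣ ℤˣ ℂ := Matrix.of fun z w => if z = -w then Complex.I * sgn w else 0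

/-- `Z |w⟩ = w |w⟩`. -/
def pauliZ : Matrix ℤˣ ℤˣ ℂ := Matrix.of fun z w => if z = w then sgn w else 0

section Quantum

variable {V : Type*} [Fintype V] [DecidableEq V]

/-- The tensor product `⨂ v, M v` of single-qubit operators. -/
def tensorOp (M : V → Matrix ℤˣ ℤˣ ℂ) : Matrix (V → ℤˣ) (V → ℤˣ) ℂ :=
  Matrix.of fun z w => ∏ v, M v (z v) (w v)

/-- The operator that acts as `P` on each qubit of `S` and as the identity on the others;
for example `onQubits {u, v} pauliX` is `X_u X_v` when `u ≠ v`. -/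
def onQubits (S : Finset V) (P : Matrix ℤˣ ℤˣ ℂ) : Matrix (V → ℤˣ) (V → ℤˣ) ℂ :=
  tensorOp fun v => if v ∈ S then P else 1

/-- The mixer `B = ∑ j, X_j`. -/
def mixer : Matrix (V → ℤˣ) (V → ℤˣ) ℂ := ∑ j : V, onQubits {j} pauliX

/-- The phaser `C_z = -(1/√D) ∑_{(u,v) ∈ E} Z_u Z_v`. -/
def phaser (G : SimpleGraph V) [DecidableRel G.Adj] (D : ℕ) : Matrix (V → ℤˣ) (V → ℤˣ) ℂ :=
  (-(1 / (Real.sqrt D : ℂ))) • ∑ e ∈ G.edgeFinset, onQubits e.toFinset pauliZ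

/-- The `2`-local Hamiltonian
`∑_{(u,v) ∈ E} (c_I I_u I_v + c_X X_u X_v + c_Y Y_u Y_v + c_Z Z_u Z_v)`. -/
def hamiltonian (G : SimpleGraph V) [DecidableRel G.Adj] (cI cX cY cZ : ℝ) :
    Matrix (V → ℤˣ) (V → ℤˣ) ℂ :=
  ∑ e ∈ G.edgeFinset,
    ((cI : ℂ) • (1 : Matrix (V → ℤˣ) (V → ℤˣ) ℂ)
      + (cX : ℂ) • onQubits e.toFinset pauliX
      + (cY : ℂ) • onQubits e.toFinset pauliY
      + (cZ : ℂ) • onQubits e.toFinset pauliZ)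

/-- `|s⟩ = |+⟩^{⊗ V}`. -/
def plusState : (V → ℤˣ) → ℂ := fun _ => (1 / (Real.sqrt 2 : ℂ)) ^ Fintype.card V

/-- The state
`e^{-i β_p B} e^{-i γ_p C_z} ⋯ e^{-i β_1 B} e^{-i γ_1 C_z} |s⟩`.
Angles are indexed from `1`: only `γ 1, …, γ p` and `β 1, …, β p` are used. -/
def ansatzState (G : SimpleGraph V) [DecidableRel G.Adj] (D : ℕ) (γ β : ℕ → ℝ) :
    ℕ → ((V → ℤˣ) → ℂ)
  | 0 => plusState
  | p + 1 =>
      NormedSpace.exp ((-(Complex.I * (β (p + 1) : ℂ))) • (mixer : Matrix (V → ℤˣ) (V → ℤˣ) ℂ)) *ᵥ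
        (NormedSpace.exp ((-(Complex.I * (γ (p + 1) : ℂ))) • phaser G D) *ᵥ
          ansatzState G D γ β p)

/-- `⟨γ, β| O |γ, β⟩` in the depth-`p` state. -/
def expectation (G : SimpleGraph V) [DecidableRel G.Adj] (D p : ℕ) (γ β : ℕ → ℝ)
    (O : Matrix (V → ℤˣ) (V → ℤˣ) ℂ) : ℂ :=
  star (ansatzState G D γ β p) ⬝ᵥ (O *ᵥ ansatzState G D γ β p)

end Quantum

/-! ### The iteration

A string `(a_1, …, a_p, a_0, a_{-p}, …, a_{-1})` is a function on `Fin (2 * p + 1)`: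
position `k < p` is `a_{k+1}`, position `p` is `a_0`, and position `k > p` is `a_{-(2p+1-k)}`. -/

/-- `±1` strings of length `2p+1`. -/
abbrev Str (p : ℕ) : Type := Fin (2 * p + 1) → ℤˣ

/-- The entry `a_0`, as a complex number. -/
def midEntry {p : ℕ} (a : Str p) : ℂ := sgn (a ⟨p, by omega⟩)

/-- `Γ = (γ_1, …, γ_p, 0, -γ_p, …, -γ_1)`. -/
def bigGamma (p : ℕ) (γ : ℕ → ℝ) (k : Fin (2 * p + 1)) : ℝ :=
  if (k : ℕ) < p then γ (k + 1) else if (k : ℕ) = p then 0 else -γ (2 * p + 1 - k)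

/-- `Γ · (a b)`, with `a b` the entrywise product. -/
def gammaDot {p : ℕ} (γ : ℕ → ℝ) (a b : Str p) : ℝ :=
  ∑ k, bigGamma p γ k * ((a k * b k : ℤˣ) : ℤ)

/-- The angle of the `k`-th matrix element in `f`:
`β_1, …, β_p, -β_p, …, -β_1`. -/
def chainAngle (p : ℕ) (β : ℕ → ℝ) (k : Fin (2 * p)) : ℝ :=
  if (k : ℕ) < p then β (k + 1) else -β (2 * p - k)

/-- `⟨x| e^{i θ X} |y⟩`. -/
def rotX (θ : ℝ) (x y : ℤˣ) : ℂ :=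
  (NormedSpace.exp ((Complex.I * (θ : ℂ)) • pauliX) : Matrix ℤˣ ℤˣ ℂ) x y

/-- `f(a) = ½ ⟨a_1|e^{iβ_1 X}|a_2⟩ ⋯ ⟨a_p|e^{iβ_p X}|a_0⟩
⟨a_0|e^{-iβ_p X}|a_{-p}⟩ ⋯ ⟨a_{-2}|e^{-iβ_1 X}|a_{-1}⟩`. -/
def f {p : ℕ} (β : ℕ → ℝ) (a : Str p) : ℂ :=
  1 / 2 * ∏ k : Fin (2 * p), rotX (chainAngle p β k) (a k.castSucc) (a k.succ)

/-- `f'(a)`: as `f(a)`, with the factor `⟨a_p|e^{iβ_p X}|a_0⟩` replaced by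
`⟨a_p|e^{iβ_p X}|-a_0⟩`. -/
def f' {p : ℕ} (β : ℕ → ℝ) (a : Str p) : ℂ :=
  1 / 2 * ∏ k : Fin (2 * p), rotX (chainAngle p β k) (a k.castSucc)
    (if (k : ℕ) + 1 = p then -a k.succ else a k.succ)

/-- `H_D^{(m)}(a)`, where `H_D^{(0)} = 1` and
`H_D^{(m)}(a) = (∑_b H_D^{(m-1)}(b) exp(-(i/√D) Γ·(a b)) f(b))^D`. -/
def treeH (p D : ℕ) (γ β : ℕ → ℝ) : ℕ → Str p → ℂ
  | 0, _ => 1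
  | m + 1, a =>
      (∑ b : Str p, treeH p D γ β m b *
        Complex.exp (-(Complex.I / (Real.sqrt D : ℂ)) * (gammaDot γ a b : ℂ)) * f β b) ^ D

/-- The right-hand side of the formula for `⟨X_L X_R⟩`. -/
def sumXX (p D : ℕ) (γ β : ℕ → ℝ) : ℂ :=
  ∑ a : Str p, ∑ b : Str p, f' β a * f' β b * treeH p D γ β p a * treeH p D γ β p b *
    (Real.cos (gammaDot γ a b / Real.sqrt D) : ℂ)

/-- The right-hand side of the formula for `⟨Y_L Y_R⟩`. -/
def sumYY (p D : ℕ) (γ β : ℕ → ℝ) : ℂ :=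
  Complex.I * ∑ a : Str p, ∑ b : Str p, midEntry a * midEntry b * f' β a * f' β b *
    treeH p D γ β p a * treeH p D γ β p b * (Real.sin (gammaDot γ a b / Real.sqrt D) : ℂ)

/-- The right-hand side of the formula for `⟨Z_L Z_R⟩`. -/
def sumZZ (p D : ℕ) (γ β : ℕ → ℝ) : ℂ :=
  -Complex.I * ∑ a : Str p, ∑ b : Str p, midEntry a * midEntry b * f β a * f β b *
    treeH p D γ β p a * treeH p D γ β p b * (Real.sin (gammaDot γ a b / Real.sqrt D) : ℂ)

/-- The total energy computed from the iteration on a graph with `m` edges. -/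
def energyValue (p D m : ℕ) (cI cX cY cZ : ℝ) (γ β : ℕ → ℝ) : ℂ :=
  (cI : ℂ) * m +
    m * ((cX : ℂ) * sumXX p D γ β + (cY : ℂ) * sumYY p D γ β + (cZ : ℂ) * sumZZ p D γ β)

/-! ### The cost model: a unit-cost arithmetic machine

A program is a fixed finite text. It has integer registers (used for loop bounds and addresses)
and arrays of complex numbers, addressed by the contents of an integer register. There is no
transfer of information from complex cells to integer registers. Since a program names only
finitely many registers and arrays, the number of integer registers is a constant; the integers
they hold are measured separately, by `Prog.peak`. -/

/-- The contents of the integer registers and of the complex arrays. -/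
structure Store where
  reg : ℕ → ℕ
  mem : ℕ → ℕ → ℂ

/-- An operand: the cell of array `arr` whose address is the content of register `ix`. -/
structure Ref where
  arr : ℕ
  ix : ℕ

/-- Operations on integers: truncated subtraction, quotient and remainder included. -/
inductive IntOp
  | add | sub | mul | div | mod

def IntOp.eval : IntOp → ℕ → ℕ → ℕ
  | .add, x, y => x + y
  | .sub, x, y => x - y
  | .mul, x, y => x * y
  | .div, x, y => x / y
  | .mod, x, y => x % y

/-- Operations on complex numbers; `pow` is the principal power `x ^ y`. -/
inductive NumOp
  | add | sub | mul | div | pow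

def NumOp.eval : NumOp → ℂ → ℂ → ℂ
  | .add, x, y => x + y
  | .sub, x, y => x - y
  | .mul, x, y => x * y
  | .div, x, y => x / y
  | .pow, x, y => x ^ y

/-- Programs. -/
inductive Prog
  /-- do nothing -/
  | skip
  /-- register `r` receives the literal `n` -/
  | setInt (r n : ℕ)
  /-- register `r` receives the result of `o` on registers `x`, `y` -/
  | opInt (o : IntOp) (r x y : ℕ)
  /-- cell `t` receives the literal `a + b i` -/
  | setNum (t : Ref) (a b : ℤ)
  /-- cell `t` receives the exponential of cell `x` -/
  | expNum (t x : Ref)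
  /-- cell `t` receives the result of `o` on cells `x`, `y` -/
  | opNum (o : NumOp) (t x y : Ref)
  /-- `c`, then `d` -/
  | seq (c d : Prog)
  /-- `c` if register `r` is zero, else `d` -/
  | ifZero (r : ℕ) (c d : Prog)
  /-- repeat `c`; the number of repetitions is the content of register `r` at entry -/
  | loop (r : ℕ) (c : Prog)

/-- The value of a cell. -/
def Store.get (s : Store) (x : Ref) : ℂ := s.mem x.arr (s.reg x.ix)

def Store.setReg (s : Store) (r n : ℕ) : Store :=
  ⟨Function.update s.reg r n, s.mem⟩

def Store.set (s : Store) (t : Ref) (z : ℂ) : Store :=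
  ⟨s.reg, Function.update s.mem t.arr (Function.update (s.mem t.arr) (s.reg t.ix) z)⟩

/-- The cell (array name, address) that an operand denotes. -/
def Store.cell (s : Store) (x : Ref) : ℕ × ℕ := (x.arr, s.reg x.ix)

/-- The store after a program has been executed. -/
def Prog.run : Prog → Store → Store
  | .skip, s => s
  | .setInt r n, s => s.setReg r n
  | .opInt o r x y, s => s.setReg r (o.eval (s.reg x) (s.reg y))
  | .setNum t a b, s => s.set t ((a : ℂ) + (b : ℂ) * Complex.I)
  | .expNum t x, s => s.set t (Complex.exp (s.get x))
  | .opNum o t x y, s => s.set t (o.eval (s.get x) (s.get y))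
  | .seq c d, s => d.run (c.run s)
  | .ifZero r c d, s => if s.reg r = 0 then c.run s else d.run s
  | .loop r c, s => c.run^[s.reg r] s

/-- The number of steps: one per basic instruction, one per test, and one per test of a loop. -/
def Prog.time : Prog → Store → ℕ
  | .skip, _ => 1
  | .setInt _ _, _ => 1
  | .opInt _ _ _ _, _ => 1
  | .setNum _ _ _, _ => 1
  | .expNum _ _, _ => 1
  | .opNum _ _ _ _, _ => 1
  | .seq c d, s => c.time s + d.time (c.run s)
  | .ifZero r c d, s => 1 + if s.reg r = 0 then c.time s else d.time s
  | .loop r c, s => 1 + ∑ k ∈ Finset.range (s.reg r), (1 + c.time (c.run^[k] s))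

/-- The complex cells that are read or written in the course of the execution. -/
def Prog.cells : Prog → Store → Finset (ℕ × ℕ)
  | .skip, _ => ∅
  | .setInt _ _, _ => ∅
  | .opInt _ _ _ _, _ => ∅
  | .setNum t _ _, s => {s.cell t}
  | .expNum t x, s => {s.cell t, s.cell x}
  | .opNum _ t x y, s => {s.cell t, s.cell x, s.cell y}
  | .seq c d, s => c.cells s ∪ d.cells (c.run s)
  | .ifZero r c d, s => if s.reg r = 0 then c.cells s else d.cells s
  | .loop r c, s => (Finset.range (s.reg r)).biUnion fun k => c.cells (c.run^[k] s)

/-- The number of complex cells used. -/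
def Prog.space (c : Prog) (s : Store) : ℕ := (c.cells s).card

/-- The largest integer written into a register in the course of the execution. -/
def Prog.peak : Prog → Store → ℕ
  | .skip, _ => 0
  | .setInt _ n, _ => n
  | .opInt o _ x y, s => o.eval (s.reg x) (s.reg y)
  | .setNum _ _ _, _ => 0
  | .expNum _ _, _ => 0
  | .opNum _ _ _ _, _ => 0
  | .seq c d, s => max (c.peak s) (d.peak (c.run s))
  | .ifZero r c d, s => if s.reg r = 0 then c.peak s else d.peak s
  | .loop r c, s => (Finset.range (s.reg r)).sup fun k => c.peak (c.run^[k] s)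

/-- The initial store: register `0` holds `p`; array `0` holds `D, m, c_I, c_X, c_Y, c_Z`;
arrays `1` and `2` hold `γ_1, …, γ_p` and `β_1, …, β_p` at the addresses `1, …, p`;
everything else is zero. -/
def inputStore (p D m : ℕ) (cI cX cY cZ : ℝ) (γ β : ℕ → ℝ) : Store where
  reg := fun r => if r = 0 then p else 0
  mem := fun arr i =>
    match arr, i with
    | 0, 0 => (D : ℂ)
    | 0, 1 => (m : ℂ)
    | 0, 2 => (cI : ℂ)
    | 0, 3 => (cX : ℂ)
    | 0, 4 => (cY : ℂ)
    | 0, 5 => (cZ : ℂ)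
    | 1, i => if 1 ≤ i ∧ i ≤ p then (γ i : ℂ) else 0
    | 2, i => if 1 ≤ i ∧ i ≤ p then (β i : ℂ) else 0
    | _, _ => 0

/-- The string encoded by the binary digits of `n`: digit `1` stands for `-1`. As `n` ranges over
`0, …, 2^(2p+1) - 1`, every string occurs exactly once. -/
def decode (p n : ℕ) : Str p := fun k => if n.testBit k then -1 else 1

/-- The output condition: array `3` holds the energy and the three edge expectation values, and
array `4` holds all the values `H_D^{(j)}(a)`, `0 ≤ j ≤ p`, row by row. -/
def IsOutput (s : Store) (p D m : ℕ) (cI cX cY cZ : ℝ) (γ β : ℕ → ℝ) : Prop :=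
  s.mem 3 0 = energyValue p D m cI cX cY cZ γ β ∧
  s.mem 3 1 = sumXX p D γ β ∧
  s.mem 3 2 = sumYY p D γ β ∧
  s.mem 3 3 = sumZZ p D γ β ∧
  ∀ j ≤ p, ∀ n < 2 ^ (2 * p + 1),
    s.mem 4 (j * 2 ^ (2 * p + 1) + n) = treeH p D γ β j (decode p n)

end MCAnsatz

end

open MCAnsatz

open scoped Matrix BigOperators

noncomputable section

namespace MCAnsatz

set_option linter.unusedSectionVars false

/-! ### Signs and single-qubit rotations -/

/-! In the Heisenberg picture, conjugating an observable by a mixing layer keeps its support,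
because rotations outside the support commute with it and cancel. A phase layer enlarges the support
by at most one edge. After p layers, an observable on the edge LR is therefore affected only by
edges touching the ball of radius p - 1 around {L, R}. The phases of all other edges may be deleted
from the state (`SupportedOn.conj_mix`, `SupportedOn.conj_phase_eq`, `expectOn_eq_of_lightCone`).

Inserting the computational basis between all layers gives a sum over assignments of one string to
each vertex (`expectOn_eq_sum_strings`). Each vertex contributes its own weight: `f` away from the
edge, and `f` or `f'` times a function of the middle entry at L and R. Each remaining edge
contributes exp(-(i/√D) Γ·(ab)).

The girth hypothesis makes the remaining edges a tree: every vertex outside {L, R} has one parent,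
and every vertex of depth less than p has D children (`parent_unique`, `not_adj_of_layer`,
`treeEdges_succ`, `card_children`). Since `f` sums to one (`sum_f`), leaves can be summed out
against their parents and unattached vertices disappear. Removing one layer multiplies D equal sums
at each parent, which is one step of `treeH` (`sum_layer`). After p layers only the strings at L and
R are left (`sum_tree`). The symmetry a ↦ -a then keeps the cosine of the phase for even weights and
the sine for odd ones. The same symmetry gives the cosine form of the recursion.

For the complexity bound, write N = 2^(2p+1), so that N² = 4·16^p. The phases of all N² pairs are
tabulated once, at cost O(p) each. The p rounds of the recursion then cost O(1) per pair. The
predicate `Ok` carries correctness, time, cells and integer size together, and loops are handled by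
invariants (`Ok.forN`). -/

theorem sgn_neg (a : ℤˣ) : sgn (-a) = -sgn a := by simp [sgn]

theorem sgn_one : sgn 1 = 1 := by simp [sgn]

theorem sgn_neg_one : sgn (-1) = -1 := by simp [sgn]

theorem sum_unitsInt (g : ℤˣ → ℂ) : ∑ z : ℤˣ, g z = g 1 + g (-1) := by
  rw [show (Finset.univ : Finset ℤˣ) = {1, -1} from rfl, Finset.sum_pair (by decide)]

/-- The unnormalized Hadamard matrix. -/
def hadamard : Matrix ℤˣ ℤˣ ℂ := Matrix.of fun z w => if z = -1 ∧ w = -1 then -1 else 1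

theorem matrix_ext_unitsInt {A B : Matrix ℤˣ ℤˣ ℂ} (h₁ : A 1 1 = B 1 1) (h₂ : A 1 (-1) = B 1 (-1))
    (h₃ : A (-1) 1 = B (-1) 1) (h₄ : A (-1) (-1) = B (-1) (-1)) : A = B := by
  ext z w
  rcases Int.units_eq_one_or z with rfl | rfl <;> rcases Int.units_eq_one_or w with rfl | rfl <;>
    assumption

theorem hadamard_mul_half : hadamard * ((1 / 2 : ℂ) • hadamard) = 1 := by
  apply matrix_ext_unitsInt <;> norm_num [Matrix.mul_apply, hadamard]

theorem half_hadamard_mul : ((1 / 2 : ℂ) • hadamard) * hadamard = 1 := by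
  rw [Matrix.smul_mul, ← Matrix.mul_smul, hadamard_mul_half]

theorem pauliX_mul_hadamard : pauliX * hadamard = hadamard * pauliZ := by
  apply matrix_ext_unitsInt <;> simp only [Matrix.mul_apply, sum_unitsInt] <;>
    simp [hadamard, pauliX, pauliZ, sgn]

theorem pauliZ_eq_diagonal : pauliZ = Matrix.diagonal sgn := by
  ext z w
  by_cases h : z = w <;> simp [pauliZ, Matrix.diagonal, h]

theorem exp_diagonal_complex {ι : Type*} [Fintype ι] [DecidableEq ι] (d : ι → ℂ) :
    NormedSpace.exp (Matrix.diagonal d) = Matrix.diagonal fun i => Complex.exp (d i) := by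
  rw [Matrix.exp_diagonal]
  congr 1
  funext i
  rw [Pi.coe_exp, Complex.exp_eq_exp_ℂ]

/-- The Hadamard matrix conjugates X to the diagonal matrix Z, and the exponential commutes with
conjugation. -/
theorem exp_smul_pauliX (c : ℂ) : NormedSpace.exp (c • pauliX) =
    hadamard * (Matrix.diagonal fun z => Complex.exp (c * sgn z)) * ((1 / 2 : ℂ) • hadamard) := by
  let U : (Matrix ℤˣ ℤˣ ℂ)ˣ := ⟨hadamard, (1 / 2 : ℂ) • hadamard, hadamard_mul_half,
    half_hadamard_mul⟩
  have h : c • pauliX = U * (Matrix.diagonal fun z => c * sgn z) * (↑U⁻¹ : Matrix ℤˣ ℤˣ ℂ) := by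
    change _ = hadamard * _ * ((1 / 2 : ℂ) • hadamard)
    have : (Matrix.diagonal fun z => c * sgn z) = c • pauliZ := by
      rw [pauliZ_eq_diagonal, ← Matrix.diagonal_smul]; rfl
    rw [this, Matrix.mul_smul hadamard c, ← pauliX_mul_hadamard, Matrix.smul_mul, Matrix.mul_assoc,
      hadamard_mul_half, Matrix.mul_one]
  rw [h, Matrix.exp_units_conj, exp_diagonal_complex]
  rfl

/-- Since X² = 1, e^{iθX} = cos θ + i sin θ X. Symmetry, flip invariance and conjugation of the
entries are all read off from this form. -/
theorem rotX_eq (θ : ℝ) (x y : ℤˣ) :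
    rotX θ x y = if x = y then Complex.cos θ else Complex.I * Complex.sin θ := by
  rw [rotX, exp_smul_pauliX]
  have h2 : Complex.I * Complex.sin θ =
      (Complex.exp (Complex.I * θ) - Complex.exp (-(Complex.I * θ))) / 2 := by
    rw [Complex.sin, neg_mul, mul_comm (θ : ℂ) Complex.I]
    linear_combination
      (Complex.exp (-(Complex.I * θ)) - Complex.exp (Complex.I * θ)) / 2 * Complex.I_sq
  rw [h2, Complex.cos, neg_mul, mul_comm (θ : ℂ) Complex.I]
  rcases Int.units_eq_one_or x with rfl | rfl <;> rcases Int.units_eq_one_or y with rfl | rfl <;>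
    simp [Matrix.mul_apply, hadamard,
      Matrix.diagonal, sgn] <;> ring

theorem rotX_neg_neg (θ : ℝ) (x y : ℤˣ) : rotX θ (-x) (-y) = rotX θ x y := by
  simp [rotX_eq]

theorem rotX_symm (θ : ℝ) (x y : ℤˣ) : rotX θ x y = rotX θ y x := by
  simp [rotX_eq, eq_comm]

theorem star_rotX (θ : ℝ) (x y : ℤˣ) : star (rotX θ x y) = rotX (-θ) x y := by
  rw [rotX_eq, rotX_eq]
  split_ifs
  · rw [Complex.ofReal_neg, Complex.cos_neg]
    exact (Complex.cos_conj _).symm.trans (by simp)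
  · have : (starRingEnd ℂ) (Complex.sin θ) = Complex.sin θ :=
      (Complex.sin_conj _).symm.trans (by simp)
    simp [this]

/-- `e^{i θ X}` as a matrix. -/
def rotMat (θ : ℝ) : Matrix ℤˣ ℤˣ ℂ := Matrix.of (rotX θ)

theorem exp_I_smul_pauliX (θ : ℝ) :
    NormedSpace.exp ((Complex.I * (θ : ℂ)) • pauliX) = rotMat θ := rfl

theorem rotMat_mul_neg (θ : ℝ) : rotMat θ * rotMat (-θ) = 1 := by
  have h := Complex.sin_sq_add_cos_sq (θ : ℂ)
  apply matrix_ext_unitsInt <;>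
    simp [Matrix.mul_apply, rotMat, rotX_eq]
  · linear_combination h - Complex.sin θ ^ 2 * Complex.I_sq
  · ring
  · ring
  · linear_combination h - Complex.sin θ ^ 2 * Complex.I_sq

theorem rotMat_conjTranspose (θ : ℝ) : (rotMat θ)ᴴ = rotMat (-θ) := by
  ext x y
  rw [Matrix.conjTranspose_apply]
  exact (star_rotX θ y x).trans (rotX_symm _ _ _)

/-! ### Tensor products of single-qubit operators -/

section Quantum

variable {V : Type*} [Fintype V] [DecidableEq V]

theorem tensorOp_mul (M N : V → Matrix ℤˣ ℤˣ ℂ) :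
    tensorOp M * tensorOp N = tensorOp fun v => M v * N v := by
  ext z w
  simp only [tensorOp, Matrix.mul_apply, Matrix.of_apply]
  rw [Fintype.prod_sum]
  exact Finset.sum_congr rfl fun x _ => Finset.prod_mul_distrib.symm

theorem tensorOp_one : tensorOp (fun _ : V => (1 : Matrix ℤˣ ℤˣ ℂ)) = 1 := by
  ext z w
  simp only [tensorOp, Matrix.of_apply, Matrix.one_apply]
  rw [Finset.prod_ite_zero]
  simp [funext_iff]

theorem tensorOp_conjTranspose (M : V → Matrix ℤˣ ℤˣ ℂ) :
    (tensorOp M)ᴴ = tensorOp fun v => (M v)ᴴ := by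
  ext z w
  simp [tensorOp, Matrix.conjTranspose_apply]

theorem onQubits_pauliZ (S : Finset V) :
    onQubits S pauliZ = Matrix.diagonal fun z : V → ℤˣ => ∏ v ∈ S, sgn (z v) := by
  ext z w
  simp only [onQubits, tensorOp, Matrix.of_apply, Matrix.diagonal_apply]
  by_cases h : z = w
  · subst h
    rw [if_pos rfl, ← Finset.prod_filter_mul_prod_filter_not Finset.univ (· ∈ S)]
    have h2 : ∏ v ∈ Finset.univ.filter (¬ · ∈ S),
        (if v ∈ S then pauliZ else 1) (z v) (z v) = 1 :=
      Finset.prod_eq_one fun v hv => by simp [(Finset.mem_filter.1 hv).2]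
    rw [h2, mul_one, Finset.filter_univ_mem]
    exact Finset.prod_congr rfl fun v hv => by simp [hv, pauliZ]
  · rw [if_neg h]
    obtain ⟨v, hv⟩ := Function.ne_iff.1 h
    refine Finset.prod_eq_zero (Finset.mem_univ v) ?_
    split_ifs <;> simp [pauliZ, hv]

/-- All summands of B are diagonalized at once by the tensor power of the Hadamard matrix. The
exponential of the resulting diagonal sum is a product over vertices. -/
theorem exp_smul_mixer (c : ℂ) :
    NormedSpace.exp (c • (mixer : Matrix (V → ℤˣ) (V → ℤˣ) ℂ)) =
      tensorOp fun _ => NormedSpace.exp (c • pauliX) := by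
  let U : (Matrix (V → ℤˣ) (V → ℤˣ) ℂ)ˣ := ⟨tensorOp fun _ => hadamard,
    tensorOp fun _ => (1 / 2 : ℂ) • hadamard,
    by rw [tensorOp_mul, hadamard_mul_half, tensorOp_one],
    by rw [tensorOp_mul, half_hadamard_mul, tensorOp_one]⟩
  have hU : (U : Matrix (V → ℤˣ) (V → ℤˣ) ℂ) = tensorOp fun _ => hadamard := rfl
  have hUi : (↑U⁻¹ : Matrix (V → ℤˣ) (V → ℤˣ) ℂ) = tensorOp fun _ => (1 / 2 : ℂ) • hadamard := rfl
  have hmix : (mixer : Matrix (V → ℤˣ) (V → ℤˣ) ℂ) * (U : Matrix (V → ℤˣ) (V → ℤˣ) ℂ) =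
      U * Matrix.diagonal fun z : V → ℤˣ => ∑ v, sgn (z v) := by
    have hd : (Matrix.diagonal fun z : V → ℤˣ => ∑ v, sgn (z v)) =
        ∑ v : V, onQubits {v} pauliZ := by
      simp only [onQubits_pauliZ, Finset.prod_singleton]
      ext z w
      rw [Matrix.sum_apply]
      by_cases h : z = w <;> simp [h]
    rw [hd, mixer, Finset.sum_mul, Finset.mul_sum]
    refine Finset.sum_congr rfl fun v _ => ?_
    rw [hU, onQubits, onQubits, tensorOp_mul, tensorOp_mul]
    congr 1
    funext u
    split_ifs
    · exact pauliX_mul_hadamard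
    · rw [one_mul, mul_one]
  have hc : c • (mixer : Matrix (V → ℤˣ) (V → ℤˣ) ℂ) =
      (U : Matrix (V → ℤˣ) (V → ℤˣ) ℂ) * (Matrix.diagonal fun z : V → ℤˣ => c * ∑ v, sgn (z v)) *
        (↑U⁻¹ : Matrix (V → ℤˣ) (V → ℤˣ) ℂ) := by
    have : (Matrix.diagonal fun z : V → ℤˣ => c * ∑ v, sgn (z v)) =
        c • Matrix.diagonal fun z : V → ℤˣ => ∑ v, sgn (z v) := by
      rw [← Matrix.diagonal_smul]; rfl
    rw [this, Matrix.mul_smul, ← hmix, Matrix.smul_mul, Matrix.mul_assoc, Units.mul_inv,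
      Matrix.mul_one]
  have hd : (Matrix.diagonal fun z : V → ℤˣ => Complex.exp (c * ∑ v, sgn (z v))) =
      tensorOp fun _ => Matrix.diagonal fun z => Complex.exp (c * sgn z) := by
    ext z w
    simp only [tensorOp, Matrix.of_apply, Matrix.diagonal_apply]
    rw [Finset.prod_ite_zero]
    simp [funext_iff, Finset.mul_sum, Complex.exp_sum]
  rw [hc, Matrix.exp_units_conj, exp_diagonal_complex, hd, hU, hUi, tensorOp_mul, tensorOp_mul]
  simp only [exp_smul_pauliX]

/-- `∏_{v ∈ e} z_v`. -/
def edgeSgn (z : V → ℤˣ) (e : Sym2 V) : ℂ := ∏ v ∈ e.toFinset, sgn (z v)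

/-- The mixing layer `e^{-i β B}`. -/
def mixOp (V : Type*) [Fintype V] [DecidableEq V] (β : ℝ) : Matrix (V → ℤˣ) (V → ℤˣ) ℂ :=
  tensorOp fun _ => rotMat (-β)

/-- The phase `e^{(iγ/√D) ∑_{e ∈ E} z_e}`. -/
def phaseFun (D : ℕ) (E : Finset (Sym2 V)) (γ : ℝ) (z : V → ℤˣ) : ℂ :=
  Complex.exp (Complex.I / (Real.sqrt D : ℂ) * γ * ∑ e ∈ E, edgeSgn z e)

/-- The phaser is diagonal. Its minus sign cancels the one in e^{-iγC}, so the ket phases carry +i.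
-/
theorem exp_smul_phaser (G : SimpleGraph V) [DecidableRel G.Adj] (D : ℕ) (γ : ℝ) :
    NormedSpace.exp ((-(Complex.I * (γ : ℂ))) • phaser G D) =
      Matrix.diagonal (phaseFun D G.edgeFinset γ) := by
  have h : (-(Complex.I * (γ : ℂ))) • phaser G D = Matrix.diagonal fun z : V → ℤˣ =>
      Complex.I / (Real.sqrt D : ℂ) * γ * ∑ e ∈ G.edgeFinset, edgeSgn z e := by
    ext z w
    simp only [phaser, onQubits_pauliZ, Matrix.smul_apply, Matrix.sum_apply, smul_eq_mul,
      Matrix.diagonal_apply]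
    by_cases h : z = w
    · simp only [if_pos h, edgeSgn]; ring
    · simp [h]
  rw [h, exp_diagonal_complex]
  rfl

/-- The ansatz state for the phaser restricted to the edges in `E`. -/
def stateOn (E : Finset (Sym2 V)) (D : ℕ) (γ β : ℕ → ℝ) : ℕ → ((V → ℤˣ) → ℂ)
  | 0 => plusState
  | p + 1 => mixOp V (β (p + 1)) *ᵥ (Matrix.diagonal (phaseFun D E (γ (p + 1))) *ᵥ
      stateOn E D γ β p)

theorem ansatzState_eq (G : SimpleGraph V) [DecidableRel G.Adj] (D : ℕ) (γ β : ℕ → ℝ) (p : ℕ) :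
    ansatzState G D γ β p = stateOn G.edgeFinset D γ β p := by
  induction p with
  | zero => rfl
  | succ p ih =>
    rw [ansatzState, stateOn, ih, exp_smul_phaser, exp_smul_mixer]
    have : -(Complex.I * (β (p + 1) : ℂ)) = Complex.I * ((-β (p + 1) : ℝ) : ℂ) := by
      push_cast; ring
    rw [this, exp_I_smul_pauliX]
    rfl

/-- `⟨ψ| O |ψ⟩` for the state `stateOn E`. -/
def expectOn (E : Finset (Sym2 V)) (D p : ℕ) (γ β : ℕ → ℝ)
    (O : Matrix (V → ℤˣ) (V → ℤˣ) ℂ) : ℂ :=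
  star (stateOn E D γ β p) ⬝ᵥ (O *ᵥ stateOn E D γ β p)

theorem expectation_eq (G : SimpleGraph V) [DecidableRel G.Adj] (D p : ℕ) (γ β : ℕ → ℝ)
    (O : Matrix (V → ℤˣ) (V → ℤˣ) ℂ) :
    expectation G D p γ β O = expectOn G.edgeFinset D p γ β O := by
  rw [expectation, expectOn, ansatzState_eq]

theorem mixOp_conjTranspose (β : ℝ) : (mixOp V β)ᴴ = tensorOp fun _ => rotMat β := by
  simp [mixOp, tensorOp_conjTranspose, rotMat_conjTranspose]

theorem star_phaseFun (D : ℕ) (E : Finset (Sym2 V)) (γ : ℝ) (z : V → ℤˣ) :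
    star (phaseFun D E γ z) = phaseFun D E (-γ) z := by
  have h : ∀ e, (starRingEnd ℂ) (edgeSgn z e) = edgeSgn z e := fun e => by
    simp [edgeSgn, sgn, map_prod]
  change (starRingEnd ℂ) _ = _
  rw [phaseFun, phaseFun, ← Complex.exp_conj]
  simp only [map_mul, map_div₀, map_sum, h, Complex.conj_I, Complex.conj_ofReal]
  congr 1
  push_cast
  ring

theorem phaseFun_neg_mul (D : ℕ) (E : Finset (Sym2 V)) (γ : ℝ) (z : V → ℤˣ) :
    phaseFun D E (-γ) z * phaseFun D E γ z = 1 := by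
  rw [phaseFun, phaseFun, ← Complex.exp_add, ← Complex.exp_zero]
  congr 1
  push_cast
  ring

/-- One layer of Heisenberg evolution. -/
theorem expectOn_succ (E : Finset (Sym2 V)) (D p : ℕ) (γ β : ℕ → ℝ)
    (O : Matrix (V → ℤˣ) (V → ℤˣ) ℂ) :
    expectOn E D (p + 1) γ β O = expectOn E D p γ β
      (Matrix.diagonal (phaseFun D E (-γ (p + 1))) *
        ((tensorOp fun _ => rotMat (β (p + 1))) * O * tensorOp fun _ => rotMat (-β (p + 1))) *
        Matrix.diagonal (phaseFun D E (γ (p + 1)))) := by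
  have hd : (Matrix.diagonal (phaseFun D E (γ (p + 1))))ᴴ =
      Matrix.diagonal (phaseFun D E (-γ (p + 1))) := by
    rw [Matrix.diagonal_conjTranspose]
    congr 1
    funext z
    exact star_phaseFun D E _ z
  rw [expectOn, stateOn, Matrix.star_mulVec, Matrix.star_mulVec, mixOp_conjTranspose, hd,
    expectOn, mixOp, Matrix.vecMul_vecMul, ← Matrix.dotProduct_mulVec, Matrix.mulVec_mulVec,
    Matrix.mulVec_mulVec, Matrix.mulVec_mulVec]
  simp only [Matrix.mul_assoc]

/-- Every layer is unitary. Besides the identity term of the energy, this yields the normalization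
of `f` in `sum_f`. -/
theorem expectOn_one (E : Finset (Sym2 V)) (D p : ℕ) (γ β : ℕ → ℝ) :
    expectOn E D p γ β 1 = 1 := by
  induction p with
  | zero =>
    rw [expectOn, stateOn, Matrix.one_mulVec]
    simp only [dotProduct, plusState, Pi.star_apply, star_pow, Finset.sum_const, Finset.card_univ]
    have hs : (Real.sqrt 2 : ℂ) * (Real.sqrt 2 : ℂ) = 2 := by
      rw [← Complex.ofReal_mul, Real.mul_self_sqrt (by norm_num)]; norm_num
    have h2 : star (1 / (Real.sqrt 2 : ℂ)) = 1 / (Real.sqrt 2 : ℂ) := by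
      change (starRingEnd ℂ) _ = _
      simp
    rw [h2, ← mul_pow, Fintype.card_fun, Fintype.card_units_int, nsmul_eq_mul, Nat.cast_pow,
      ← mul_pow, div_mul_div_comm, hs]
    norm_num
  | succ p ih =>
    rw [expectOn_succ, Matrix.mul_one, tensorOp_mul]
    simp only [rotMat_mul_neg, tensorOp_one, Matrix.mul_one, Matrix.diagonal_mul_diagonal,
      phaseFun_neg_mul]
    rwa [Matrix.diagonal_one]

end Quantum

/-! ### The light cone -/

section LightCone

variable {V : Type*} [Fintype V] [DecidableEq V]

/-- `O` acts trivially outside `S`: it commutes with every tensor operator that is trivial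
on `S`. -/
def SupportedOn (O : Matrix (V → ℤˣ) (V → ℤˣ) ℂ) (S : Finset V) : Prop :=
  ∀ M : V → Matrix ℤˣ ℤˣ ℂ, (∀ v ∈ S, M v = 1) → Commute O (tensorOp M)

theorem commute_tensorOp {M N : V → Matrix ℤˣ ℤˣ ℂ} (h : ∀ v, M v = 1 ∨ N v = 1) :
    Commute (tensorOp M) (tensorOp N) := by
  rw [Commute, SemiconjBy, tensorOp_mul, tensorOp_mul]
  congr 1
  funext v
  rcases h v with h | h <;> simp [h]

theorem supportedOn_onQubits (S : Finset V) (P : Matrix ℤˣ ℤˣ ℂ) :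
    SupportedOn (onQubits S P) S := fun M hM =>
  commute_tensorOp fun v => by
    by_cases hv : v ∈ S
    · exact Or.inr (hM v hv)
    · exact Or.inl (if_neg hv)

theorem SupportedOn.mul {A B : Matrix (V → ℤˣ) (V → ℤˣ) ℂ} {S : Finset V}
    (hA : SupportedOn A S) (hB : SupportedOn B S) : SupportedOn (A * B) S :=
  fun M hM => (hA M hM).mul_left (hB M hM)

theorem SupportedOn.mono {A : Matrix (V → ℤˣ) (V → ℤˣ) ℂ} {S T : Finset V}
    (hA : SupportedOn A S) (h : S ⊆ T) : SupportedOn A T :=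
  fun M hM => hA M fun v hv => hM v (h hv)

/-- The mixing layer splits into a factor on S and a factor on its complement. The second factor
commutes with O and cancels against its inverse. -/
theorem SupportedOn.conj_mix {O : Matrix (V → ℤˣ) (V → ℤˣ) ℂ} {S : Finset V}
    (hO : SupportedOn O S) (β : ℝ) :
    SupportedOn ((tensorOp fun _ => rotMat β) * O * tensorOp fun _ => rotMat (-β)) S := by
  have hsplit : ∀ θ : ℝ, (tensorOp fun _ : V => rotMat θ) =
      onQubits S (rotMat θ) * onQubits Sᶜ (rotMat θ) := fun θ => by
    rw [onQubits, onQubits, tensorOp_mul]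
    congr 1
    funext v
    by_cases hv : v ∈ S <;> simp [hv]
  have hcomm : Commute (onQubits S (rotMat (-β))) (onQubits Sᶜ (rotMat (-β))) :=
    supportedOn_onQubits S _ _ fun v hv => by simp [hv]
  have hO' : Commute O (onQubits Sᶜ (rotMat (-β))) := hO _ fun v hv => by simp [hv]
  have hinv : onQubits Sᶜ (rotMat β) * onQubits Sᶜ (rotMat (-β)) = 1 := by
    rw [onQubits, onQubits, tensorOp_mul, ← tensorOp_one]
    congr 1
    funext v
    by_cases hv : v ∈ S <;> simp [hv, rotMat_mul_neg]
  have : (tensorOp fun _ => rotMat β) * O * (tensorOp fun _ => rotMat (-β)) =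
      onQubits S (rotMat β) * O * onQubits S (rotMat (-β)) := by
    rw [hsplit, hsplit, hcomm.eq]
    calc _ = onQubits S (rotMat β) * (onQubits Sᶜ (rotMat β) *
            (O * onQubits Sᶜ (rotMat (-β)))) * onQubits S (rotMat (-β)) := by
          simp only [Matrix.mul_assoc]
      _ = _ := by rw [hO'.eq, ← Matrix.mul_assoc (onQubits Sᶜ _), hinv, Matrix.one_mul]
  rw [this]
  exact ((supportedOn_onQubits S _).mul hO).mul (supportedOn_onQubits S _)

theorem edgeSgn_sq (z : V → ℤˣ) (e : Sym2 V) : edgeSgn z e = 1 ∨ edgeSgn z e = -1 := by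
  have h : edgeSgn z e = sgn (∏ v ∈ e.toFinset, z v) := by
    simp [edgeSgn, sgn]
  rw [h]
  rcases Int.units_eq_one_or (∏ v ∈ e.toFinset, z v) with h | h <;> rw [h]
  · exact Or.inl sgn_one
  · exact Or.inr sgn_neg_one

/-- The edge operator squares to one, so its exponential is a combination of it and the identity.
Whatever commutes with the edge operator therefore commutes with its phase. -/
theorem diagonal_exp_edgeSgn (c : ℂ) (e : Sym2 V) :
    (Matrix.diagonal fun z : V → ℤˣ => Complex.exp (c * edgeSgn z e)) =
      Complex.cosh c • (1 : Matrix (V → ℤˣ) (V → ℤˣ) ℂ) +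
        Complex.sinh c • onQubits e.toFinset pauliZ := by
  have hz : ∀ z : V → ℤˣ, ∏ v ∈ e.toFinset, sgn (z v) = edgeSgn z e := fun _ => rfl
  rw [onQubits_pauliZ]
  ext z w
  simp only [Matrix.diagonal_apply, Matrix.add_apply, Matrix.smul_apply, Matrix.one_apply,
    smul_eq_mul, hz]
  by_cases h : z = w
  · simp only [if_pos h]
    rcases edgeSgn_sq z e with h | h <;> rw [h]
    · rw [mul_one, mul_one, mul_one, Complex.cosh_add_sinh]
    · rw [mul_one, mul_neg, mul_neg, mul_one, mul_one, ← sub_eq_add_neg, Complex.cosh_sub_sinh]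
  · simp [h]

theorem phaseFun_insert (D : ℕ) {E : Finset (Sym2 V)} {e : Sym2 V} (he : e ∉ E) (γ : ℝ)
    (z : V → ℤˣ) : phaseFun D (insert e E) γ z =
      Complex.exp (Complex.I / (Real.sqrt D : ℂ) * γ * edgeSgn z e) * phaseFun D E γ z := by
  rw [phaseFun, Finset.sum_insert he, mul_add, Complex.exp_add, phaseFun]

theorem commute_phaseFun (D : ℕ) (E : Finset (Sym2 V)) (γ : ℝ)
    {O : Matrix (V → ℤˣ) (V → ℤˣ) ℂ}
    (h : ∀ e ∈ E, Commute O (onQubits e.toFinset pauliZ)) :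
    Commute O (Matrix.diagonal (phaseFun D E γ)) := by
  induction E using Finset.induction_on with
  | empty =>
    have : (phaseFun D (∅ : Finset (Sym2 V)) γ) = fun _ => 1 := by
      funext z; simp [phaseFun]
    rw [this, Matrix.diagonal_one]
    exact Commute.one_right _
  | insert e E he ih =>
    have : (phaseFun D (insert e E) γ) = fun z => Complex.exp
        (Complex.I / (Real.sqrt D : ℂ) * γ * edgeSgn z e) * phaseFun D E γ z :=
      funext (phaseFun_insert D he γ)
    rw [this, ← Matrix.diagonal_mul_diagonal, diagonal_exp_edgeSgn]
    refine Commute.mul_right (Commute.add_right ?_ ?_)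
      (ih fun e' he' => h e' (Finset.mem_insert_of_mem he'))
    · exact (Commute.one_right _).smul_right _
    · exact (h e (Finset.mem_insert_self _ _)).smul_right _

/-- The edges of `E` with an endpoint in `S`. -/
def touching (E : Finset (Sym2 V)) (S : Finset V) : Finset (Sym2 V) :=
  E.filter fun e => ¬ Disjoint e.toFinset S

/-- Phases of edges disjoint from S commute with O and cancel between the two sides. -/
theorem SupportedOn.conj_phase_eq {O : Matrix (V → ℤˣ) (V → ℤˣ) ℂ} {S : Finset V}
    (hO : SupportedOn O S) (D : ℕ) (E : Finset (Sym2 V)) (γ : ℝ) :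
    Matrix.diagonal (phaseFun D E (-γ)) * O * Matrix.diagonal (phaseFun D E γ) =
      Matrix.diagonal (phaseFun D (touching E S) (-γ)) * O *
        Matrix.diagonal (phaseFun D (touching E S) γ) := by
  let F := E.filter fun e => ¬ ¬ Disjoint e.toFinset S
  have hsplit : ∀ θ : ℝ, phaseFun D E θ =
      fun z => phaseFun D (touching E S) θ z * phaseFun D F θ z := fun θ => by
    funext z
    rw [phaseFun, phaseFun, phaseFun, ← Complex.exp_add, ← mul_add, touching,
      Finset.sum_filter_add_sum_filter_not]
  have hO' : Commute O (Matrix.diagonal (phaseFun D F γ)) :=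
    commute_phaseFun D F γ fun e he => hO _ fun v hv => if_neg fun hv' =>
      Finset.disjoint_left.1 (not_not.1 (Finset.mem_filter.1 he).2) hv' hv
  have hc : Commute (Matrix.diagonal (phaseFun D (touching E S) γ))
      (Matrix.diagonal (phaseFun D F γ)) := by
    rw [Commute, SemiconjBy, Matrix.diagonal_mul_diagonal, Matrix.diagonal_mul_diagonal]
    congr 1
    funext z
    exact mul_comm _ _
  have hinv : Matrix.diagonal (phaseFun D F (-γ)) * Matrix.diagonal (phaseFun D F γ) = 1 := by
    simp only [Matrix.diagonal_mul_diagonal, phaseFun_neg_mul]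
    exact Matrix.diagonal_one
  rw [hsplit, hsplit, ← Matrix.diagonal_mul_diagonal, ← Matrix.diagonal_mul_diagonal, hc.eq]
  calc _ = Matrix.diagonal (phaseFun D (touching E S) (-γ)) *
        (Matrix.diagonal (phaseFun D F (-γ)) * (O * Matrix.diagonal (phaseFun D F γ))) *
        Matrix.diagonal (phaseFun D (touching E S) γ) := by
        simp only [Matrix.mul_assoc]
    _ = _ := by rw [hO'.eq, ← Matrix.mul_assoc (Matrix.diagonal (phaseFun D F (-γ))), hinv,
        Matrix.one_mul]

theorem SupportedOn.phase {E : Finset (Sym2 V)} {S : Finset V}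
    (h : ∀ e ∈ E, e.toFinset ⊆ S) (D : ℕ) (γ : ℝ) :
    SupportedOn (Matrix.diagonal (phaseFun D E γ)) S := fun M hM =>
  (commute_phaseFun D E γ fun e he => commute_tensorOp fun v => by
    by_cases hv : v ∈ e.toFinset
    · exact Or.inl (hM v (h e he hv))
    · exact Or.inr (if_neg hv)).symm

/-- Edges outside the light cone do not matter. -/
theorem expectOn_eq_of_lightCone (E E' : Finset (Sym2 V)) (hE : E' ⊆ E) (D : ℕ) (γ β : ℕ → ℝ)
    (B : ℕ → Finset V) (hB : ∀ j, B j ⊆ B (j + 1))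
    (hnbr : ∀ j, ∀ e ∈ E, ¬ Disjoint e.toFinset (B j) → e.toFinset ⊆ B (j + 1)) (p : ℕ) :
    ∀ (j : ℕ) (O : Matrix (V → ℤˣ) (V → ℤˣ) ℂ), SupportedOn O (B j) →
      (∀ e ∈ E, e ∉ E' → ∀ k < j + p, Disjoint e.toFinset (B k)) →
      expectOn E D p γ β O = expectOn E' D p γ β O := by
  induction p with
  | zero => intro j O _ _; rfl
  | succ p ih =>
    intro j O hO hout
    -- After the mixer the support is still in B j, so this layer involves only edges touching B j.
    -- None of the deleted edges does.
    have ht : touching E (B j) = touching E' (B j) := by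
      ext e
      simp only [touching, Finset.mem_filter]
      refine ⟨fun h => ⟨?_, h.2⟩, fun h => ⟨hE h.1, h.2⟩⟩
      by_contra hne
      exact h.2 (hout e h.1 hne j (by omega))
    have hO' := hO.conj_mix (β (p + 1))
    rw [expectOn_succ, expectOn_succ, hO'.conj_phase_eq, hO'.conj_phase_eq D E', ← ht]
    refine ih (j + 1) _ ?_ fun e he hne k hk => hout e he hne k (by omega)
    have hs : ∀ e ∈ touching E (B j), e.toFinset ⊆ B (j + 1) := fun e he =>
      hnbr j e (Finset.mem_filter.1 he).1 (Finset.mem_filter.1 he).2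
    exact ((SupportedOn.phase hs D _).mul (hO'.mono (hB j))).mul (SupportedOn.phase hs D _)

end LightCone

/-! ### Sums over paths -/

/-- Iterated application of transfer matrices `M k` and diagonal weights `d k`. -/
def rowVec {X : Type*} [Fintype X] (d : ℕ → X → ℂ) (M : ℕ → X → X → ℂ) : ℕ → X → ℂ
  | 0, y => d 0 y
  | k + 1, y => (∑ x, rowVec d M k x * M k x y) * d (k + 1) y

/-- Unrolls a product of transfer matrices into a sum over paths. The test function is arbitrary so
that, in the induction, the last matrix can be absorbed into it. -/
theorem sum_rowVec_mul {X : Type*} [Fintype X] (d : ℕ → X → ℂ) (M : ℕ → X → X → ℂ) (n : ℕ) :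
    ∀ h : X → ℂ, ∑ y, rowVec d M n y * h y = ∑ x : Fin (n + 1) → X,
      (∏ k : Fin (n + 1), d k (x k)) * (∏ k : Fin n, M k (x k.castSucc) (x k.succ)) *
        h (x (Fin.last n)) := by
  induction n with
  | zero =>
    intro h
    rw [← (Equiv.funUnique (Fin 1) X).symm.sum_comp]
    simp [rowVec]
  | succ n ih =>
    intro h
    have h1 : ∑ y, rowVec d M (n + 1) y * h y =
        ∑ x, rowVec d M n x * ∑ y, M n x y * d (n + 1) y * h y := by
      simp only [rowVec, Finset.sum_mul, Finset.mul_sum]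
      rw [Finset.sum_comm]
      exact Finset.sum_congr rfl fun x _ => Finset.sum_congr rfl fun y _ => by ring
    rw [h1, ih, ← (Fin.snocEquiv fun _ : Fin (n + 2) => X).sum_comp, Fintype.sum_prod_type_right]
    refine Finset.sum_congr rfl fun x _ => ?_
    rw [Finset.mul_sum]
    refine Finset.sum_congr rfl fun y _ => ?_
    have hs : (Fin.last n).succ = Fin.last (n + 1) := rfl
    have hM : ∏ k : Fin (n + 1), M k (Fin.snoc (α := fun _ => X) x y k.castSucc)
        (Fin.snoc (α := fun _ => X) x y k.succ) =
        (∏ k : Fin n, M k (x k.castSucc) (x k.succ)) * M n (x (Fin.last n)) y := by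
      rw [Fin.prod_univ_castSucc]
      simp only [← Fin.castSucc_succ, Fin.snoc_castSucc, hs, Fin.snoc_last, Fin.val_castSucc,
        Fin.val_last]
    have hd : ∏ k : Fin (n + 2), d k (Fin.snoc (α := fun _ => X) x y k) =
        (∏ k : Fin (n + 1), d k (x k)) * d (n + 1) y := by
      rw [Fin.prod_univ_castSucc]
      simp only [Fin.snoc_castSucc, Fin.snoc_last, Fin.val_castSucc, Fin.val_last]
    simp only [Fin.snocEquiv, Equiv.coe_fn_mk]
    rw [hM, hd, Fin.snoc_last]
    ring

section PathIntegral

variable {V : Type*} [Fintype V] [DecidableEq V]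

theorem stateOn_succ_apply (E : Finset (Sym2 V)) (D : ℕ) (γ β : ℕ → ℝ) (p : ℕ) (y : V → ℤˣ) :
    stateOn E D γ β (p + 1) y = ∑ x, (∏ v, rotX (-β (p + 1)) (y v) (x v)) *
      phaseFun D E (γ (p + 1)) x * stateOn E D γ β p x := by
  simp only [stateOn, Matrix.mulVec, mixOp, tensorOp, dotProduct, Matrix.of_apply, rotMat,
    Matrix.diagonal_apply, ite_mul, zero_mul, Finset.sum_ite_eq, Finset.mem_univ, if_true,
    mul_assoc]

theorem star_stateOn_succ_apply (E : Finset (Sym2 V)) (D : ℕ) (γ β : ℕ → ℝ) (p : ℕ)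
    (y : V → ℤˣ) :
    star (stateOn E D γ β (p + 1) y) = ∑ x, star (stateOn E D γ β p x) *
      phaseFun D E (-γ (p + 1)) x * ∏ v, rotX (β (p + 1)) (x v) (y v) := by
  rw [stateOn_succ_apply, star_sum]
  refine Finset.sum_congr rfl fun x _ => ?_
  rw [star_mul, star_mul, star_phaseFun, star_prod, mul_assoc]
  congr 2
  exact Finset.prod_congr rfl fun v _ => by rw [star_rotX, neg_neg, rotX_symm]

/-- `bigGamma` at a natural number. -/
def gammaAt (p : ℕ) (γ : ℕ → ℝ) (k : ℕ) : ℝ :=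
  if k < p then γ (k + 1) else if k = p then 0 else -γ (2 * p + 1 - k)

/-- `chainAngle` at a natural number. -/
def angleAt (p : ℕ) (β : ℕ → ℝ) (k : ℕ) : ℝ :=
  if k < p then β (k + 1) else -β (2 * p - k)

/-- The single-qubit operator `w ↦ c w |s w⟩`. -/
def flipOp (s : ℤˣ) (c : ℤˣ → ℂ) : Matrix ℤˣ ℤˣ ℂ :=
  Matrix.of fun z w => if z = s * w then c w else 0

/-- The weight of a string in the path integral with the operator `flipOp s c` in the middle. -/
def strWeight {p : ℕ} (β : ℕ → ℝ) (s : ℤˣ) (c : ℤˣ → ℂ) (a : Str p) : ℂ :=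
  c (a ⟨p, by omega⟩) * (1 / 2 * ∏ k : Fin (2 * p), rotX (chainAngle p β k) (a k.castSucc)
    (if (k : ℕ) + 1 = p then s * a k.succ else a k.succ))

/-- The phase of an edge in the path integral. -/
def edgeDot {p : ℕ} (γ : ℕ → ℝ) (a : V → Str p) (e : Sym2 V) : ℂ :=
  ∑ k, (bigGamma p γ k : ℂ) * edgeSgn (fun v => a v k) e

theorem vecMul_tensorOp_flipOp (s : V → ℤˣ) (c : V → ℤˣ → ℂ) (ψ : (V → ℤˣ) → ℂ) (w : V → ℤˣ) :
    (ψ ᵥ* tensorOp fun v => flipOp (s v) (c v)) w = ψ (s * w) * ∏ v, c v (w v) := by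
  simp only [Matrix.vecMul, dotProduct, tensorOp, flipOp, Matrix.of_apply]
  rw [Finset.sum_eq_single (s * w)]
  · simp
  · intro z _ hz
    obtain ⟨v, hv⟩ := Function.ne_iff.1 hz
    rw [Finset.prod_eq_zero (Finset.mem_univ v), mul_zero]
    exact if_neg hv
  · simp

/-- The bra supplies the first p transfer matrices, the observable sits at position p, and the ket
supplies the other p. The flip in the observable is absorbed into the last bra rotation, at k + 1 =
p; this is where `f'` comes from. -/
theorem expectOn_eq_sum_rowVec (E : Finset (Sym2 V)) (D p : ℕ) (hp : 1 ≤ p) (γ β : ℕ → ℝ)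
    (s : V → ℤˣ) (c : V → ℤˣ → ℂ) :
    expectOn E D p γ β (tensorOp fun v => flipOp (s v) (c v)) =
      (1 / 2) ^ Fintype.card V * ∑ y, rowVec
        (fun k z => phaseFun D E (-gammaAt p γ k) z * if k = p then ∏ v, c v (z v) else 1)
        (fun k x y => ∏ v, rotX (angleAt p β k) (x v) (if k + 1 = p then s v * y v else y v))
        (2 * p) y := by
  set d : ℕ → (V → ℤˣ) → ℂ :=
    fun k z => phaseFun D E (-gammaAt p γ k) z * if k = p then ∏ v, c v (z v) else 1 with hd
  set M : ℕ → (V → ℤˣ) → (V → ℤˣ) → ℂ :=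
    fun k x y => ∏ v, rotX (angleAt p β k) (x v) (if k + 1 = p then s v * y v else y v) with hM
  let κ : ℂ := (1 / (Real.sqrt 2 : ℂ)) ^ Fintype.card V
  have hκ : star κ = κ := by
    change (starRingEnd ℂ) _ = _
    simp [κ]
  have hκ2 : κ * κ = (1 / 2) ^ Fintype.card V := by
    have hs : (Real.sqrt 2 : ℂ) * (Real.sqrt 2 : ℂ) = 2 := by
      rw [← Complex.ofReal_mul, Real.mul_self_sqrt (by norm_num)]; norm_num
    rw [← mul_pow, div_mul_div_comm, hs, one_mul]
  have hbra : ∀ k < p, ∀ x, κ * rowVec d M k x =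
      star (stateOn E D γ β k x) * phaseFun D E (-γ (k + 1)) x := by
    intro k
    induction k with
    | zero =>
      intro hk x
      have : star (stateOn E D γ β 0 x) = κ := hκ
      rw [this, rowVec, hd]
      simp [gammaAt, hk, hk.ne]
    | succ k ih =>
      intro hk x
      rw [star_stateOn_succ_apply, rowVec, ← mul_assoc, Finset.mul_sum]
      congr 1
      · refine Finset.sum_congr rfl fun y _ => ?_
        rw [← mul_assoc, ih (by omega)]
        simp [hM, angleAt, show k < p by omega, hk.ne]
      · simp [hd, gammaAt, hk, hk.ne]
  -- Position p carries no phase because Γ vanishes there; it carries only the coefficients of the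
  -- observable.
  have hmid : ∀ y, κ * rowVec d M p y =
      star (stateOn E D γ β p (s * y)) * ∏ v, c v (y v) := by
    obtain ⟨q, rfl⟩ : ∃ q, p = q + 1 := ⟨p - 1, by omega⟩
    intro y
    rw [star_stateOn_succ_apply, rowVec, ← mul_assoc, Finset.mul_sum]
    congr 1
    · refine Finset.sum_congr rfl fun x _ => ?_
      rw [← mul_assoc, hbra q (by omega)]
      simp [hM, angleAt]
    · simp [hd, gammaAt, phaseFun]
  -- The layers of the ket are transferred to the row vector one at a time. At j = p only the
  -- constant κ of the initial state is left, which pairs with the κ of the bra.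
  have hket : ∀ j ≤ p, ∑ y, κ * rowVec d M (p + j) y * stateOn E D γ β (p - j) y =
      expectOn E D p γ β (tensorOp fun v => flipOp (s v) (c v)) := by
    intro j
    induction j with
    | zero =>
      intro _
      rw [expectOn, Matrix.dotProduct_mulVec]
      refine Finset.sum_congr rfl fun y _ => ?_
      rw [vecMul_tensorOp_flipOp, Nat.add_zero, Nat.sub_zero, hmid]
      rfl
    | succ j ih =>
      intro hj
      rw [← ih (by omega)]
      obtain ⟨q, hq⟩ : ∃ q, p - j = q + 1 := ⟨p - j - 1, by omega⟩
      rw [hq, show p - (j + 1) = q by omega]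
      simp only [stateOn_succ_apply, Finset.mul_sum]
      rw [Finset.sum_comm]
      refine Finset.sum_congr rfl fun x _ => ?_
      rw [← add_assoc, rowVec, ← mul_assoc, Finset.mul_sum, Finset.sum_mul, Finset.sum_mul]
      refine Finset.sum_congr rfl fun y _ => ?_
      have h1 : d (p + j + 1) x = phaseFun D E (γ (q + 1)) x := by
        simp only [hd, gammaAt]
        rw [if_neg (by omega), if_neg (by omega), if_neg (by omega), neg_neg, mul_one,
          show 2 * p + 1 - (p + j + 1) = q + 1 by omega]
      have h2 : M (p + j) y x = ∏ v, rotX (-β (q + 1)) (y v) (x v) := by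
        simp only [hM, angleAt]
        rw [if_neg (by omega), show 2 * p - (p + j) = q + 1 by omega]
        simp only [if_neg (show ¬ p + j + 1 = p by omega)]
      rw [h1, h2]
      ring
  rw [← hket p le_rfl, ← hκ2, Finset.mul_sum, ← two_mul, Nat.sub_self]
  refine Finset.sum_congr rfl fun y _ => ?_
  rw [show stateOn E D γ β 0 y = κ from rfl]
  ring

/-- The path-integral form of an expectation value. -/
theorem expectOn_eq_sum_strings (E : Finset (Sym2 V)) (D p : ℕ) (hp : 1 ≤ p) (γ β : ℕ → ℝ)
    (s : V → ℤˣ) (c : V → ℤˣ → ℂ) :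
    expectOn E D p γ β (tensorOp fun v => flipOp (s v) (c v)) =
      ∑ a : V → Str p, (∏ v, strWeight β (s v) (c v) (a v)) *
        ∏ e ∈ E, Complex.exp (-(Complex.I / (Real.sqrt D : ℂ)) * edgeDot γ a e) := by
  rw [expectOn_eq_sum_rowVec E D p hp]
  have h := sum_rowVec_mul
    (fun k (z : V → ℤˣ) =>
      phaseFun D E (-gammaAt p γ k) z * if k = p then ∏ v, c v (z v) else 1)
    (fun k x y => ∏ v, rotX (angleAt p β k) (x v) (if k + 1 = p then s v * y v else y v))
    (2 * p) (fun _ => 1)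
  simp only [mul_one] at h
  -- A path of spin configurations is the same as one string per vertex. This exchange of indices
  -- turns the transfer-matrix product into vertex weights and edge phases.
  rw [h, ← (Equiv.piComm fun (_ : V) (_ : Fin (2 * p + 1)) => ℤˣ).sum_comp, Finset.mul_sum]
  refine Finset.sum_congr rfl fun a _ => ?_
  have hsw : (Equiv.piComm fun (_ : V) (_ : Fin (2 * p + 1)) => ℤˣ) a = fun k v => a v k := rfl
  rw [hsw]
  have h1 : ∏ v, strWeight β (s v) (c v) (a v) =
      (1 / 2) ^ Fintype.card V * (∏ v, c v (a v ⟨p, by omega⟩)) *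
        ∏ k : Fin (2 * p), ∏ v, rotX (angleAt p β k) (a v k.castSucc)
          (if (k : ℕ) + 1 = p then s v * a v k.succ else a v k.succ) := by
    simp only [strWeight, Finset.prod_mul_distrib, Finset.prod_const, Finset.card_univ]
    rw [Finset.prod_comm]
    simp only [chainAngle, angleAt]
    ring
  have h2 : (∏ k : Fin (2 * p + 1), if (k : ℕ) = p then ∏ v, c v (a v k) else 1) =
      ∏ v, c v (a v ⟨p, by omega⟩) := by
    rw [Finset.prod_eq_single ⟨p, by omega⟩]
    · simp
    · intro k _ hk
      exact if_neg fun h => hk (Fin.ext h)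
    · simp
  have h3 : ∏ k : Fin (2 * p + 1), phaseFun D E (-gammaAt p γ k) (fun v => a v k) =
      ∏ e ∈ E, Complex.exp (-(Complex.I / (Real.sqrt D : ℂ)) * edgeDot γ a e) := by
    simp only [phaseFun, edgeDot]
    rw [← Complex.exp_sum, ← Complex.exp_sum]
    congr 1
    simp only [Finset.mul_sum]
    rw [Finset.sum_comm]
    refine Finset.sum_congr rfl fun e _ => Finset.sum_congr rfl fun k _ => ?_
    have : bigGamma p γ k = gammaAt p γ k := rfl
    rw [this]
    push_cast
    ring
  rw [Finset.prod_mul_distrib, h2, h3, h1]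
  ring

end PathIntegral

/-! ### Balls around an edge of a graph of large girth -/

section Girth

variable {V : Type*} {G : SimpleGraph V}

/-- Two different walks between the same endpoints give a short cycle. -/
theorem egirth_le_of_walks {v u u' w : V} (P : G.Walk u w) (P' : G.Walk u' w)
    (hv : v ∉ P.support) (hv' : v ∉ P'.support) (hu : G.Adj v u) (hu' : G.Adj v u')
    (hne : u ≠ u') : G.egirth ≤ ((P.length + P'.length + 2 : ℕ) : ℕ∞) := by
  classical
  let q : G.Walk v w := SimpleGraph.Walk.cons hu P.bypass
  let q' : G.Walk v w := SimpleGraph.Walk.cons hu' P'.bypass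
  have hq : q.IsPath := (SimpleGraph.Walk.cons_isPath_iff _ _).2
    ⟨P.bypass_isPath, fun h => hv (P.support_bypass_subset_support h)⟩
  have hq' : q'.IsPath := (SimpleGraph.Walk.cons_isPath_iff _ _).2
    ⟨P'.bypass_isPath, fun h => hv' (P'.support_bypass_subset_support h)⟩
  -- The cycle is sought in the subgraph spanned by the two paths, so that its length is bounded by
  -- the number of their edges.
  let s : Finset (Sym2 V) := q.edges.toFinset ∪ q'.edges.toFinset
  let H : SimpleGraph V := SimpleGraph.fromEdgeSet s
  have hs : ∀ e ∈ s, e ∈ G.edgeSet := fun e he => by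
    rcases Finset.mem_union.1 he with h | h
    · exact q.edges_subset_edgeSet (List.mem_toFinset.1 h)
    · exact q'.edges_subset_edgeSet (List.mem_toFinset.1 h)
  have hHs : ∀ e, e ∈ H.edgeSet ↔ e ∈ s := fun e => by
    rw [SimpleGraph.edgeSet_fromEdgeSet]
    exact ⟨fun h => h.1, fun h => ⟨h, G.not_isDiag_of_mem_edgeSet (hs e h)⟩⟩
  have hHG : H ≤ G := by
    rw [← SimpleGraph.edgeSet_subset_edgeSet]
    exact fun e he => hs e ((hHs e).1 he)
  have h1 : ∀ e ∈ q.edges, e ∈ H.edgeSet := fun e he =>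
    (hHs e).2 (Finset.mem_union_left _ (List.mem_toFinset.2 he))
  have h2 : ∀ e ∈ q'.edges, e ∈ H.edgeSet := fun e he =>
    (hHs e).2 (Finset.mem_union_right _ (List.mem_toFinset.2 he))
  -- In an acyclic graph paths are determined by their endpoints, while these two already differ at
  -- the vertex after v.
  have hcyc : ¬ H.IsAcyclic := fun hac => by
    have := (hac.subsingleton_path v w).elim ⟨q.transfer H h1, hq.transfer h1⟩
      ⟨q'.transfer H h2, hq'.transfer h2⟩
    have hsupp := congrArg (fun r : H.Path v w => r.1.support) this
    simp only [SimpleGraph.Walk.support_transfer, q, q', SimpleGraph.Walk.support_cons,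
      List.cons.injEq, true_and] at hsupp
    have hh := congrArg List.head? hsupp
    rw [List.head?_eq_some_head (SimpleGraph.Walk.support_ne_nil _),
      List.head?_eq_some_head (SimpleGraph.Walk.support_ne_nil _)] at hh
    simp at hh
    exact hne hh
  rw [SimpleGraph.IsAcyclic] at hcyc
  push Not at hcyc
  obtain ⟨x, c, hc⟩ := hcyc
  have hlen : c.length ≤ P.length + P'.length + 2 := by
    have hc1 : c.edges.toFinset ⊆ s := fun e he =>
      (hHs e).1 (c.edges_subset_edgeSet (List.mem_toFinset.1 he))
    have hc2 := Finset.card_le_card hc1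
    rw [List.toFinset_card_of_nodup hc.edges_nodup, SimpleGraph.Walk.length_edges] at hc2
    have hc3 := Finset.card_union_le q.edges.toFinset q'.edges.toFinset
    have hc4 := q.edges.toFinset_card_le
    have hc5 := q'.edges.toFinset_card_le
    rw [SimpleGraph.Walk.length_edges] at hc4 hc5
    have hc6 : q.length = P.bypass.length + 1 := rfl
    have hc7 : q'.length = P'.bypass.length + 1 := rfl
    have hc8 := P.length_bypass_le_length
    have hc9 := P'.length_bypass_le_length
    change c.length ≤ s.card at hc2
    change s.card ≤ _ at hc3
    omega
  calc G.egirth ≤ ((c.mapLe hHG).length : ℕ∞) :=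
        SimpleGraph.egirth_le_length (hc.mapLe hHG)
    _ ≤ _ := by
        rw [SimpleGraph.Walk.length_mapLe]
        exact_mod_cast hlen

/-- `u` is joined to `L` or `R` by a walk of length at most `n` that avoids `v`. -/
def ReachAvoiding (G : SimpleGraph V) (L R v u : V) (n : ℕ) : Prop :=
  ∃ w, (w = L ∨ w = R) ∧ ∃ P : G.Walk u w, P.length ≤ n ∧ v ∉ P.support

theorem ReachAvoiding.mono {L R v u : V} {n m : ℕ} (h : ReachAvoiding G L R v u n) (hnm : n ≤ m) :
    ReachAvoiding G L R v u m :=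
  let ⟨w, hw, P, hP, hv⟩ := h
  ⟨w, hw, P, hP.trans hnm, hv⟩

theorem ReachAvoiding.cons {L R v u x : V} {n : ℕ} (h : ReachAvoiding G L R v u n)
    (hx : G.Adj x u) (hvx : v ≠ x) : ReachAvoiding G L R v x (n + 1) :=
  let ⟨w, hw, P, hP, hv⟩ := h
  ⟨w, hw, SimpleGraph.Walk.cons hx P, by simpa using hP, by simp [hvx, hv]⟩

/-- If u ≠ u', the two walks close up to a cycle through v. Besides n + n' it uses the two edges at
v and possibly the edge LR, when the walks end at different roots; hence n + n' + 3. -/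
theorem eq_of_reachAvoiding {L R v u u' : V} {n n' : ℕ} (hLR : G.Adj L R) (hvL : v ≠ L)
    (hvR : v ≠ R) (h : ReachAvoiding G L R v u n) (h' : ReachAvoiding G L R v u' n')
    (hu : G.Adj v u) (hu' : G.Adj v u') (hg : ((n + n' + 3 : ℕ) : ℕ∞) < G.egirth) : u = u' := by
  by_contra hne
  have key : ∀ {w : V} (P : G.Walk u w) (P' : G.Walk u' w), v ∉ P.support → v ∉ P'.support →
      P.length + P'.length ≤ n + n' + 1 → False := fun P P' hP hP' hl => by
    refine absurd (egirth_le_of_walks P P' hP hP' hu hu' hne) (not_le.2 (lt_of_le_of_lt ?_ hg))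
    exact_mod_cast (by omega : P.length + P'.length + 2 ≤ n + n' + 3)
  obtain ⟨w, hw, P, hP, hvP⟩ := h
  obtain ⟨w', hw', P', hP', hvP'⟩ := h'
  by_cases hww : w = w'
  · subst hww
    exact key P P' hvP hvP' (by omega)
  · have hadj : G.Adj w' w := by
      rcases hw with rfl | rfl <;> rcases hw' with rfl | rfl
      · exact absurd rfl hww
      · exact hLR.symm
      · exact hLR
      · exact absurd rfl hww
    have hvw : v ≠ w := by rcases hw with rfl | rfl <;> assumption
    refine key P (P'.concat hadj) hvP ?_ ?_
    · rw [SimpleGraph.Walk.support_concat]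
      simp [hvP', hvw]
    · rw [SimpleGraph.Walk.length_concat]
      omega

end Girth

section Ball

variable {V : Type*} [Fintype V] [DecidableEq V] (G : SimpleGraph V) [DecidableRel G.Adj]

/-- The vertices at distance at most `j` from `{L, R}`. -/
def ball (L R : V) : ℕ → Finset V
  | 0 => {L, R}
  | j + 1 => ball L R j ∪ Finset.univ.filter fun v => ∃ u ∈ ball L R j, G.Adj v u

theorem ball_subset_succ (L R : V) (j : ℕ) : ball G L R j ⊆ ball G L R (j + 1) :=
  Finset.subset_union_left

theorem ball_mono (L R : V) : Monotone (ball G L R) :=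
  monotone_nat_of_le_succ (ball_subset_succ G L R)

theorem mem_ball_succ {L R v : V} {j : ℕ} :
    v ∈ ball G L R (j + 1) ↔ v ∈ ball G L R j ∨ ∃ u ∈ ball G L R j, G.Adj v u := by
  simp [ball]

theorem ne_of_notMem_ball {L R v : V} {j : ℕ} (h : v ∉ ball G L R j) : v ≠ L ∧ v ≠ R := by
  have h0 : v ∉ ball G L R 0 := fun h' => h (ball_mono G L R (Nat.zero_le j) h')
  simpa [ball] using h0

/-- Stepping inwards through the balls gives a walk that never leaves the ball, so it misses any v
outside. -/
theorem reachAvoiding_of_mem_ball {L R v : V} (j : ℕ) : ∀ {u : V}, u ∈ ball G L R j →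
    v ∉ ball G L R j → ReachAvoiding G L R v u j := by
  induction j with
  | zero =>
    intro u hu hv
    have hne : v ≠ u := fun h => hv (h ▸ hu)
    refine ⟨u, by simpa [ball] using hu, SimpleGraph.Walk.nil, by simp, by simpa using hne⟩
  | succ j ih =>
    intro u hu hv
    have hv' : v ∉ ball G L R j := fun h => hv (ball_subset_succ G L R j h)
    rcases (mem_ball_succ G).1 hu with h | ⟨u', hu', hadj⟩
    · exact (ih h hv').mono (Nat.le_succ j)
    · exact (ih hu' hv').cons hadj fun h => hv (h ▸ hu)

/-- The inner neighbour of a vertex at distance `j + 1` is unique. -/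
theorem parent_unique {L R v u u' : V} {p j : ℕ} (hLR : G.Adj L R)
    (hg : ((2 * p + 1 : ℕ) : ℕ∞) < G.egirth) (hj : j + 1 ≤ p) (hv : v ∉ ball G L R j)
    (hu : u ∈ ball G L R j) (hu' : u' ∈ ball G L R j) (hvu : G.Adj v u) (hvu' : G.Adj v u') :
    u = u' := by
  refine eq_of_reachAvoiding hLR (ne_of_notMem_ball G hv).1 (ne_of_notMem_ball G hv).2
    (reachAvoiding_of_mem_ball G j hu hv) (reachAvoiding_of_mem_ball G j hu' hv) hvu hvu'
    (lt_of_le_of_lt ?_ hg)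
  -- This is sharp at j + 1 = p: it uses the full girth hypothesis.
  exact_mod_cast (by omega : j + j + 3 ≤ 2 * p + 1)

/-- No edge joins two vertices at distance `j + 1`. -/
theorem not_adj_of_layer {L R v u : V} {p j : ℕ} (hLR : G.Adj L R)
    (hg : ((2 * p + 1 : ℕ) : ℕ∞) < G.egirth) (hj : j + 2 ≤ p)
    (hv : v ∈ ball G L R (j + 1)) (hv' : v ∉ ball G L R j)
    (hu : u ∈ ball G L R (j + 1)) (hu' : u ∉ ball G L R j) : ¬ G.Adj v u := by
  intro hvu
  obtain ⟨x, hx, hvx⟩ := ((mem_ball_succ G).1 hv).resolve_left hv'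
  obtain ⟨y, hy, huy⟩ := ((mem_ball_succ G).1 hu).resolve_left hu'
  have h1 := reachAvoiding_of_mem_ball G j hx hv'
  have h2 := (reachAvoiding_of_mem_ball G j hy hv').cons huy hvu.ne
  -- Both x and u are neighbours of v that reach the roots while avoiding v, in j and j + 1 steps.
  -- Here 2j + 4 ≤ 2p + 1 forces j + 2 ≤ p. Edges inside the outermost layer p may exist, but they
  -- do not belong to `treeEdges G L R p`.
  have : x = u := eq_of_reachAvoiding hLR (ne_of_notMem_ball G hv').1 (ne_of_notMem_ball G hv').2
    h1 h2 hvx hvu (lt_of_le_of_lt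
      (by exact_mod_cast (by omega : j + (j + 1) + 3 ≤ 2 * p + 1)) hg)
  exact hu' (this ▸ hx)

end Ball

/-! ### Summing out vertices -/

section SumOut

variable {V A : Type*} [Fintype V] [DecidableEq V] [Fintype A]

/-- Cross-multiplied, since weights may vanish. -/
theorem prod_update_mul (w : V → A → ℂ) (a : V → A) (v : V) (b : A) :
    (∏ u, w u (Function.update a v b u)) * w v (a v) = (∏ u, w u (a u)) * w v b := by
  rw [← Finset.mul_prod_erase _ _ (Finset.mem_univ v),
    ← Finset.mul_prod_erase _ (fun u => w u (a u)) (Finset.mem_univ v), Function.update_self]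
  have : ∏ u ∈ Finset.univ.erase v, w u (Function.update a v b u) =
      ∏ u ∈ Finset.univ.erase v, w u (a u) :=
    Finset.prod_congr rfl fun u hu => by rw [Function.update_of_ne (Finset.ne_of_mem_erase hu)]
  rw [this]
  ring

/-- If the weights at `v` add up to one, the value at `v` may be resampled. -/
theorem sum_resample (w : V → A → ℂ) (v : V) (hv : ∑ b, w v b = 1) (F : (V → A) → ℂ) :
    ∑ a : V → A, (∏ u, w u (a u)) * F a =
      ∑ a : V → A, (∏ u, w u (a u)) * ∑ b, w v b * F (Function.update a v b) := by
  -- Exchanging the value at v with an independent fresh value is an involution that preserves the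
  -- total weight of the pair.
  have hinv : Function.Involutive fun x : (V → A) × A => (Function.update x.1 v x.2, x.1 v) := by
    rintro ⟨a, b⟩
    simp
  have h := Equiv.sum_comp (hinv.toPerm _) fun x : (V → A) × A =>
    (∏ u, w u (x.1 u)) * (w v x.2 * F (Function.update x.1 v x.2))
  simp only [Function.Involutive.coe_toPerm, Function.update_idem, Function.update_eq_self] at h
  rw [Fintype.sum_prod_type, Fintype.sum_prod_type] at h
  simp only [Finset.mul_sum]
  rw [← h]
  refine Finset.sum_congr rfl fun a _ => ?_
  calc (∏ u, w u (a u)) * F a = (∏ u, w u (a u)) * (∑ b, w v b) * F a := by rw [hv, mul_one]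
    _ = ∑ b, (∏ u, w u (a u)) * w v b * F a := by rw [Finset.mul_sum, Finset.sum_mul]
    _ = _ := Finset.sum_congr rfl fun b _ => by rw [← prod_update_mul]; ring

/-- A leaf occurs only in its own weight and in the factor linking it to its parent. The parents lie
outside T, so the leaves can be averaged independently with the parents fixed. -/
theorem sum_leaves (w : V → A → ℂ) (T : Finset V) (hT : ∀ v ∈ T, ∑ b, w v b = 1) (π : V → V)
    (hπ : ∀ v ∈ T, π v ∉ T) (k : V → A → A → ℂ) : ∀ F : (V → A) → ℂ,
      (∀ v ∈ T, ∀ a b, F (Function.update a v b) = F a) →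
      ∑ a : V → A, (∏ u, w u (a u)) * (F a * ∏ v ∈ T, k v (a (π v)) (a v)) =
        ∑ a : V → A, (∏ u, w u (a u)) * (F a * ∏ v ∈ T, ∑ b, w v b * k v (a (π v)) b) := by
  classical
  induction T using Finset.induction_on with
  | empty => intro F _; simp
  | insert v T hv ih =>
    intro F hF
    have hπv : π v ≠ v := fun h => hπ v (Finset.mem_insert_self _ _)
      (h.symm ▸ Finset.mem_insert_self _ _)
    have hπT : ∀ u ∈ T, π u ∉ T := fun u hu h =>
      hπ u (Finset.mem_insert_of_mem hu) (Finset.mem_insert_of_mem h)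
    -- The link factor of the new leaf v is treated as part of F while the other leaves are summed
    -- out.
    have h1 := ih (fun u hu => hT u (Finset.mem_insert_of_mem hu)) hπT
      (fun a => F a * k v (a (π v)) (a v)) (fun u hu a b => by
        have huv : v ≠ u := fun h => hv (h ▸ hu)
        have huπ : π v ≠ u := fun h => hπ v (Finset.mem_insert_self _ _)
          (h.symm ▸ Finset.mem_insert_of_mem hu)
        rw [hF u (Finset.mem_insert_of_mem hu), Function.update_of_ne huv,
          Function.update_of_ne huπ])
    simp only [Finset.prod_insert hv, ← mul_assoc] at h1 ⊢
    rw [h1]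
    simp only [mul_assoc]
    rw [sum_resample w v (hT v (Finset.mem_insert_self _ _))]
    refine Finset.sum_congr rfl fun a _ => ?_
    congr 1
    rw [Finset.sum_mul, Finset.mul_sum]
    refine Finset.sum_congr rfl fun b _ => ?_
    rw [hF v (Finset.mem_insert_self _ _), Function.update_self, Function.update_of_ne hπv]
    have : ∏ u ∈ T, ∑ c, w u c * k u (Function.update a v b (π u)) c =
        ∏ u ∈ T, ∑ c, w u c * k u (a (π u)) c :=
      Finset.prod_congr rfl fun u hu => by
        have huv : π u ≠ v := fun h => hπ u (Finset.mem_insert_of_mem hu)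
          (h.symm ▸ Finset.mem_insert_self _ _)
        rw [Function.update_of_ne huv]
    rw [this]
    ring

/-- Only the two vertices on which `F` depends remain. -/
theorem sum_two_vertices [DecidableEq A] (w : V → A → ℂ) {L R : V} (hLR : L ≠ R)
    (hw : ∀ v, v ≠ L → v ≠ R → ∑ b, w v b = 1) (F : A → A → ℂ) :
    ∑ a : V → A, (∏ u, w u (a u)) * F (a L) (a R) =
      ∑ x, ∑ y, w L x * w R y * F x y := by
  -- Indicators fix the values at L and R. The summand then factors over the vertices, and the sum
  -- over assignments becomes a product of sums.
  have h1 : ∀ a : V → A, (∏ u, w u (a u)) * F (a L) (a R) = ∑ x, ∑ y, F x y *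
      ∏ u, (w u (a u) * ((if u = L then (if a u = x then 1 else 0) else 1) *
        (if u = R then (if a u = y then 1 else 0) else 1))) := fun a => by
    simp only [Finset.prod_mul_distrib, Finset.prod_ite_eq', Finset.mem_univ, if_true]
    rw [Finset.sum_eq_single (a L) (fun x _ hx => by simp [hx.symm]) (by simp),
      Finset.sum_eq_single (a R) (fun x _ hx => by simp [hx.symm]) (by simp)]
    simp [mul_comm]
  simp only [h1]
  rw [Finset.sum_comm]
  refine Finset.sum_congr rfl fun x _ => ?_
  rw [Finset.sum_comm]
  refine Finset.sum_congr rfl fun y _ => ?_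
  rw [← Finset.mul_sum, ← Fintype.prod_sum fun (u : V) (b : A) =>
    (w u b * ((if u = L then (if b = x then 1 else 0) else 1) *
        (if u = R then (if b = y then 1 else 0) else 1))), mul_comm]
  congr 1
  rw [Finset.prod_eq_mul L R hLR (fun v _ hv => by simp [hv.1, hv.2, hw v hv.1 hv.2])
    (by simp) (by simp)]
  simp [hLR, hLR.symm]

end SumOut

/-! ### String weights -/

theorem gammaDot_comm {p : ℕ} (γ : ℕ → ℝ) (a b : Str p) : gammaDot γ a b = gammaDot γ b a := by
  simp only [gammaDot, mul_comm]

theorem strWeight_one {p : ℕ} (β : ℕ → ℝ) (a : Str p) : strWeight β 1 (fun _ => 1) a = f β a := by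
  simp [strWeight, f]

theorem flipOp_one : flipOp 1 (fun _ => 1) = 1 := by
  ext z w
  simp [flipOp, Matrix.one_apply]

/-- This is the norm of the ansatz state on one vertex without edges, written as a path sum. -/
theorem sum_f {p : ℕ} (hp : 1 ≤ p) (β : ℕ → ℝ) : ∑ a : Str p, f β a = 1 := by
  have h := expectOn_eq_sum_strings (V := Unit) ∅ 1 p hp 0 β 1 (fun _ _ => 1)
  have h1 : (tensorOp fun v : Unit => flipOp ((1 : Unit → ℤˣ) v) fun _ => 1) = 1 := by
    rw [← tensorOp_one]
    congr 1
    funext v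
    exact flipOp_one
  rw [h1, expectOn_one] at h
  rw [h, ← (Equiv.funUnique Unit (Str p)).symm.sum_comp]
  simp [strWeight_one]

/-! ### The tree around an edge and the summation over its layers -/

section Tree

variable {V : Type*} [Fintype V] [DecidableEq V]

/-- The phase factor of an edge. -/
def edgePhase {p : ℕ} (D : ℕ) (γ : ℕ → ℝ) (a : V → Str p) (e : Sym2 V) : ℂ :=
  Complex.exp (-(Complex.I / (Real.sqrt D : ℂ)) * edgeDot γ a e)

/-- The phase factor of an edge with given strings at its ends. -/
def pairPhase {p : ℕ} (D : ℕ) (γ : ℕ → ℝ) (a b : Str p) : ℂ :=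
  Complex.exp (-(Complex.I / (Real.sqrt D : ℂ)) * (gammaDot γ a b : ℂ))

theorem edgePhase_mk {p : ℕ} (D : ℕ) (γ : ℕ → ℝ) (a : V → Str p) {u v : V} (h : u ≠ v) :
    edgePhase D γ a s(u, v) = pairPhase D γ (a u) (a v) := by
  have h2 : ∀ z : V → ℤˣ, edgeSgn z s(u, v) = sgn (z u) * sgn (z v) := fun z => by
    have : (s(u, v) : Sym2 V).toFinset = {u, v} := by
      ext x; simp
    rw [edgeSgn, this, Finset.prod_pair h]
  rw [edgePhase, pairPhase, edgeDot, gammaDot]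
  congr 2
  push_cast
  exact Finset.sum_congr rfl fun k _ => by rw [h2]; simp [sgn]

theorem edgePhase_update {p : ℕ} (D : ℕ) (γ : ℕ → ℝ) (a : V → Str p) {v : V} (b : Str p)
    {e : Sym2 V} (h : v ∉ e) : edgePhase D γ (Function.update a v b) e = edgePhase D γ a e := by
  have : ∀ k, edgeSgn (fun u => Function.update a v b u k) e = edgeSgn (fun u => a u k) e :=
    fun k => Finset.prod_congr rfl fun u hu => by
      have : u ≠ v := fun huv => h (huv ▸ Sym2.mem_toFinset.1 hu)
      simp only [Function.update_of_ne this]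
  simp only [edgePhase, edgeDot, this]

variable (G : SimpleGraph V) [DecidableRel G.Adj]

/-- The vertices at distance exactly `j` from `{L, R}`. -/
def layer (L R : V) : ℕ → Finset V
  | 0 => {L, R}
  | j + 1 => ball G L R (j + 1) \ ball G L R j

/-- The edges inside the tree of depth `j` around `{L, R}`. -/
def treeEdges (L R : V) : ℕ → Finset (Sym2 V)
  | 0 => {s(L, R)}
  | j + 1 => touching G.edgeFinset (ball G L R j)

open Classical in
/-- A neighbour of `v` in the ball of radius `j`. -/
def parent (L R : V) (j : ℕ) (v : V) : V :=
  if h : ∃ u ∈ ball G L R j, G.Adj v u then h.choose else v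

theorem parent_spec {L R v : V} {j : ℕ} (hv : v ∈ layer G L R (j + 1)) :
    parent G L R j v ∈ ball G L R j ∧ G.Adj v (parent G L R j v) := by
  have hv' := Finset.mem_sdiff.1 hv
  have h := ((mem_ball_succ G).1 hv'.1).resolve_left hv'.2
  rw [parent, dif_pos h]
  exact h.choose_spec

theorem parent_eq {L R v u : V} {p j : ℕ} (hLR : G.Adj L R)
    (hg : ((2 * p + 1 : ℕ) : ℕ∞) < G.egirth) (hj : j + 1 ≤ p) (hv : v ∉ ball G L R j)
    (hu : u ∈ ball G L R j) (hvu : G.Adj v u) :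
    v ∈ layer G L R (j + 1) ∧ parent G L R j v = u := by
  have hl : v ∈ layer G L R (j + 1) :=
    Finset.mem_sdiff.2 ⟨(mem_ball_succ G).2 (Or.inr ⟨u, hu, hvu⟩), hv⟩
  have hp := parent_spec G hl
  exact ⟨hl, parent_unique G hLR hg hj hv hp.1 hu hp.2 hvu⟩

theorem mem_layer_of_adj {L R v u : V} {j : ℕ} (hv : v ∉ ball G L R j)
    (hu : u ∈ ball G L R j) (hvu : G.Adj v u) : u ∈ layer G L R j := by
  cases j with
  | zero => exact hu
  | succ i =>
    exact Finset.mem_sdiff.2 ⟨hu, fun h => hv ((mem_ball_succ G).2 (Or.inr ⟨u, h, hvu⟩))⟩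

theorem layer_subset_ball (L R : V) (j : ℕ) : layer G L R j ⊆ ball G L R j := by
  cases j with
  | zero => exact subset_rfl
  | succ i => exact Finset.sdiff_subset

theorem mem_ball_of_mem_treeEdges {L R : V} {j : ℕ} {e : Sym2 V} (he : e ∈ treeEdges G L R j)
    {v : V} (hv : v ∈ e) : v ∈ ball G L R j := by
  cases j with
  | zero =>
    rw [treeEdges, Finset.mem_singleton] at he
    subst he
    simpa [ball] using hv
  | succ i =>
    rw [treeEdges, touching, Finset.mem_filter, Finset.not_disjoint_iff] at he
    obtain ⟨he, u, hu, hub⟩ := he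
    rw [Sym2.mem_toFinset] at hu
    by_cases huv : v = u
    · exact huv ▸ ball_subset_succ G L R i hub
    · have : e = s(v, u) := ((Sym2.mem_and_mem_iff huv).1 ⟨hv, hu⟩)
      rw [this, SimpleGraph.mem_edgeFinset, SimpleGraph.mem_edgeSet] at he
      exact (mem_ball_succ G).2 (Or.inr ⟨u, hub, he⟩)

theorem notMem_treeEdges {L R v u : V} {j : ℕ} (hv : v ∉ ball G L R j) :
    s(v, u) ∉ treeEdges G L R j := fun h =>
  hv (mem_ball_of_mem_treeEdges G h (Sym2.mem_mk_left v u))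

theorem treeEdges_subset_succ {L R : V} (hLR : G.Adj L R) (j : ℕ) :
    treeEdges G L R j ⊆ treeEdges G L R (j + 1) := by
  intro e he
  cases j with
  | zero =>
    rw [treeEdges, Finset.mem_singleton] at he
    subst he
    rw [treeEdges, touching, Finset.mem_filter, Finset.not_disjoint_iff]
    exact ⟨by simpa using hLR, L, by simp, by simp [ball]⟩
  | succ i =>
    rw [treeEdges, touching, Finset.mem_filter, Finset.not_disjoint_iff] at he ⊢
    obtain ⟨he, u, hu, hub⟩ := he
    exact ⟨he, u, hu, ball_subset_succ G L R i hub⟩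

/-- An edge touching the ball of radius j either leaves it, and then joins a vertex of the next
layer to its parent, or has both ends in it. In the second case it is already in the smaller tree,
because no edge lies inside an inner layer. -/
theorem treeEdges_succ {L R : V} {p j : ℕ} (hLR : G.Adj L R)
    (hg : ((2 * p + 1 : ℕ) : ℕ∞) < G.egirth) (hj : j + 1 ≤ p) :
    treeEdges G L R (j + 1) = treeEdges G L R j ∪
      (layer G L R (j + 1)).image fun v => s(v, parent G L R j v) := by
  ext e
  constructor
  · intro he
    rw [treeEdges, touching, Finset.mem_filter, Finset.not_disjoint_iff] at he
    obtain ⟨he, x, hx, hxb⟩ := he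
    rw [Sym2.mem_toFinset] at hx
    obtain ⟨y, rfl⟩ := hx
    rw [SimpleGraph.mem_edgeFinset, SimpleGraph.mem_edgeSet] at he
    rw [Finset.mem_union, Finset.mem_image]
    by_cases hy : y ∈ ball G L R j
    · left
      cases j with
      | zero =>
        rw [treeEdges, Finset.mem_singleton]
        simp only [ball, Finset.mem_insert, Finset.mem_singleton] at hxb hy
        rcases hxb with rfl | rfl <;> rcases hy with rfl | rfl
        · exact absurd rfl he.ne
        · rfl
        · exact Sym2.eq_swap
        · exact absurd rfl he.ne
      | succ i =>
        rw [treeEdges, touching, Finset.mem_filter, Finset.not_disjoint_iff]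
        refine ⟨by simpa using he, ?_⟩
        by_cases hxi : x ∈ ball G L R i
        · exact ⟨x, by simp, hxi⟩
        · by_cases hyi : y ∈ ball G L R i
          · exact ⟨y, by simp, hyi⟩
          · exact absurd he (not_adj_of_layer G hLR hg (by omega) hxb hxi hy hyi)
    · right
      obtain ⟨h1, h2⟩ := parent_eq G hLR hg hj hy hxb he.symm
      exact ⟨y, h1, by rw [h2]; exact Sym2.eq_swap⟩
  · intro he
    rcases Finset.mem_union.1 he with he | he
    · exact treeEdges_subset_succ G hLR j he
    · obtain ⟨v, hv, rfl⟩ := Finset.mem_image.1 he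
      obtain ⟨h1, h2⟩ := parent_spec G hv
      rw [treeEdges, touching, Finset.mem_filter, Finset.not_disjoint_iff]
      exact ⟨by simpa using h2, parent G L R j v, by simp, h1⟩

theorem prod_treeEdges_succ {L R : V} {p j : ℕ} (hLR : G.Adj L R)
    (hg : ((2 * p + 1 : ℕ) : ℕ∞) < G.egirth) (hj : j + 1 ≤ p) (φ : Sym2 V → ℂ) :
    ∏ e ∈ treeEdges G L R (j + 1), φ e = (∏ e ∈ treeEdges G L R j, φ e) *
      ∏ v ∈ layer G L R (j + 1), φ s(v, parent G L R j v) := by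
  rw [treeEdges_succ G hLR hg hj, Finset.prod_union, Finset.prod_image]
  -- In the crossed case v would be the parent of v', hence in the ball that its layer excludes.
  · intro v hv v' hv' h
    rcases Sym2.eq_iff.1 h with h | h
    · exact h.1
    · exact absurd (h.1 ▸ (parent_spec G hv').1) (Finset.mem_sdiff.1 hv).2
  · rw [Finset.disjoint_right]
    intro e he
    obtain ⟨v, hv, rfl⟩ := Finset.mem_image.1 he
    exact notMem_treeEdges G (Finset.mem_sdiff.1 hv).2

/-- Of the D + 1 neighbours of u exactly one lies in the ball: the other root if u is a root, and
the parent of u otherwise. -/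
theorem card_children {L R u : V} {p D j : ℕ} (hreg : G.IsRegularOfDegree (D + 1))
    (hLR : G.Adj L R) (hg : ((2 * p + 1 : ℕ) : ℕ∞) < G.egirth) (hj : j + 1 ≤ p)
    (hu : u ∈ layer G L R j) :
    ((layer G L R (j + 1)).filter fun v => parent G L R j v = u).card = D := by
  have hub := layer_subset_ball G L R j hu
  have h1 : (layer G L R (j + 1)).filter (fun v => parent G L R j v = u) =
      (G.neighborFinset u) \ ball G L R j := by
    ext v
    rw [Finset.mem_filter, Finset.mem_sdiff, SimpleGraph.mem_neighborFinset]
    constructor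
    · rintro ⟨hv, rfl⟩
      exact ⟨(parent_spec G hv).2.symm, (Finset.mem_sdiff.1 hv).2⟩
    · rintro ⟨huv, hv⟩
      exact parent_eq G hLR hg hj hv hub huv.symm
  have h2 : (G.neighborFinset u ∩ ball G L R j).card = 1 := by
    rw [Finset.card_eq_one]
    cases j with
    | zero =>
      simp only [layer, Finset.mem_insert, Finset.mem_singleton] at hu
      rcases hu with rfl | rfl
      · refine ⟨R, ?_⟩
        ext v
        simp only [Finset.mem_inter, SimpleGraph.mem_neighborFinset, ball, Finset.mem_insert,
          Finset.mem_singleton]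
        exact ⟨fun h => h.2.resolve_left h.1.ne', by rintro rfl; exact ⟨hLR, Or.inr rfl⟩⟩
      · refine ⟨L, ?_⟩
        ext v
        simp only [Finset.mem_inter, SimpleGraph.mem_neighborFinset, ball, Finset.mem_insert,
          Finset.mem_singleton]
        exact ⟨fun h => h.2.resolve_right h.1.ne', by rintro rfl; exact ⟨hLR.symm, Or.inl rfl⟩⟩
    | succ i =>
      refine ⟨parent G L R i u, ?_⟩
      have hp := parent_spec G hu
      have hu' := Finset.mem_sdiff.1 hu
      ext v
      rw [Finset.mem_inter, SimpleGraph.mem_neighborFinset, Finset.mem_singleton]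
      constructor
      · rintro ⟨huv, hv⟩
        by_cases hvi : v ∈ ball G L R i
        · exact (parent_eq G hLR hg (by omega) hu'.2 hvi huv).2.symm
        · exact absurd huv (not_adj_of_layer G hLR hg (by omega) hu'.1 hu'.2 hv hvi)
      · rintro rfl
        exact ⟨hp.2, ball_subset_succ G L R i hp.1⟩
  have h3 := Finset.card_sdiff_add_card_inter (G.neighborFinset u) (ball G L R j)
  rw [SimpleGraph.card_neighborFinset_eq_degree, hreg u] at h3
  rw [h1]
  omega

theorem treeH_succ (p D : ℕ) (γ β : ℕ → ℝ) (m : ℕ) (a : Str p) : treeH p D γ β (m + 1) a =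
    (∑ b : Str p, f β b * (treeH p D γ β m b * pairPhase D γ b a)) ^ D := by
  rw [treeH]
  congr 1
  exact Finset.sum_congr rfl fun b _ => by rw [pairPhase, gammaDot_comm γ b a]; ring

/-- Summing out one layer of the tree. -/
theorem sum_layer {L R : V} {p D j : ℕ} (hreg : G.IsRegularOfDegree (D + 1))
    (hLR : G.Adj L R) (hg : ((2 * p + 1 : ℕ) : ℕ∞) < G.egirth) (hj : j + 1 ≤ p)
    (γ β : ℕ → ℝ) (w : V → Str p → ℂ) (hw : ∀ v, v ≠ L → v ≠ R → w v = f β) (m : ℕ) :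
    ∑ a : V → Str p, (∏ u, w u (a u)) * ((∏ e ∈ treeEdges G L R (j + 1), edgePhase D γ a e) *
        ∏ v ∈ layer G L R (j + 1), treeH p D γ β m (a v)) =
      ∑ a : V → Str p, (∏ u, w u (a u)) * ((∏ e ∈ treeEdges G L R j, edgePhase D γ a e) *
        ∏ v ∈ layer G L R j, treeH p D γ β (m + 1) (a v)) := by
  have hwl : ∀ v ∈ layer G L R (j + 1), w v = f β := fun v hv =>
    hw v (ne_of_notMem_ball G (Finset.mem_sdiff.1 hv).2).1
      (ne_of_notMem_ball G (Finset.mem_sdiff.1 hv).2).2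
  have h1 := sum_leaves w (layer G L R (j + 1))
    (fun v hv => by rw [hwl v hv]; exact sum_f (by omega) β) (parent G L R j)
    (fun v hv h => (Finset.mem_sdiff.1 h).2 (parent_spec G hv).1)
    (fun _ x b => treeH p D γ β m b * pairPhase D γ b x)
    (fun a => ∏ e ∈ treeEdges G L R j, edgePhase D γ a e)
    (fun v hv a b => Finset.prod_congr rfl fun e he => edgePhase_update D γ a b fun hve =>
      (Finset.mem_sdiff.1 hv).2 (mem_ball_of_mem_treeEdges G he hve))
  have h2 : ∀ a : V → Str p, (∏ e ∈ treeEdges G L R (j + 1), edgePhase D γ a e) *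
      ∏ v ∈ layer G L R (j + 1), treeH p D γ β m (a v) =
      (∏ e ∈ treeEdges G L R j, edgePhase D γ a e) * ∏ v ∈ layer G L R (j + 1),
        (treeH p D γ β m (a v) * pairPhase D γ (a v) (a (parent G L R j v))) := fun a => by
    rw [prod_treeEdges_succ G hLR hg hj, Finset.prod_mul_distrib, mul_assoc,
      mul_comm (∏ v ∈ layer G L R (j + 1), treeH p D γ β m (a v))]
    congr 2
    exact Finset.prod_congr rfl fun v hv => edgePhase_mk D γ a (parent_spec G hv).2.ne
  simp only [h2]
  rw [h1]
  refine Finset.sum_congr rfl fun a _ => ?_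
  congr 2
  -- Leaves are grouped by parent. The D children of u give equal sums, and their product is the
  -- D-th power in `treeH`.
  rw [← Finset.prod_fiberwise_of_maps_to (s := layer G L R (j + 1)) (t := layer G L R j)
    (g := parent G L R j) fun v hv =>
      mem_layer_of_adj G (Finset.mem_sdiff.1 hv).2 (parent_spec G hv).1
      (parent_spec G hv).2]
  refine Finset.prod_congr rfl fun u hu => ?_
  rw [treeH_succ, ← card_children G hreg hLR hg hj hu, ← Finset.prod_const]
  refine Finset.prod_congr rfl fun v hv => ?_
  rw [hwl v (Finset.mem_filter.1 hv).1, (Finset.mem_filter.1 hv).2,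
    card_children G hreg hLR hg hj hu]

theorem sum_tree {L R : V} {p D : ℕ} (hreg : G.IsRegularOfDegree (D + 1))
    (hLR : G.Adj L R) (hg : ((2 * p + 1 : ℕ) : ℕ∞) < G.egirth)
    (γ β : ℕ → ℝ) (w : V → Str p → ℂ) (hw : ∀ v, v ≠ L → v ≠ R → w v = f β) (hp : 1 ≤ p) :
    ∑ a : V → Str p, (∏ u, w u (a u)) * ∏ e ∈ treeEdges G L R p, edgePhase D γ a e =
      ∑ a, ∑ b, w L a * w R b *
        (pairPhase D γ a b * (treeH p D γ β p a * treeH p D γ β p b)) := by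
  -- With j layers removed, the boundary at depth p - j carries the j-th iterate; initially the
  -- iterate is 1.
  have h : ∀ j ≤ p, ∑ a : V → Str p, (∏ u, w u (a u)) *
      ((∏ e ∈ treeEdges G L R (p - j), edgePhase D γ a e) *
        ∏ v ∈ layer G L R (p - j), treeH p D γ β j (a v)) =
      ∑ a : V → Str p, (∏ u, w u (a u)) * ∏ e ∈ treeEdges G L R p, edgePhase D γ a e := by
    intro j
    induction j with
    | zero => intro _; simp [treeH]
    | succ j ih =>
      intro hj
      rw [← ih (by omega), show p - j = p - (j + 1) + 1 by omega]
      exact (sum_layer G hreg hLR hg (by omega) γ β w hw j).symm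
  rw [← h p le_rfl, Nat.sub_self, ← sum_two_vertices w hLR.ne
    (fun v hL hR => by rw [hw v hL hR]; exact sum_f hp β)]
  refine Finset.sum_congr rfl fun a _ => ?_
  rw [treeEdges, Finset.prod_singleton, edgePhase_mk D γ a hLR.ne, layer,
    Finset.prod_pair hLR.ne]

/-- The expectation value of a product operator on an edge, as a sum over two strings. -/
theorem expectation_flipOp {L R : V} {p D : ℕ} (hp : 1 ≤ p) (hreg : G.IsRegularOfDegree (D + 1))
    (hLR : G.Adj L R) (hg : ((2 * p + 1 : ℕ) : ℕ∞) < G.egirth) (γ β : ℕ → ℝ) (s : ℤˣ)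
    (c : ℤˣ → ℂ) :
    expectation G D p γ β (onQubits {L, R} (flipOp s c)) =
      ∑ a : Str p, ∑ b : Str p, strWeight β s c a * strWeight β s c b *
        (pairPhase D γ a b * (treeH p D γ β p a * treeH p D γ β p b)) := by
  obtain ⟨q, rfl⟩ : ∃ q, p = q + 1 := ⟨p - 1, by omega⟩
  let s' : V → ℤˣ := fun v => if v ∈ ({L, R} : Finset V) then s else 1
  let c' : V → ℤˣ → ℂ := fun v => if v ∈ ({L, R} : Finset V) then c else fun _ => 1
  have hO : onQubits {L, R} (flipOp s c) = tensorOp fun v => flipOp (s' v) (c' v) := by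
    rw [onQubits]
    congr 1
    funext v
    by_cases hv : v ∈ ({L, R} : Finset V)
    · simp only [s', c', if_pos hv]
    · simp only [s', c', if_neg hv, flipOp_one]
  -- An edge outside the tree misses the ball of radius q = p - 1, hence all smaller balls, so no
  -- layer sees it.
  have hcone := expectOn_eq_of_lightCone G.edgeFinset (treeEdges G L R (q + 1))
    (Finset.filter_subset _ _) D γ β (ball G L R) (ball_subset_succ G L R)
    (fun j e he ht v hv => by
      refine mem_ball_of_mem_treeEdges G (j := j + 1) (e := e) ?_ (Sym2.mem_toFinset.1 hv)
      exact Finset.mem_filter.2 ⟨he, ht⟩) (q + 1) 0 (onQubits {L, R} (flipOp s c))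
    (supportedOn_onQubits _ _) (fun e he hne k hk => by
      by_contra ht
      refine hne (Finset.mem_filter.2 ⟨he, fun hd => ht ?_⟩)
      exact hd.mono_right (ball_mono G L R (by omega)))
  rw [expectation_eq, hcone, hO, expectOn_eq_sum_strings _ _ _ hp]
  have h := sum_tree G hreg hLR hg γ β (fun v => strWeight β (s' v) (c' v)) (fun v hL hR => by
    funext a
    have hv : v ∉ ({L, R} : Finset V) := by simp [hL, hR]
    simp only [s', c', if_neg hv, strWeight_one]) hp
  have hL : L ∈ ({L, R} : Finset V) := by simp
  have hR : R ∈ ({L, R} : Finset V) := by simp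
  simp only [s', c', if_pos hL, if_pos hR] at h
  exact h

end Tree

/-! ### The symmetry `a ↦ -a` -/

theorem gammaDot_neg_left {p : ℕ} (γ : ℕ → ℝ) (a b : Str p) :
    gammaDot γ (-a) b = -gammaDot γ a b := by
  simp [gammaDot]

theorem gammaDot_neg_right {p : ℕ} (γ : ℕ → ℝ) (a b : Str p) :
    gammaDot γ a (-b) = -gammaDot γ a b := by
  simp [gammaDot]

theorem midEntry_neg {p : ℕ} (a : Str p) : midEntry (-a) = -midEntry a := by
  simp [midEntry, sgn_neg]

theorem f_neg {p : ℕ} (β : ℕ → ℝ) (a : Str p) : f β (-a) = f β a := by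
  simp [f, rotX_neg_neg]

theorem f'_neg {p : ℕ} (β : ℕ → ℝ) (a : Str p) : f' β (-a) = f' β a := by
  simp only [f', Pi.neg_apply]
  congr 1
  refine Finset.prod_congr rfl fun k _ => ?_
  rw [← rotX_neg_neg]
  split_ifs <;> simp

/-- Substituting b ↦ -b under the sum leaves Γ·(ab) unchanged. -/
theorem treeH_neg {p D : ℕ} (γ β : ℕ → ℝ) (m : ℕ) (a : Str p) :
    treeH p D γ β m (-a) = treeH p D γ β m a := by
  induction m generalizing a with
  | zero => rfl
  | succ m ih =>
    rw [treeH, treeH, ← Equiv.sum_comp (Equiv.neg (Str p))]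
    simp only [Equiv.neg_apply, ih, gammaDot_neg_left, gammaDot_neg_right, neg_neg, f_neg]

theorem sum_eq_zero_of_neg {p : ℕ} {g : Str p → ℂ} (h : ∀ a, g (-a) = -g a) : ∑ a, g a = 0 := by
  have h1 := Equiv.sum_comp (Equiv.neg (Str p)) g
  simp only [Equiv.neg_apply, h, Finset.sum_neg_distrib] at h1
  exact self_eq_neg.1 h1.symm

theorem pairPhase_eq {p : ℕ} (D : ℕ) (γ : ℕ → ℝ) (a b : Str p) : pairPhase D γ a b =
    (Real.cos (gammaDot γ a b / Real.sqrt D) : ℂ) -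
      Complex.I * (Real.sin (gammaDot γ a b / Real.sqrt D) : ℂ) := by
  have h : -(Complex.I / (Real.sqrt D : ℂ)) * (gammaDot γ a b : ℂ) =
      ((-(gammaDot γ a b / Real.sqrt D) : ℝ) : ℂ) * Complex.I := by
    push_cast; ring
  rw [pairPhase, h, Complex.exp_mul_I, ← Complex.ofReal_cos, ← Complex.ofReal_sin, Real.cos_neg,
    Real.sin_neg]
  push_cast
  ring

/-- The bilinear form shared by the three edge expectation values. -/
def edgeForm (p D : ℕ) (γ β : ℕ → ℝ) (w : Str p → ℂ) : ℂ :=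
  ∑ a : Str p, ∑ b : Str p, w a * w b *
    (pairPhase D γ a b * (treeH p D γ β p a * treeH p D γ β p b))

/-- Only a is flipped, not b: Γ·(ab) then changes sign, and the sine part of the phase sums to zero.
For odd weights the cosine part vanishes instead. -/
theorem edgeForm_of_even {p D : ℕ} (γ β : ℕ → ℝ) {w : Str p → ℂ} (hw : ∀ a, w (-a) = w a) :
    edgeForm p D γ β w = ∑ a, ∑ b, w a * w b * treeH p D γ β p a * treeH p D γ β p b *
      (Real.cos (gammaDot γ a b / Real.sqrt D) : ℂ) := by
  have h : ∑ a, ∑ b, w a * w b * treeH p D γ β p a * treeH p D γ β p b *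
      (Real.sin (gammaDot γ a b / Real.sqrt D) : ℂ) = 0 :=
    sum_eq_zero_of_neg fun a => by
      simp only [hw, treeH_neg, gammaDot_neg_left, neg_div, Real.sin_neg, Complex.ofReal_neg,
        mul_neg, Finset.sum_neg_distrib]
  rw [← sub_zero (∑ a, _), ← mul_zero Complex.I, ← h, Finset.mul_sum, ← Finset.sum_sub_distrib,
    edgeForm]
  refine Finset.sum_congr rfl fun a _ => ?_
  rw [Finset.mul_sum, ← Finset.sum_sub_distrib]
  exact Finset.sum_congr rfl fun b _ => by rw [pairPhase_eq]; ring

theorem edgeForm_of_odd {p D : ℕ} (γ β : ℕ → ℝ) {w : Str p → ℂ} (hw : ∀ a, w (-a) = -w a) :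
    edgeForm p D γ β w = -Complex.I * ∑ a, ∑ b, w a * w b * treeH p D γ β p a *
      treeH p D γ β p b * (Real.sin (gammaDot γ a b / Real.sqrt D) : ℂ) := by
  have h : ∑ a, ∑ b, w a * w b * treeH p D γ β p a * treeH p D γ β p b *
      (Real.cos (gammaDot γ a b / Real.sqrt D) : ℂ) = 0 :=
    sum_eq_zero_of_neg fun a => by
      simp only [hw, treeH_neg, gammaDot_neg_left, neg_div, Real.cos_neg,
        neg_mul, Finset.sum_neg_distrib]
  rw [← zero_add (-Complex.I * _), ← h, Finset.mul_sum, ← Finset.sum_add_distrib, edgeForm]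
  refine Finset.sum_congr rfl fun a _ => ?_
  rw [Finset.mul_sum, ← Finset.sum_add_distrib]
  exact Finset.sum_congr rfl fun b _ => by rw [pairPhase_eq]; ring

theorem sumXX_eq (p D : ℕ) (γ β : ℕ → ℝ) : sumXX p D γ β = edgeForm p D γ β (f' β) :=
  (edgeForm_of_even γ β (f'_neg β)).symm

/-- The minus sign is i², from the factor i in each of the two Y operators; the weights of this form
omit it. -/
theorem sumYY_eq (p D : ℕ) (γ β : ℕ → ℝ) :
    sumYY p D γ β = -edgeForm p D γ β fun a => midEntry a * f' β a := by
  rw [edgeForm_of_odd γ β fun a => by rw [midEntry_neg, f'_neg, neg_mul], neg_mul, neg_neg, sumYY]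
  congr 1
  exact Finset.sum_congr rfl fun a _ => Finset.sum_congr rfl fun b _ => by ring

theorem sumZZ_eq (p D : ℕ) (γ β : ℕ → ℝ) :
    sumZZ p D γ β = edgeForm p D γ β fun a => midEntry a * f β a := by
  rw [edgeForm_of_odd γ β fun a => by rw [midEntry_neg, f_neg, neg_mul], sumZZ]
  congr 1
  exact Finset.sum_congr rfl fun a _ => Finset.sum_congr rfl fun b _ => by ring

/-- The recursion in terms of cosines. -/
theorem treeH_succ_cos (p D : ℕ) (γ β : ℕ → ℝ) (m : ℕ) (a : Str p) :
    treeH p D γ β (m + 1) a = (∑ b : Str p, treeH p D γ β m b *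
      (Real.cos (1 / Real.sqrt D * gammaDot γ a b) : ℂ) * f β b) ^ D := by
  have h : ∑ b : Str p, treeH p D γ β m b *
      (Real.sin (gammaDot γ a b / Real.sqrt D) : ℂ) * f β b = 0 :=
    sum_eq_zero_of_neg fun b => by
      simp only [treeH_neg, gammaDot_neg_right, neg_div, Real.sin_neg, Complex.ofReal_neg,
        f_neg, mul_neg, neg_mul]
  rw [treeH_succ]
  congr 1
  rw [← sub_zero (∑ b, treeH p D γ β m b * _ * _), ← mul_zero Complex.I, ← h, Finset.mul_sum,
    ← Finset.sum_sub_distrib]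
  refine Finset.sum_congr rfl fun b _ => ?_
  rw [pairPhase_eq, gammaDot_comm γ b a, one_div_mul_eq_div]
  ring

/-! ### The energy on a graph -/

theorem pauliX_eq_flipOp : pauliX = flipOp (-1) fun _ => 1 := by
  ext z w
  simp [pauliX, flipOp]

theorem pauliY_eq_flipOp : pauliY = flipOp (-1) fun w => Complex.I * sgn w := by
  ext z w
  simp [pauliY, flipOp]

theorem pauliZ_eq_flipOp : pauliZ = flipOp 1 sgn := by
  ext z w
  by_cases h : z = w <;> simp [pauliZ, flipOp, h]

theorem strWeight_neg_one {p : ℕ} (β : ℕ → ℝ) (c : ℤˣ → ℂ) (a : Str p) :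
    strWeight β (-1) c a = c (a ⟨p, by omega⟩) * f' β a := by
  simp [strWeight, f']

theorem strWeight_one' {p : ℕ} (β : ℕ → ℝ) (c : ℤˣ → ℂ) (a : Str p) :
    strWeight β 1 c a = c (a ⟨p, by omega⟩) * f β a := by
  simp [strWeight, f]

section Energy

variable {V : Type*} [Fintype V] [DecidableEq V] (G : SimpleGraph V) [DecidableRel G.Adj]

theorem expectation_pauli {L R : V} {p D : ℕ} (hp : 1 ≤ p) (hreg : G.IsRegularOfDegree (D + 1))
    (hLR : G.Adj L R) (hg : ((2 * p + 1 : ℕ) : ℕ∞) < G.egirth) (γ β : ℕ → ℝ) :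
    expectation G D p γ β (onQubits {L, R} pauliX) = sumXX p D γ β ∧
    expectation G D p γ β (onQubits {L, R} pauliY) = sumYY p D γ β ∧
    expectation G D p γ β (onQubits {L, R} pauliZ) = sumZZ p D γ β := by
  refine ⟨?_, ?_, ?_⟩
  · rw [pauliX_eq_flipOp, expectation_flipOp G hp hreg hLR hg, sumXX_eq, edgeForm]
    simp only [strWeight_neg_one, one_mul]
  · rw [pauliY_eq_flipOp, expectation_flipOp G hp hreg hLR hg, sumYY_eq, edgeForm,
      ← Finset.sum_neg_distrib]
    refine Finset.sum_congr rfl fun a _ => ?_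
    rw [← Finset.sum_neg_distrib]
    refine Finset.sum_congr rfl fun b _ => ?_
    simp only [strWeight_neg_one, midEntry]
    ring_nf
    rw [Complex.I_sq]
    ring
  · rw [pauliZ_eq_flipOp, expectation_flipOp G hp hreg hLR hg, sumZZ_eq, edgeForm]
    simp only [strWeight_one', midEntry]

theorem expectation_add (D p : ℕ) (γ β : ℕ → ℝ) (A B : Matrix (V → ℤˣ) (V → ℤˣ) ℂ) :
    expectation G D p γ β (A + B) = expectation G D p γ β A + expectation G D p γ β B := by
  rw [expectation, Matrix.add_mulVec, dotProduct_add]; rfl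

theorem expectation_smul (D p : ℕ) (γ β : ℕ → ℝ) (c : ℂ) (A : Matrix (V → ℤˣ) (V → ℤˣ) ℂ) :
    expectation G D p γ β (c • A) = c * expectation G D p γ β A := by
  rw [expectation, Matrix.smul_mulVec, dotProduct_smul]; rfl

theorem expectation_sum {ι : Type*} (D p : ℕ) (γ β : ℕ → ℝ) (s : Finset ι)
    (A : ι → Matrix (V → ℤˣ) (V → ℤˣ) ℂ) :
    expectation G D p γ β (∑ i ∈ s, A i) = ∑ i ∈ s, expectation G D p γ β (A i) := by
  rw [expectation, Matrix.sum_mulVec, dotProduct_sum]; rfl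

theorem expectation_hamiltonian {p D : ℕ} (hp : 1 ≤ p) (hreg : G.IsRegularOfDegree (D + 1))
    (hg : ((2 * p + 1 : ℕ) : ℕ∞) < G.egirth) (γ β : ℕ → ℝ) (cI cX cY cZ : ℝ) :
    expectation G D p γ β (hamiltonian G cI cX cY cZ) =
      (cI : ℂ) * G.edgeFinset.card + G.edgeFinset.card *
        ((cX : ℂ) * sumXX p D γ β + (cY : ℂ) * sumYY p D γ β + (cZ : ℂ) * sumZZ p D γ β) := by
  rw [hamiltonian, expectation_sum, Finset.sum_congr rfl (g := fun _ => (cI : ℂ) +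
    ((cX : ℂ) * sumXX p D γ β + (cY : ℂ) * sumYY p D γ β + (cZ : ℂ) * sumZZ p D γ β))]
  · rw [Finset.sum_const, nsmul_eq_mul]
    ring
  · intro e he
    induction e with
    | _ u v =>
      rw [SimpleGraph.mem_edgeFinset, SimpleGraph.mem_edgeSet] at he
      obtain ⟨hX, hY, hZ⟩ := expectation_pauli G hp hreg he hg γ β
      have huv : (s(u, v) : Sym2 V).toFinset = {u, v} := by
        ext x; simp
      rw [huv, expectation_add, expectation_add, expectation_add, expectation_smul,
        expectation_smul, expectation_smul, expectation_smul, hX, hY, hZ, expectation_eq,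
        expectOn_one]
      ring

end Energy

/-! ### A calculus for the machine -/

@[simp] theorem Store.setReg_reg (s : Store) (r n r' : ℕ) :
    (s.setReg r n).reg r' = if r' = r then n else s.reg r' := Function.update_apply _ _ _ _

@[simp] theorem Store.setReg_mem (s : Store) (r n : ℕ) : (s.setReg r n).mem = s.mem := rfl

@[simp] theorem Store.set_reg (s : Store) (t : Ref) (z : ℂ) : (s.set t z).reg = s.reg := rfl

@[simp] theorem Store.set_mem (s : Store) (t : Ref) (z : ℂ) (a i : ℕ) :
    (s.set t z).mem a i = if a = t.arr ∧ i = s.reg t.ix then z else s.mem a i := by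
  simp only [Store.set]
  by_cases ha : a = t.arr
  · subst ha
    simp [Function.update_apply]
  · simp [ha]

/-- The registers that a program may write. -/
def Prog.regs : Prog → List ℕ
  | .skip => []
  | .setInt r _ => [r]
  | .opInt _ r _ _ => [r]
  | .setNum _ _ _ => []
  | .expNum _ _ => []
  | .opNum _ _ _ _ => []
  | .seq c d => c.regs ++ d.regs
  | .ifZero _ c d => c.regs ++ d.regs
  | .loop _ c => c.regs

/-- The arrays that a program may write. -/
def Prog.arrs : Prog → List ℕ
  | .skip => []
  | .setInt _ _ => []
  | .opInt _ _ _ _ => []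
  | .setNum t _ _ => [t.arr]
  | .expNum t _ => [t.arr]
  | .opNum _ t _ _ => [t.arr]
  | .seq c d => c.arrs ++ d.arrs
  | .ifZero _ c d => c.arrs ++ d.arrs
  | .loop _ c => c.arrs

theorem Prog.run_reg (c : Prog) : ∀ (s : Store) {r : ℕ}, r ∉ c.regs →
    (c.run s).reg r = s.reg r := by
  induction c with
  | skip => intros; rfl
  | setInt r n =>
    intro s r' h
    simp only [Prog.regs, List.mem_singleton] at h
    simp [Prog.run, h]
  | opInt o r x y =>
    intro s r' h
    simp only [Prog.regs, List.mem_singleton] at h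
    simp [Prog.run, h]
  | setNum t a b => intros; rfl
  | expNum t x => intros; rfl
  | opNum o t x y => intros; rfl
  | seq c d hc hd =>
    intro s r h
    simp only [Prog.regs, List.mem_append, not_or] at h
    rw [Prog.run, hd _ h.2, hc _ h.1]
  | ifZero r c d hc hd =>
    intro s r h
    simp only [Prog.regs, List.mem_append, not_or] at h
    rw [Prog.run]
    split_ifs
    · exact hc _ h.1
    · exact hd _ h.2
  | loop r c hc =>
    intro s r' h
    rw [Prog.run]
    generalize s.reg r = n
    induction n generalizing s with
    | zero => rfl
    | succ n ih => rw [Function.iterate_succ_apply, ih, hc _ h]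

theorem Prog.run_mem (c : Prog) : ∀ (s : Store) {a : ℕ}, a ∉ c.arrs →
    (c.run s).mem a = s.mem a := by
  have hset : ∀ (s : Store) (t : Ref) (z : ℂ) {a : ℕ}, a ≠ t.arr → (s.set t z).mem a = s.mem a :=
    fun s t z a h => Function.update_of_ne h _ _
  induction c with
  | skip => intros; rfl
  | setInt r n => intros; rfl
  | opInt o r x y => intros; rfl
  | setNum t a b =>
    intro s a' h
    exact hset _ _ _ (by simpa [Prog.arrs] using h)
  | expNum t x =>
    intro s a' h
    exact hset _ _ _ (by simpa [Prog.arrs] using h)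
  | opNum o t x y =>
    intro s a' h
    exact hset _ _ _ (by simpa [Prog.arrs] using h)
  | seq c d hc hd =>
    intro s r h
    simp only [Prog.arrs, List.mem_append, not_or] at h
    rw [Prog.run, hd _ h.2, hc _ h.1]
  | ifZero r c d hc hd =>
    intro s r h
    simp only [Prog.arrs, List.mem_append, not_or] at h
    rw [Prog.run]
    split_ifs
    · exact hc _ h.1
    · exact hd _ h.2
  | loop r c hc =>
    intro s a h
    rw [Prog.run]
    generalize s.reg r = n
    induction n generalizing s with
    | zero => rfl
    | succ n ih => rw [Function.iterate_succ_apply, ih, hc _ h]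

/-- `s'` agrees with `s` on the registers and arrays that `c` does not write. -/
def Frame (c : Prog) (s s' : Store) : Prop :=
  (∀ r, r ∉ c.regs → s'.reg r = s.reg r) ∧ ∀ a, a ∉ c.arrs → s'.mem a = s.mem a

theorem frame_run (c : Prog) (s : Store) : Frame c s (c.run s) :=
  ⟨fun _ h => c.run_reg s h, fun _ h => c.run_mem s h⟩

/-- From `s`, the program `c` reaches a store satisfying `Q` in at most `T` steps, using cells of
the arrays `0, …, 31` with addresses below `W` only, and writing integers up to `W` only. -/
def Ok (W T : ℕ) (c : Prog) (s : Store) (Q : Store → Prop) : Prop :=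
  Q (c.run s) ∧ c.time s ≤ T ∧ c.cells s ⊆ Finset.range 32 ×ˢ Finset.range W ∧ c.peak s ≤ W

theorem Ok.mono {W T T' : ℕ} {c : Prog} {s : Store} {Q Q' : Store → Prop} (h : Ok W T c s Q)
    (hT : T ≤ T') (hQ : ∀ s', Q s' → Frame c s s' → Q' s') : Ok W T' c s Q' :=
  ⟨hQ _ h.1 (frame_run c s), h.2.1.trans hT, h.2.2⟩

theorem Ok.seq {W T T₁ T₂ : ℕ} {c d : Prog} {s : Store} {P Q : Store → Prop}
    (hc : Ok W T₁ c s P) (hd : ∀ s', P s' → Frame c s s' → Ok W T₂ d s' Q)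
    (hT : T₁ + T₂ ≤ T) : Ok W T (.seq c d) s Q := by
  obtain ⟨h1, h2, h3, h4⟩ := hc
  obtain ⟨g1, g2, g3, g4⟩ := hd _ h1 (frame_run c s)
  refine ⟨g1, ?_, Finset.union_subset h3 g3, max_le h4 g4⟩
  rw [Prog.time]
  omega

theorem ok_skip {W T : ℕ} {s : Store} {Q : Store → Prop} :
    Ok W T .skip s Q ↔ 1 ≤ T ∧ Q s := by
  simp [Ok, Prog.run, Prog.time, Prog.cells, Prog.peak, and_comm]

/-- This and the following rules are equivalences so that `simp` can execute straight-line code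
symbolically. Each instruction lowers the time budget by one and leaves its bounds as side goals. -/
theorem ok_setInt_seq {W T r n : ℕ} {d : Prog} {s : Store} {Q : Store → Prop} :
    Ok W T (.seq (.setInt r n) d) s Q ↔ 1 ≤ T ∧ n ≤ W ∧ Ok W (T - 1) d (s.setReg r n) Q := by
  simp only [Ok, Prog.run, Prog.time, Prog.cells, Prog.peak, Finset.empty_union, max_le_iff]
  have : 1 + d.time (s.setReg r n) ≤ T ↔ 1 ≤ T ∧ d.time (s.setReg r n) ≤ T - 1 := by omega
  rw [this]
  tauto

theorem ok_opInt_seq {W T r x y : ℕ} {o : IntOp} {d : Prog} {s : Store} {Q : Store → Prop} :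
    Ok W T (.seq (.opInt o r x y) d) s Q ↔ 1 ≤ T ∧ o.eval (s.reg x) (s.reg y) ≤ W ∧
      Ok W (T - 1) d (s.setReg r (o.eval (s.reg x) (s.reg y))) Q := by
  simp only [Ok, Prog.run, Prog.time, Prog.cells, Prog.peak, Finset.empty_union, max_le_iff]
  generalize s.setReg r (o.eval (s.reg x) (s.reg y)) = s'
  have : 1 + d.time s' ≤ T ↔ 1 ≤ T ∧ d.time s' ≤ T - 1 := by omega
  rw [this]
  tauto

theorem ok_setNum_seq {W T : ℕ} {t : Ref} {a b : ℤ} {d : Prog} {s : Store} {Q : Store → Prop} :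
    Ok W T (.seq (.setNum t a b) d) s Q ↔ 1 ≤ T ∧ (t.arr < 32 ∧ s.reg t.ix < W) ∧
      Ok W (T - 1) d (s.set t ((a : ℂ) + (b : ℂ) * Complex.I)) Q := by
  simp only [Ok, Prog.run, Prog.time, Prog.cells, Prog.peak, max_le_iff, Finset.union_subset_iff,
    Finset.singleton_subset_iff, Finset.mem_product, Finset.mem_range, Store.cell]
  generalize s.set t ((a : ℂ) + (b : ℂ) * Complex.I) = s'
  have : 1 + d.time s' ≤ T ↔ 1 ≤ T ∧ d.time s' ≤ T - 1 := by omega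
  rw [this]
  have := Nat.zero_le W
  tauto

theorem ok_expNum_seq {W T : ℕ} {t x : Ref} {d : Prog} {s : Store} {Q : Store → Prop} :
    Ok W T (.seq (.expNum t x) d) s Q ↔ 1 ≤ T ∧
      ((t.arr < 32 ∧ s.reg t.ix < W) ∧ (x.arr < 32 ∧ s.reg x.ix < W)) ∧
      Ok W (T - 1) d (s.set t (Complex.exp (s.mem x.arr (s.reg x.ix)))) Q := by
  simp only [Ok, Prog.run, Prog.time, Prog.cells, Prog.peak, max_le_iff, Finset.union_subset_iff,
    Finset.insert_subset_iff, Finset.singleton_subset_iff, Finset.mem_product, Finset.mem_range,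
    Store.cell, Store.get]
  generalize s.set t (Complex.exp (s.mem x.arr (s.reg x.ix))) = s'
  have : 1 + d.time s' ≤ T ↔ 1 ≤ T ∧ d.time s' ≤ T - 1 := by omega
  rw [this]
  have := Nat.zero_le W
  tauto

theorem ok_opNum_seq {W T : ℕ} {o : NumOp} {t x y : Ref} {d : Prog} {s : Store}
    {Q : Store → Prop} :
    Ok W T (.seq (.opNum o t x y) d) s Q ↔ 1 ≤ T ∧
      ((t.arr < 32 ∧ s.reg t.ix < W) ∧ (x.arr < 32 ∧ s.reg x.ix < W) ∧
        (y.arr < 32 ∧ s.reg y.ix < W)) ∧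
      Ok W (T - 1) d
        (s.set t (o.eval (s.mem x.arr (s.reg x.ix)) (s.mem y.arr (s.reg y.ix)))) Q := by
  simp only [Ok, Prog.run, Prog.time, Prog.cells, Prog.peak, max_le_iff, Finset.union_subset_iff,
    Finset.insert_subset_iff, Finset.singleton_subset_iff, Finset.mem_product, Finset.mem_range,
    Store.cell, Store.get]
  generalize s.set t (o.eval (s.mem x.arr (s.reg x.ix)) (s.mem y.arr (s.reg y.ix))) = s'
  have : 1 + d.time s' ≤ T ↔ 1 ≤ T ∧ d.time s' ≤ T - 1 := by omega
  rw [this]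
  have := Nat.zero_le W
  tauto

theorem ok_skip_seq {W T : ℕ} {d : Prog} {s : Store} {Q : Store → Prop} :
    Ok W T (.seq .skip d) s Q ↔ 1 ≤ T ∧ Ok W (T - 1) d s Q := by
  simp only [Ok, Prog.run, Prog.time, Prog.cells, Prog.peak, Finset.empty_union, max_le_iff]
  have : 1 + d.time s ≤ T ↔ 1 ≤ T ∧ d.time s ≤ T - 1 := by omega
  rw [this]
  have := Nat.zero_le W
  tauto

theorem ok_seq_seq {W T : ℕ} {c d e : Prog} {s : Store} {Q : Store → Prop} :
    Ok W T (.seq (.seq c d) e) s Q ↔ Ok W T (.seq c (.seq d e)) s Q := by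
  simp only [Ok, Prog.run, Prog.time, Prog.cells, Prog.peak, Finset.union_assoc, max_assoc,
    add_assoc]

/-- The continuation is pushed into both branches, so a known test value leaves straight-line code.
-/
theorem ok_ifZero_seq {W T r : ℕ} {c d e : Prog} {s : Store} {Q : Store → Prop} :
    Ok W T (.seq (.ifZero r c d) e) s Q ↔ 1 ≤ T ∧
      if s.reg r = 0 then Ok W (T - 1) (.seq c e) s Q else Ok W (T - 1) (.seq d e) s Q := by
  have h : ∀ x y, 1 + x + y ≤ T ↔ 1 ≤ T ∧ x + y ≤ T - 1 := fun x y => by omega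
  by_cases hr : s.reg r = 0
  · simp only [Ok, Prog.run, Prog.time, Prog.cells, Prog.peak, if_pos hr, h]
    tauto
  · simp only [Ok, Prog.run, Prog.time, Prog.cells, Prog.peak, if_neg hr, h]
    tauto

theorem Ok.loop {W T r n : ℕ} {c : Prog} {s : Store} {Q : Store → Prop} (I : ℕ → Store → Prop)
    (hn : s.reg r = n) (h0 : I 0 s) (hc : ∀ k < n, ∀ s', I k s' → Ok W T c s' (I (k + 1)))
    (hQ : ∀ s', I n s' → Q s') : Ok W (1 + n * (1 + T)) (.loop r c) s Q := by
  have hI : ∀ k ≤ n, I k (c.run^[k] s) := by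
    intro k
    induction k with
    | zero => intro _; exact h0
    | succ k ih =>
      intro hk
      rw [Function.iterate_succ_apply']
      exact (hc k (by omega) _ (ih (by omega))).1
  have hok := fun k (hk : k < n) => (hc k hk _ (hI k hk.le)).2
  refine ⟨?_, ?_, ?_, ?_⟩
  · rw [Prog.run, hn]
    exact hQ _ (hI n le_rfl)
  · rw [Prog.time, hn]
    have := Finset.sum_le_card_nsmul (Finset.range n) (fun k => 1 + c.time (c.run^[k] s)) (1 + T)
      fun k hk => Nat.add_le_add_left (hok k (Finset.mem_range.1 hk)).1 1
    simpa using this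
  · rw [Prog.cells, hn]
    exact Finset.biUnion_subset.2 fun k hk => (hok k (Finset.mem_range.1 hk)).2.1
  · rw [Prog.peak, hn]
    exact Finset.sup_le fun k hk => (hok k (Finset.mem_range.1 hk)).2.2

/-- Sequential composition of a list of programs. -/
def seqs : List Prog → Prog
  | [] => .skip
  | c :: cs => .seq c (seqs cs)

/-- `for i = 0, …, n - 1 do c`, where `n` is the content of register `n`, and register `2`
contains `1`. -/
def forN (i n : ℕ) (c : Prog) : Prog :=
  .seq (.setInt i 0) (.loop n (.seq c (.seq (.opInt .add i i 2) .skip)))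

theorem regs_forN (i n : ℕ) (c : Prog) : (forN i n c).regs = i :: (c.regs ++ [i]) := by
  simp [forN, Prog.regs]

theorem arrs_forN (i n : ℕ) (c : Prog) : (forN i n c).arrs = c.arrs := by
  simp [forN, Prog.arrs]

/-- The body may assume the value of the counter and that whatever it does not write is as before
the loop, so invariants mention only what changes. A pass costs T + 3: loop test, body, increment
and closing `skip`. The remaining 2 are the initialization and the entry of the loop. -/
theorem Ok.forN {W T T' i n m : ℕ} {c : Prog} {s : Store} {Q : Store → Prop}
    (I : ℕ → Store → Prop) (hin : n ≠ i) (hi2 : i ≠ 2) (hi : i ∉ c.regs) (h2 : 2 ∉ c.regs)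
    (h1 : s.reg 2 = 1) (hm : s.reg n = m) (hW : m ≤ W)
    (h0 : I 0 (s.setReg i 0))
    (hc : ∀ k < m, ∀ s', I k s' → s'.reg i = k → (∀ r, r ≠ i → r ∉ c.regs → s'.reg r = s.reg r) →
      (∀ a, a ∉ c.arrs → s'.mem a = s.mem a) →
      Ok W T c s' fun s'' => I (k + 1) (s''.setReg i (k + 1)))
    (hQ : ∀ s', I m s' → Frame (MCAnsatz.forN i n c) s s' → Q s')
    (hT : 2 + m * (T + 3) ≤ T') :
    Ok W T' (MCAnsatz.forN i n c) s Q := by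
  suffices h : Ok W (2 + m * (T + 3)) (MCAnsatz.forN i n c) s (I m) from h.mono hT hQ
  rw [MCAnsatz.forN, ok_setInt_seq]
  refine ⟨by omega, Nat.zero_le _, ?_⟩
  let J : ℕ → Store → Prop := fun k s' => I k s' ∧ s'.reg i = k ∧
    (∀ r, r ≠ i → r ∉ c.regs → s'.reg r = s.reg r) ∧ ∀ a, a ∉ c.arrs → s'.mem a = s.mem a
  have hl : Ok W (1 + m * (1 + (T + 2))) (.loop n (.seq c (.seq (.opInt .add i i 2) .skip)))
      (s.setReg i 0) (I m) := by
    refine Ok.loop J ?_ ⟨h0, by simp, fun r hr _ => by simp [hr], fun _ _ => rfl⟩ ?_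
      fun s' h => h.1
    · simpa [hin] using hm
    · rintro k hk s' ⟨hI, hk', hr, ha⟩
      refine Ok.seq (T₂ := 2) (hc k hk s' hI hk' hr ha) (fun s'' hI' hF => ?_) le_rfl
      have e1 : s''.reg i = k := by rw [hF.1 i hi, hk']
      have e2 : s''.reg 2 = 1 := by rw [hF.1 2 h2, hr 2 hi2.symm h2, h1]
      rw [ok_opInt_seq, ok_skip]
      simp only [IntOp.eval, e1, e2]
      refine ⟨by omega, by omega, by omega, hI', by simp, fun r hri hrc => ?_, fun a hac => ?_⟩
      · simp [hri, hF.1 r hrc, hr r hri hrc]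
      · rw [Store.setReg_mem, hF.2 a hac, ha a hac]
  exact hl.mono (by have : 1 + (T + 2) = T + 3 := by omega
                    rw [this]; omega) fun _ h _ => h

/-- Array names are below 32 and addresses below W, hence at most 32 W cells. -/
theorem Ok.spec {W T : ℕ} {c : Prog} {s : Store} {Q : Store → Prop} (h : Ok W T c s Q) :
    Q (c.run s) ∧ c.time s ≤ T ∧ c.space s ≤ 32 * W ∧ c.peak s ≤ W :=
  ⟨h.1, h.2.1, (Finset.card_le_card h.2.2.1).trans (by simp), h.2.2.2⟩

attribute [irreducible] Ok

/-! ### The program -/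

/-- The number of strings. -/
def strCount (p : ℕ) : ℕ := 2 ^ (2 * p + 1)

/-- The bound on addresses and on integers. -/
def sizeBound (p : ℕ) : ℕ := strCount p * strCount p

/-- Addresses in the per-position tables reach 4p + 1 and row numbers reach p, so both fit below N.
Equality holds at p = 1. -/
theorem strCount_ge {p : ℕ} (hp : 1 ≤ p) : 4 * p + 4 ≤ strCount p := by
  obtain ⟨q, rfl⟩ : ∃ q, p = q + 1 := ⟨p - 1, by omega⟩
  rw [strCount]
  induction q with
  | zero => norm_num
  | succ q ih =>
    have := ih (by omega)
    rw [show 2 * (q + 1 + 1) + 1 = 2 * (q + 1) + 1 + 2 by ring, pow_add]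
    omega

theorem sizeBound_ge {p : ℕ} (hp : 1 ≤ p) : 8 * strCount p ≤ sizeBound p :=
  Nat.mul_le_mul_right _ (by have := strCount_ge hp; omega)

theorem index_lt_sizeBound {p a b : ℕ} (ha : a < strCount p) (hb : b < strCount p) :
    a * strCount p + b < sizeBound p := by
  rw [sizeBound]
  nlinarith

/-- The constants set up at the start of the program. -/
structure Base (p D : ℕ) (s : Store) : Prop where
  r0 : s.reg 0 = p
  r1 : s.reg 1 = 0
  r2 : s.reg 2 = 1
  r3 : s.reg 3 = 2
  r4 : s.reg 4 = strCount p
  r5 : s.reg 5 = 2 * p + 1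
  r6 : s.reg 6 = 2 * p
  r7 : s.reg 7 = 2 ^ p
  zero : s.mem 11 0 = 0
  half : s.mem 12 0 = 1 / 2
  im : s.mem 13 0 = Complex.I
  kappa : s.mem 14 0 = -(Complex.I / (Real.sqrt D : ℂ))

theorem Base.congr {p D : ℕ} {s s' : Store} (h : Base p D s) (hr : ∀ r < 8, s'.reg r = s.reg r)
    (hm : ∀ a < 15, 10 < a → s'.mem a = s.mem a) : Base p D s' where
  r0 := by rw [hr 0 (by omega), h.r0]
  r1 := by rw [hr 1 (by omega), h.r1]
  r2 := by rw [hr 2 (by omega), h.r2]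
  r3 := by rw [hr 3 (by omega), h.r3]
  r4 := by rw [hr 4 (by omega), h.r4]
  r5 := by rw [hr 5 (by omega), h.r5]
  r6 := by rw [hr 6 (by omega), h.r6]
  r7 := by rw [hr 7 (by omega), h.r7]
  zero := by rw [hm 11 (by omega) (by omega), h.zero]
  half := by rw [hm 12 (by omega) (by omega), h.half]
  im := by rw [hm 13 (by omega) (by omega), h.im]
  kappa := by rw [hm 14 (by omega) (by omega), h.kappa]

theorem Base.of_frame {p D : ℕ} {c : Prog} {s s' : Store} (h : Base p D s) (hF : Frame c s s')
    (hr : ∀ r < 8, r ∉ c.regs) (ha : ∀ a < 15, 10 < a → a ∉ c.arrs) : Base p D s' :=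
  h.congr (fun r hr' => hF.1 r (hr r hr')) fun a ha' ha'' => hF.2 a (ha a ha' ha'')

/-- Set up the constants. -/
def setup : Prog := seqs
  [.setInt 2 1, .setInt 3 2, .opInt .add 6 0 0, .opInt .add 5 6 2, .setInt 4 1, .setInt 7 1,
    .setNum ⟨10, 1⟩ 1 0, .setNum ⟨16, 1⟩ 2 0, .opNum .div ⟨12, 1⟩ ⟨10, 1⟩ ⟨16, 1⟩,
    .opNum .pow ⟨17, 1⟩ ⟨0, 1⟩ ⟨12, 1⟩, .setNum ⟨13, 1⟩ 0 1, .setNum ⟨14, 1⟩ 0 (-1),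
    .opNum .div ⟨14, 1⟩ ⟨14, 1⟩ ⟨17, 1⟩, .setNum ⟨11, 1⟩ 0 0,
    forN 10 5 (seqs [.opInt .mul 4 4 3]), forN 10 0 (seqs [.opInt .mul 7 7 3])]

/-- The machine has no square root; it computes √D as a principal power with exponent 1/2. -/
theorem natCast_cpow_half (D : ℕ) : (D : ℂ) ^ (1 / 2 : ℂ) = (Real.sqrt D : ℂ) := by
  rw [Real.sqrt_eq_rpow, Complex.ofReal_cpow (Nat.cast_nonneg D)]
  push_cast
  rfl

theorem ok_setup {p D m : ℕ} (hp : 1 ≤ p) (cI cX cY cZ : ℝ) (γ β : ℕ → ℝ) :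
    Ok (sizeBound p) (40 + 15 * p) setup (inputStore p D m cI cX cY cZ γ β) (Base p D) := by
  have hN := strCount_ge hp
  have hW := sizeBound_ge hp
  simp only [setup, seqs, ok_setInt_seq, ok_opInt_seq, ok_setNum_seq, ok_opNum_seq]
  simp [IntOp.eval, NumOp.eval, inputStore]
  have h2 := natCast_cpow_half D
  rw [one_div] at h2
  repeat' refine And.intro ?_ ?_
  any_goals omega
  -- The powers of two are produced by repeated doubling. A pass costs 5 steps: 2 for the body with
  -- its `skip`, and 3 for the loop.
  refine Ok.seq (T₁ := 2 + (2 * p + 1) * 5) (T₂ := 3 + p * 5) (Ok.forN (T := 2) (m := 2 * p + 1)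
    (fun k s' => s'.reg 4 = 2 ^ k) (by decide) (by decide) (by decide) (by decide) (by simp)
    (by simp; omega) (by omega) (by simp) ?_ (fun s' h _ => h) le_rfl) (fun s' h hF => ?_)
    (by omega)
  · intro k hk s' h1 h2 hr _
    have h3 : s'.reg 3 = 2 := by rw [hr 3 (by decide) (by decide)]; simp
    have hle : 2 ^ k * 2 ≤ sizeBound p := by
      rw [← pow_succ]
      exact (Nat.pow_le_pow_right (by omega) (by omega : k + 1 ≤ 2 * p + 1)).trans
        (by rw [strCount] at hW; omega)
    simp [ok_opInt_seq, ok_skip, IntOp.eval, h1, h3, hle, pow_succ]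
  · refine Ok.seq (T₁ := 2 + p * 5) (T₂ := 1) (Ok.forN (T := 2) (m := p)
      (fun k s' => s'.reg 7 = 2 ^ k) (by decide) (by decide) (by decide) (by decide)
      (by rw [hF.1 2 (by decide)]; simp) (by rw [hF.1 0 (by decide)]; simp) (by omega)
      (by simp [hF.1 7 (by decide)]) ?_ (fun s' h _ => h) le_rfl)
      (fun s'' h' hF' => ?_) (by omega)
    · intro k hk s'' h1 h2 hr _
      have h3 : s''.reg 3 = 2 := by
        rw [hr 3 (by decide) (by decide), hF.1 3 (by decide)]; simp
      have hle : 2 ^ k * 2 ≤ sizeBound p := by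
        rw [← pow_succ]
        exact (Nat.pow_le_pow_right (by omega) (by omega : k + 1 ≤ 2 * p + 1)).trans
          (by rw [strCount] at hW; omega)
      simp [ok_opInt_seq, ok_skip, IntOp.eval, h1, h3, hle, pow_succ]
    · rw [ok_skip]
      refine ⟨le_rfl, ?_⟩
      constructor
      · rw [hF'.1 0 (by decide), hF.1 0 (by decide)]; simp
      · rw [hF'.1 1 (by decide), hF.1 1 (by decide)]; simp
      · rw [hF'.1 2 (by decide), hF.1 2 (by decide)]; simp
      · rw [hF'.1 3 (by decide), hF.1 3 (by decide)]; simp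
      · rw [hF'.1 4 (by decide), h, strCount]
      · rw [hF'.1 5 (by decide), hF.1 5 (by decide)]; simp; omega
      · rw [hF'.1 6 (by decide), hF.1 6 (by decide)]; simp; omega
      · exact h'
      · rw [hF'.2 11 (by decide), hF.2 11 (by decide)]; simp
      · rw [hF'.2 12 (by decide), hF.2 12 (by decide)]; simp
      · rw [hF'.2 13 (by decide), hF.2 13 (by decide)]; simp
      · rw [hF'.2 14 (by decide), hF.2 14 (by decide)]; simp [h2, neg_div]

/-! ### Tables for single positions: rotations and phases -/

/-- Tabulate the entries of the rotation number `i`, where `i` is the content of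
register `10`. -/
def rotBody : Prog := seqs
  -- The truncated difference p - k vanishes exactly in the second half of the chain, where the
  -- angle is negated and read backwards.
  [.opInt .sub 11 0 10,
    .ifZero 11 (seqs [.opInt .sub 12 6 10, .opNum .sub ⟨16, 1⟩ ⟨11, 1⟩ ⟨2, 12⟩])
      (seqs [.opInt .add 12 10 2, .opNum .add ⟨16, 1⟩ ⟨11, 1⟩ ⟨2, 12⟩]),
    .opNum .mul ⟨16, 1⟩ ⟨16, 1⟩ ⟨13, 1⟩, .expNum ⟨17, 1⟩ ⟨16, 1⟩,
    .opNum .sub ⟨16, 1⟩ ⟨11, 1⟩ ⟨16, 1⟩, .expNum ⟨16, 1⟩ ⟨16, 1⟩,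
    .opInt .add 13 10 10, .opInt .add 14 13 2,
    .opNum .add ⟨5, 13⟩ ⟨17, 1⟩ ⟨16, 1⟩, .opNum .mul ⟨5, 13⟩ ⟨5, 13⟩ ⟨12, 1⟩,
    .opNum .sub ⟨5, 14⟩ ⟨17, 1⟩ ⟨16, 1⟩, .opNum .mul ⟨5, 14⟩ ⟨5, 14⟩ ⟨12, 1⟩,
    -- The sum of the two truncated differences is |k + 1 - p|, so the test singles out k + 1 = p,
    -- the factor altered in `f'`. There the two entries are swapped.
    .opInt .add 15 10 2, .opInt .sub 16 15 0, .opInt .sub 15 0 15, .opInt .add 15 15 16,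
    .ifZero 15
      (seqs [.opNum .add ⟨6, 13⟩ ⟨5, 14⟩ ⟨11, 1⟩, .opNum .add ⟨6, 14⟩ ⟨5, 13⟩ ⟨11, 1⟩])
      (seqs [.opNum .add ⟨6, 13⟩ ⟨5, 13⟩ ⟨11, 1⟩, .opNum .add ⟨6, 14⟩ ⟨5, 14⟩ ⟨11, 1⟩])]

/-- The entry `⟨x|e^{iθX}|y⟩`, where `d = 0` if `x = y` and `d = 1` otherwise. -/
def rotVal (θ : ℝ) (d : ℕ) : ℂ := if d = 0 then Complex.cos θ else Complex.I * Complex.sin θ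

theorem cos_eq_half (z : ℂ) :
    (Complex.exp (z * Complex.I) + Complex.exp (-(z * Complex.I))) * 2⁻¹ = Complex.cos z := by
  rw [Complex.cos, neg_mul, div_eq_mul_inv]

theorem I_mul_sin_eq_half (z : ℂ) :
    (Complex.exp (z * Complex.I) - Complex.exp (-(z * Complex.I))) * 2⁻¹ =
      Complex.I * Complex.sin z := by
  rw [Complex.sin, neg_mul]
  linear_combination (Complex.exp (z * Complex.I) - Complex.exp (-(z * Complex.I))) / 2 *
    Complex.I_sq

theorem cos_eq_half' (z : ℂ) :
    (Complex.exp (-(z * Complex.I)) + Complex.exp (z * Complex.I)) * 2⁻¹ = Complex.cos z := by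
  rw [add_comm, cos_eq_half]

theorem I_mul_sin_eq_half' (z : ℂ) :
    (Complex.exp (-(z * Complex.I)) - Complex.exp (z * Complex.I)) * 2⁻¹ =
      -(Complex.I * Complex.sin z) := by
  rw [← I_mul_sin_eq_half]
  ring

/-- The tables `5` and `6` hold the entries of the rotations. -/
def RotTable (p : ℕ) (β : ℕ → ℝ) (k : ℕ) (s : Store) : Prop :=
  ∀ j < k, s.mem 5 (2 * j) = rotVal (angleAt p β j) 0 ∧
    s.mem 5 (2 * j + 1) = rotVal (angleAt p β j) 1 ∧
    s.mem 6 (2 * j) = rotVal (angleAt p β j) (if j + 1 = p then 1 else 0) ∧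
    s.mem 6 (2 * j + 1) = rotVal (angleAt p β j) (if j + 1 = p then 0 else 1)

theorem ok_rotBody {p D k : ℕ} {β : ℕ → ℝ} {s : Store} (hp : 1 ≤ p) (hs : Base p D s)
    (hβ : ∀ i, 1 ≤ i → i ≤ p → s.mem 2 i = β i) (hk : s.reg 10 = k) (hkp : k < 2 * p)
    (hT : RotTable p β k s) :
    Ok (sizeBound p) 25 rotBody s (RotTable p β (k + 1)) := by
  have hN := strCount_ge hp
  have hW := sizeBound_ge hp
  by_cases h1 : k < p
  · have e1 : ¬ p - k = 0 := by omega
    have e2 : s.mem 2 (k + 1) = β (k + 1) := hβ _ (by omega) (by omega)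
    have e3 : angleAt p β k = β (k + 1) := by rw [angleAt, if_pos h1]
    by_cases h2 : k + 1 = p
    · have e4 : k + 1 - p = 0 := by omega
      have e5 : p - (k + 1) = 0 := by omega
      simp [rotBody, seqs, ok_opInt_seq, ok_opNum_seq, ok_expNum_seq, ok_ifZero_seq, ok_seq_seq,
        ok_skip_seq, ok_skip, IntOp.eval, NumOp.eval, hs.r0, hs.r1, hs.r2, hk, hs.zero,
        hs.half, hs.im, e1, e2, e4, e5, cos_eq_half, I_mul_sin_eq_half]
      repeat' refine And.intro ?_ ?_
      any_goals omega
      intro j hj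
      rcases Nat.lt_succ_iff_lt_or_eq.1 hj with hj | rfl
      · have := hT j hj
        have i1 : 2 * j ≠ k + k := by omega
        have i2 : 2 * j ≠ k + k + 1 := by omega
        have i3 : 2 * j + 1 ≠ k + k := by omega
        simpa [i1, i2, i3, show j ≠ k by omega] using this
      · simp [two_mul, rotVal, e3, h2]
    · have e4 : ¬ p - (k + 1) = 0 := by omega
      simp [rotBody, seqs, ok_opInt_seq, ok_opNum_seq, ok_expNum_seq, ok_ifZero_seq, ok_seq_seq,
        ok_skip_seq, ok_skip, IntOp.eval, NumOp.eval, hs.r0, hs.r1, hs.r2, hk, hs.zero,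
        hs.half, hs.im, e1, e2, e4, cos_eq_half, I_mul_sin_eq_half]
      repeat' refine And.intro ?_ ?_
      any_goals omega
      intro j hj
      rcases Nat.lt_succ_iff_lt_or_eq.1 hj with hj | rfl
      · have := hT j hj
        have i1 : 2 * j ≠ k + k := by omega
        have i2 : 2 * j ≠ k + k + 1 := by omega
        have i3 : 2 * j + 1 ≠ k + k := by omega
        simpa [i1, i2, i3, show j ≠ k by omega] using this
      · simp [two_mul, rotVal, e3, h2]
  · have e1 : p - k = 0 := by omega
    have e2 : s.mem 2 (2 * p - k) = β (2 * p - k) := hβ _ (by omega) (by omega)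
    have e3 : angleAt p β k = -β (2 * p - k) := by rw [angleAt, if_neg h1]
    have e4 : ¬ k + 1 - p = 0 := by omega
    have h2 : ¬ k + 1 = p := by omega
    simp [rotBody, seqs, ok_opInt_seq, ok_opNum_seq, ok_expNum_seq, ok_ifZero_seq, ok_seq_seq,
      ok_skip_seq, ok_skip, IntOp.eval, NumOp.eval, hs.r0, hs.r1, hs.r2, hs.r6, hk, hs.zero,
      hs.half, hs.im, e1, e2, e4, cos_eq_half', I_mul_sin_eq_half']
    repeat' refine And.intro ?_ ?_
    any_goals omega
    intro j hj
    rcases Nat.lt_succ_iff_lt_or_eq.1 hj with hj | rfl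
    · have := hT j hj
      have i1 : 2 * j ≠ k + k := by omega
      have i2 : 2 * j ≠ k + k + 1 := by omega
      have i3 : 2 * j + 1 ≠ k + k := by omega
      simpa [i1, i2, i3, show j ≠ k by omega] using this
    · simp [two_mul, rotVal, e3, h2]

theorem ok_rotTables {p D : ℕ} {β : ℕ → ℝ} {s : Store} (hp : 1 ≤ p) (hs : Base p D s)
    (hβ : ∀ i, 1 ≤ i → i ≤ p → s.mem 2 i = β i) :
    Ok (sizeBound p) (2 + 2 * p * 28) (forN 10 6 rotBody) s (RotTable p β (2 * p)) := by
  have hN := strCount_ge hp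
  have hW := sizeBound_ge hp
  refine Ok.forN (T := 25) (fun k s' => RotTable p β k s') (by decide) (by decide)
    (by decide) (by decide) hs.r2 hs.r6 (by omega) (fun j hj => absurd hj (Nat.not_lt_zero j))
    (fun k hk s' hI h1 hr ha => ?_) (fun s' h _ => h) le_rfl
  have hb : Base p D s' := hs.congr
    (fun r hr8 => hr r (by omega) (by simp [rotBody, seqs, Prog.regs]; omega))
    (fun a ha15 ha10 => ha a (by simp [rotBody, seqs, Prog.arrs]; omega))
  exact (ok_rotBody hp hb (by rwa [ha 2 (by decide)]) h1 hk hI).mono le_rfl fun s'' h _ => h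

/-- Tabulate `-(i/√D) Γ_k` and its negative, where `k` is the content of register `10`. -/
def gammaBody : Prog := seqs
  [.opInt .sub 11 0 10,
    .ifZero 11 (seqs [.opInt .sub 12 5 10, .opNum .sub ⟨16, 1⟩ ⟨11, 1⟩ ⟨1, 12⟩])
      (seqs [.opInt .add 12 10 2, .opNum .add ⟨16, 1⟩ ⟨11, 1⟩ ⟨1, 12⟩]),
    .opInt .add 13 10 10, .opInt .add 14 13 2,
    .opNum .mul ⟨7, 13⟩ ⟨14, 1⟩ ⟨16, 1⟩, .opNum .sub ⟨7, 14⟩ ⟨11, 1⟩ ⟨7, 13⟩]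

/-- The table `7` holds the phases of single positions. -/
def GammaTable (p D : ℕ) (γ : ℕ → ℝ) (k : ℕ) (s : Store) : Prop :=
  ∀ j < k, s.mem 7 (2 * j) = -(Complex.I / (Real.sqrt D : ℂ)) * gammaAt p γ j ∧
    s.mem 7 (2 * j + 1) = -(-(Complex.I / (Real.sqrt D : ℂ)) * gammaAt p γ j)

theorem ok_gammaTable {p D : ℕ} {γ : ℕ → ℝ} {s : Store} (hp : 1 ≤ p) (hs : Base p D s)
    (hγ : ∀ i, 1 ≤ i → i ≤ p → s.mem 1 i = γ i) (hγ' : s.mem 1 (p + 1) = 0) :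
    Ok (sizeBound p) (2 + (2 * p + 1) * 18) (forN 10 5 gammaBody) s
      (GammaTable p D γ (2 * p + 1)) := by
  have hN := strCount_ge hp
  have hW := sizeBound_ge hp
  refine Ok.forN (T := 15) (fun k s' => GammaTable p D γ k s') (by decide) (by decide)
    (by decide) (by decide) hs.r2 hs.r5 (by omega) (fun j hj => absurd hj (Nat.not_lt_zero j))
    (fun k hk s' hT hk' hr ha => ?_) (fun s' h _ => h) le_rfl
  have hb : Base p D s' := hs.congr
    (fun r hr8 => hr r (by omega) (by simp [gammaBody, seqs, Prog.regs]; omega))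
    (fun a ha15 ha10 => ha a (by simp [gammaBody, seqs, Prog.arrs]; omega))
  have ha1 : s'.mem 1 = s.mem 1 := ha 1 (by decide)
  by_cases h1 : k < p
  · have e1 : ¬ p - k = 0 := by omega
    have e2 : s.mem 1 (k + 1) = γ (k + 1) := hγ _ (by omega) (by omega)
    have e3 : gammaAt p γ k = γ (k + 1) := by rw [gammaAt, if_pos h1]
    simp [gammaBody, seqs, ok_opInt_seq, ok_opNum_seq, ok_ifZero_seq, ok_seq_seq,
      ok_skip_seq, ok_skip, IntOp.eval, NumOp.eval, hb.r0, hb.r1, hb.r2, hk', hb.zero,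
      hb.kappa, e1, e2, ha1]
    repeat' refine And.intro ?_ ?_
    any_goals omega
    intro j hj
    rcases Nat.lt_succ_iff_lt_or_eq.1 hj with hj | rfl
    · have := hT j hj
      have i1 : 2 * j ≠ k + k := by omega
      have i2 : 2 * j ≠ k + k + 1 := by omega
      have i3 : 2 * j + 1 ≠ k + k := by omega
      simpa [i1, i2, i3, show j ≠ k by omega] using this
    · simp [two_mul, e3]
  · have e1 : p - k = 0 := by omega
    -- The middle entry of Γ needs no branch of its own: for k = p the address is p + 1, one past
    -- the input, where the cell holds zero.
    have e3 : ((gammaAt p γ k : ℝ) : ℂ) = -s.mem 1 (2 * p + 1 - k) := by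
      rw [gammaAt, if_neg h1]
      split_ifs with h2
      · rw [h2, show 2 * p + 1 - p = p + 1 by omega, hγ']
        simp
      · rw [hγ _ (by omega) (by omega)]
        simp
    simp [gammaBody, seqs, ok_opInt_seq, ok_opNum_seq, ok_ifZero_seq, ok_seq_seq,
      ok_skip_seq, ok_skip, IntOp.eval, NumOp.eval, hb.r0, hb.r1, hb.r2, hb.r5, hk', hb.zero,
      hb.kappa, e1, ha1]
    repeat' refine And.intro ?_ ?_
    any_goals omega
    intro j hj
    rcases Nat.lt_succ_iff_lt_or_eq.1 hj with hj | rfl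
    · have := hT j hj
      have i1 : 2 * j ≠ k + k := by omega
      have i2 : 2 * j ≠ k + k + 1 := by omega
      have i3 : 2 * j + 1 ≠ k + k := by omega
      simpa [i1, i2, i3, show j ≠ k by omega] using this
    · simp [two_mul, e3]

/-! ### Strings and their codes -/

theorem decode_apply {p : ℕ} (n : ℕ) (k : Fin (2 * p + 1)) :
    decode p n k = if n / 2 ^ (k : ℕ) % 2 = 1 then -1 else 1 := by
  simp [decode, Nat.testBit_eq_decide_div_mod_eq]

theorem decode_bijective (p : ℕ) :
    Function.Bijective fun n : Fin (strCount p) => decode p n := by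
  refine (Fintype.bijective_iff_injective_and_card _).2 ⟨fun n m h => ?_, ?_⟩
  · refine Fin.ext (Nat.eq_of_testBit_eq fun k => ?_)
    by_cases hk : k < 2 * p + 1
    · have hk' := congrFun h ⟨k, hk⟩
      simp only [decode] at hk'
      rcases hn : (n : ℕ).testBit k <;> rcases hm : (m : ℕ).testBit k <;>
        simp [hn, hm] at hk' ⊢
    · have hle : strCount p ≤ 2 ^ k := Nat.pow_le_pow_right (by omega) (by omega)
      rw [Nat.testBit_lt_two_pow (n.2.trans_le hle), Nat.testBit_lt_two_pow (m.2.trans_le hle)]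
  · rw [Fintype.card_fun, Fintype.card_units_int, Fintype.card_fin, strCount]
    exact congrArg (2 ^ ·) (Fintype.card_fin _).symm

theorem sum_str {p : ℕ} (g : Str p → ℂ) :
    ∑ a, g a = ∑ n ∈ Finset.range (strCount p), g (decode p n) := by
  rw [Finset.sum_range]
  exact ((decode_bijective p).sum_comp g).symm

/-- The exclusive or of the digits `k` and `k + 1` of `n`. -/
def digitXor (n k : ℕ) : ℕ := (n / 2 ^ k + n / 2 ^ (k + 1)) % 2

/-- A rotation entry depends only on whether its two labels agree, so the exclusive or of the digits
addresses the table. -/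
theorem rotX_digits (θ : ℝ) (x y : ℕ) :
    rotX θ (if x % 2 = 1 then -1 else 1) (if y % 2 = 1 then -1 else 1) =
      rotVal θ ((x + y) % 2) := by
  rw [rotX_eq, rotVal]
  rcases Nat.mod_two_eq_zero_or_one x with hx | hx <;>
    rcases Nat.mod_two_eq_zero_or_one y with hy | hy <;>
    simp [hx, hy, Nat.add_mod]

theorem rotX_digits_neg (θ : ℝ) (x y : ℕ) :
    rotX θ (if x % 2 = 1 then -1 else 1) (-(if y % 2 = 1 then -1 else 1)) =
      rotVal θ (1 - (x + y) % 2) := by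
  rw [rotX_eq, rotVal]
  rcases Nat.mod_two_eq_zero_or_one x with hx | hx <;>
    rcases Nat.mod_two_eq_zero_or_one y with hy | hy <;>
    simp [hx, hy, Nat.add_mod]

theorem f_decode (p : ℕ) (β : ℕ → ℝ) (n : ℕ) : f β (decode p n) =
    (∏ k ∈ Finset.range (2 * p), rotVal (angleAt p β k) (digitXor n k)) * 2⁻¹ := by
  rw [f, Finset.prod_range, mul_comm, one_div]
  congr 1
  refine Finset.prod_congr rfl fun k _ => ?_
  rw [decode_apply, decode_apply, rotX_digits]
  rfl

theorem f'_decode (p : ℕ) (β : ℕ → ℝ) (n : ℕ) : f' β (decode p n) =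
    (∏ k ∈ Finset.range (2 * p), rotVal (angleAt p β k)
      (if k + 1 = p then 1 - digitXor n k else digitXor n k)) * 2⁻¹ := by
  rw [f', Finset.prod_range, mul_comm, one_div]
  congr 1
  refine Finset.prod_congr rfl fun k _ => ?_
  rw [decode_apply, decode_apply]
  by_cases h : (k : ℕ) + 1 = p
  · rw [if_pos h, if_pos h]
    exact rotX_digits_neg _ _ _
  · rw [if_neg h, if_neg h]
    exact rotX_digits _ _ _

theorem midEntry_decode (p n : ℕ) :
    midEntry (decode p n) = if n / 2 ^ p % 2 = 0 then 1 else -1 := by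
  rw [midEntry, decode_apply]
  rcases Nat.mod_two_eq_zero_or_one (n / 2 ^ p) with h | h <;> simp [h, sgn]

/-- The parity of the digit sum selects between a stored phase and its negative, matching the two
entries per position of table 7. -/
theorem gammaDot_decode (p : ℕ) (γ : ℕ → ℝ) (a b : ℕ) (c : ℂ) :
    c * (gammaDot γ (decode p a) (decode p b) : ℂ) = ∑ k ∈ Finset.range (2 * p + 1),
      if (a / 2 ^ k + b / 2 ^ k) % 2 = 0 then c * gammaAt p γ k else -(c * gammaAt p γ k) := by
  rw [gammaDot, Finset.sum_range]
  push_cast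
  rw [Finset.mul_sum]
  refine Finset.sum_congr rfl fun k _ => ?_
  rw [show bigGamma p γ k = gammaAt p γ k from rfl, decode_apply, decode_apply]
  rcases Nat.mod_two_eq_zero_or_one (a / 2 ^ (k : ℕ)) with hx | hx <;>
    rcases Nat.mod_two_eq_zero_or_one (b / 2 ^ (k : ℕ)) with hy | hy <;>
    simp [hx, hy, Nat.add_mod]

/-! ### Tabulating the weights of strings -/

/-- Multiply the accumulator by the table entry for the next pair of digits. -/
def chainBody (tbl : ℕ) : Prog := seqs
  [.opInt .add 23 21 1, .opInt .div 21 21 3, .opInt .add 23 23 21, .opInt .mod 23 23 3,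
    .opInt .add 24 22 22, .opInt .add 24 24 23, .opNum .mul ⟨15, 1⟩ ⟨15, 1⟩ ⟨tbl, 24⟩]

/-- The product of the table entries for the neighbouring digits of register `20`. -/
def chainProd (tbl : ℕ) : Prog := seqs
  [.opInt .add 21 20 1, .setNum ⟨15, 1⟩ 1 0, forN 22 6 (chainBody tbl)]

/-- Register 21 runs through the quotients n / 2^k. Consecutive quotients give neighbouring digits
at constant cost, so a string costs O(p). -/
theorem ok_chainProd {p D n tbl : ℕ} {s : Store} (hp : 1 ≤ p) (hs : Base p D s) (ht : tbl < 32)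
    (ht' : tbl ≠ 15) (hn : s.reg 20 = n) (hnN : n < strCount p) :
    Ok (sizeBound p) (5 + 2 * p * 11) (chainProd tbl) s fun s' =>
      s'.mem 15 0 = ∏ k ∈ Finset.range (2 * p), s.mem tbl (2 * k + digitXor n k) := by
  have hN := strCount_ge hp
  have hW := sizeBound_ge hp
  rw [chainProd, seqs, seqs, ok_opInt_seq, ok_setNum_seq]
  simp [IntOp.eval, hs.r1, hn]
  refine ⟨by omega, by omega, by omega, by omega, ?_⟩
  refine Ok.seq (T₂ := 1) (T₁ := 2 + 2 * p * 11)
    (Ok.forN (T := 8) (m := 2 * p) (fun k s' => s'.reg 21 = n / 2 ^ k ∧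
      s'.mem 15 0 = ∏ j ∈ Finset.range k, s.mem tbl (2 * j + digitXor n j))
      (by decide) (by decide) (by simp [chainBody, seqs, Prog.regs])
      (by simp [chainBody, seqs, Prog.regs]) (by simp [hs.r2]) (by simp [hs.r6])
      (by omega) (by simp [hs.r1]) ?_ (fun s' h _ => h) le_rfl) (fun s' h _ => ?_) (by omega)
  · rintro k hk s' ⟨h1, h2⟩ h3 hr ha
    have hb : Base p D s' := hs.congr
      (fun r hr8 => (hr r (by omega) (by simp [chainBody, seqs, Prog.regs]; omega)).trans
        (by simp; omega))
      (fun a ha15 ha10 => by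
        rw [ha a (by simp [chainBody, seqs, Prog.arrs]; omega)]
        funext i
        simp; omega)
    have htb : s'.mem tbl = s.mem tbl := by
      rw [ha tbl (by simpa [chainBody, seqs, Prog.arrs] using ht')]
      funext i
      simp [ht']
    have hq : n / 2 ^ k ≤ n := Nat.div_le_self _ _
    have hq' : n / 2 ^ (k + 1) ≤ n := Nat.div_le_self _ _
    have hx : digitXor n k < 2 := Nat.mod_lt _ (by omega)
    have hx' : (n / 2 ^ k + n / 2 ^ (k + 1)) % 2 = digitXor n k := rfl
    have hd : n / 2 ^ k / 2 = n / 2 ^ (k + 1) := by rw [Nat.div_div_eq_div_mul, pow_succ]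
    simp [chainBody, seqs, ok_opInt_seq, ok_opNum_seq, ok_skip, IntOp.eval, NumOp.eval, hb.r1,
      hb.r3, h1, h2, h3, hd, htb, ht, hx', Finset.prod_range_succ]
    repeat' refine And.intro ?_ ?_
    any_goals omega
    exact Or.inl (by rw [two_mul])
  · rw [seqs, ok_skip]
    exact ⟨le_rfl, h.2⟩

/-- Tabulate the weights of the string encoded by register `20`. -/
def strBody : Prog := seqs
  [chainProd 5, .opNum .mul ⟨8, 20⟩ ⟨15, 1⟩ ⟨12, 1⟩,
    chainProd 6, .opNum .mul ⟨9, 20⟩ ⟨15, 1⟩ ⟨12, 1⟩,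
    .opInt .div 23 20 7, .opInt .mod 23 23 3,
    .ifZero 23
      (seqs [.opNum .add ⟨18, 20⟩ ⟨8, 20⟩ ⟨11, 1⟩, .opNum .add ⟨19, 20⟩ ⟨9, 20⟩ ⟨11, 1⟩])
      (seqs [.opNum .sub ⟨18, 20⟩ ⟨11, 1⟩ ⟨8, 20⟩, .opNum .sub ⟨19, 20⟩ ⟨11, 1⟩ ⟨9, 20⟩])]

/-- The tables `8`, `9`, `18` and `19` hold the weights of the strings. -/
def StrTable (p : ℕ) (β : ℕ → ℝ) (k : ℕ) (s : Store) : Prop :=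
  ∀ n < k, s.mem 8 n = f β (decode p n) ∧ s.mem 9 n = f' β (decode p n) ∧
    s.mem 18 n = midEntry (decode p n) * f β (decode p n) ∧
    s.mem 19 n = midEntry (decode p n) * f' β (decode p n)

theorem RotTable.prod_five {p : ℕ} {β : ℕ → ℝ} {s : Store} (h : RotTable p β (2 * p) s) (n : ℕ) :
    (∏ k ∈ Finset.range (2 * p), s.mem 5 (2 * k + digitXor n k)) * 2⁻¹ = f β (decode p n) := by
  rw [f_decode]
  congr 1
  refine Finset.prod_congr rfl fun k hk => ?_
  have hk' := h k (Finset.mem_range.1 hk)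
  rcases Nat.mod_two_eq_zero_or_one (n / 2 ^ k + n / 2 ^ (k + 1)) with hx | hx <;>
    rw [digitXor, hx]
  · exact hk'.1
  · exact hk'.2.1

theorem RotTable.prod_six {p : ℕ} {β : ℕ → ℝ} {s : Store} (h : RotTable p β (2 * p) s) (n : ℕ) :
    (∏ k ∈ Finset.range (2 * p), s.mem 6 (2 * k + digitXor n k)) * 2⁻¹ = f' β (decode p n) := by
  rw [f'_decode]
  congr 1
  refine Finset.prod_congr rfl fun k hk => ?_
  have hk' := h k (Finset.mem_range.1 hk)
  rcases Nat.mod_two_eq_zero_or_one (n / 2 ^ k + n / 2 ^ (k + 1)) with hx | hx <;>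
    rw [digitXor, hx]
  · exact hk'.2.2.1
  · exact hk'.2.2.2

theorem ok_strBody {p D n : ℕ} {β : ℕ → ℝ} {s : Store} (hp : 1 ≤ p) (hs : Base p D s)
    (hR : RotTable p β (2 * p) s) (hn : s.reg 20 = n) (hnN : n < strCount p)
    (hT : StrTable p β n s) :
    Ok (sizeBound p) (20 + 2 * p * 22) strBody s (StrTable p β (n + 1)) := by
  have hN := strCount_ge hp
  have hW := sizeBound_ge hp
  refine Ok.seq (T₂ := 15 + 2 * p * 11) (ok_chainProd hp hs (by norm_num) (by norm_num) hn hnN)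
    (fun s₁ h₁ hF₁ => ?_) (by omega)
  have hb₁ : Base p D s₁ := hs.of_frame hF₁ (by decide) (by decide)
  have hn₁ : s₁.reg 20 = n := by rw [hF₁.1 20 (by decide), hn]
  rw [seqs, ok_opNum_seq]
  simp [NumOp.eval, hb₁.r1, hb₁.half, hn₁, h₁, hR.prod_five n]
  refine ⟨by omega, by omega, ?_⟩
  set s₂ := s₁.set ⟨8, 20⟩ (f β (decode p n)) with hs₂
  have hb₂ : Base p D s₂ := hb₁.congr (fun _ _ => rfl)
    (fun a h1 h2 => by funext i; simp [hs₂]; omega)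
  have e6 : s₂.mem 6 = s.mem 6 := by
    funext i
    simp [hs₂, hF₁.2 6 (by decide)]
  refine Ok.seq (T₁ := 5 + 2 * p * 11) (T₂ := 9)
    (ok_chainProd hp hb₂ (by norm_num) (by norm_num) hn₁ hnN)
    (fun s₃ h₃ hF₃ => ?_) (by omega)
  have hb₃ : Base p D s₃ := hb₂.of_frame hF₃ (by decide) (by decide)
  have hn₃ : s₃.reg 20 = n := by rw [hF₃.1 20 (by decide), hs₂, Store.set_reg, hn₁]
  have e8 : s₃.mem 8 n = f β (decode p n) := by
    rw [hF₃.2 8 (by decide)]; simp [hs₂, hn₁]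
  rw [e6] at h₃
  have hT₃ : StrTable p β n s₃ := by
    intro j hj
    have hne : j ≠ n := hj.ne
    have := hT j hj
    rw [hF₃.2 8 (by decide), hF₃.2 9 (by decide), hF₃.2 18 (by decide), hF₃.2 19 (by decide)]
    simp only [hs₂, Store.set_mem, hn₁, hF₁.2 8 (by decide), hF₁.2 9 (by decide),
      hF₁.2 18 (by decide), hF₁.2 19 (by decide)]
    simpa [hne] using this
  have hq : n / 2 ^ p ≤ n := Nat.div_le_self _ _
  rcases Nat.mod_two_eq_zero_or_one (n / 2 ^ p) with hm | hm
  all_goals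
    simp [seqs, ok_opNum_seq, ok_opInt_seq, ok_ifZero_seq, ok_seq_seq, ok_skip_seq, ok_skip,
      IntOp.eval, NumOp.eval, hb₃.r1, hb₃.r3, hb₃.r7, hb₃.half, hb₃.zero, hn₃, h₃,
      hR.prod_six n, hm, e8]
    repeat' refine And.intro ?_ ?_
    any_goals omega
    intro j hj
    rcases Nat.lt_succ_iff_lt_or_eq.1 hj with hj | rfl
    · have := hT₃ j hj
      simpa [hn₃, hj.ne] using this
    · simp [midEntry_decode, hm, hn₃, e8]

theorem ok_strTable {p D : ℕ} {β : ℕ → ℝ} {s : Store} (hp : 1 ≤ p) (hs : Base p D s)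
    (hR : RotTable p β (2 * p) s) :
    Ok (sizeBound p) (2 + strCount p * (23 + 2 * p * 22)) (forN 20 4 strBody) s
      (StrTable p β (strCount p)) := by
  have hN := strCount_ge hp
  have hW := sizeBound_ge hp
  refine Ok.forN (T := 20 + 2 * p * 22) (fun k s' => StrTable p β k s') (by decide) (by decide)
    (by decide) (by decide) hs.r2 hs.r4 (by omega) (fun j hj => absurd hj (Nat.not_lt_zero j))
    (fun k hk s' hI h1 hr ha => ?_) (fun s' h _ => h) (le_of_eq (by ring))
  have hb : Base p D s' := hs.congr
    (fun r hr8 => hr r (by omega) (by revert r; decide))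
    (fun a ha15 ha10 => ha a (by revert a; decide))
  refine (ok_strBody hp hb ?_ h1 hk hI).mono le_rfl fun s'' h _ => h
  intro j hj
  rw [ha 5 (by decide), ha 6 (by decide)]
  exact hR j hj

/-! ### Tabulating the phases of pairs of strings -/

/-- Add the phase at the next position to the accumulator. -/
def kerInner : Prog := seqs
  [.opInt .add 23 21 26, .opInt .mod 23 23 3, .opInt .add 24 22 22, .opInt .add 24 24 23,
    .opNum .add ⟨15, 1⟩ ⟨15, 1⟩ ⟨7, 24⟩, .opInt .div 21 21 3, .opInt .div 26 26 3]

/-- Tabulate the phase for the strings encoded by registers `20` and `25`. -/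
def kerBody : Prog := seqs
  [.opInt .add 21 20 1, .opInt .add 26 25 1, .setNum ⟨15, 1⟩ 0 0, forN 22 5 kerInner,
    .opInt .mul 24 20 4, .opInt .add 24 24 25, .expNum ⟨22, 24⟩ ⟨15, 1⟩]

/-- The table `22` holds the phases of the pairs `(a, b)` with `a < k`, or `a = k` and `b < l`. -/
def KerTable (p D : ℕ) (γ : ℕ → ℝ) (k l : ℕ) (s : Store) : Prop :=
  ∀ a b, b < strCount p → (a < k ∨ a = k ∧ b < l) →
    s.mem 22 (a * strCount p + b) = pairPhase D γ (decode p a) (decode p b)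

/-- Row-major addresses do not collide, so writing one entry of a table preserves the others. -/
theorem index_inj {N a b c d : ℕ} (hb : b < N) (hd : d < N) (h : a * N + b = c * N + d) :
    a = c ∧ b = d := by
  have h1 : (a * N + b) / N = a := by
    rw [mul_comm, Nat.mul_add_div (by omega), Nat.div_eq_of_lt hb, add_zero]
  have h2 : (c * N + d) / N = c := by
    rw [mul_comm, Nat.mul_add_div (by omega), Nat.div_eq_of_lt hd, add_zero]
  have h3 : a = c := by rw [← h1, h, h2]
  subst h3
  exact ⟨rfl, by omega⟩

/-- The O(p) cost of a phase is paid once per pair here; otherwise each of the p rounds would pay it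
again and the total would be of order p² 16^p. -/
theorem ok_kerBody {p D a b : ℕ} {γ : ℕ → ℝ} {s : Store} (hp : 1 ≤ p) (hs : Base p D s)
    (hG : GammaTable p D γ (2 * p + 1) s) (ha : s.reg 20 = a) (haN : a < strCount p)
    (hb : s.reg 25 = b) (hbN : b < strCount p) (hT : KerTable p D γ a b s) :
    Ok (sizeBound p) (10 + (2 * p + 1) * 11) kerBody s (KerTable p D γ a (b + 1)) := by
  have hN := strCount_ge hp
  have hW := sizeBound_ge hp
  have hab := index_lt_sizeBound haN hbN
  rw [kerBody]
  simp only [seqs, ok_opInt_seq, ok_setNum_seq]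
  simp [IntOp.eval, hs.r1, ha, hb]
  repeat' refine And.intro ?_ ?_
  any_goals omega
  refine Ok.seq (T₁ := 2 + (2 * p + 1) * 11) (T₂ := 4)
    (Ok.forN (T := 8) (m := 2 * p + 1) (fun k s' => s'.reg 21 = a / 2 ^ k ∧
      s'.reg 26 = b / 2 ^ k ∧ s'.mem 15 0 = ∑ k ∈ Finset.range k,
      if (a / 2 ^ k + b / 2 ^ k) % 2 = 0 then -(Complex.I / (Real.sqrt D : ℂ)) * gammaAt p γ k
      else -(-(Complex.I / (Real.sqrt D : ℂ)) * gammaAt p γ k))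
      (by decide) (by decide) (by decide) (by decide) (by simp [hs.r2]) (by simp [hs.r5])
      (by omega) (by simp [hs.r1]) ?_ (fun s' h _ => h) le_rfl) (fun s' h hF => ?_) (by omega)
  · rintro k hk s' ⟨h1, h2, h3⟩ h4 hr hm
    have hb' : Base p D s' := hs.congr
      (fun r hr8 => (hr r (by omega) (by revert r; decide)).trans
        (by simp [show r ≠ 21 by omega, show r ≠ 26 by omega]))
      (fun a ha15 ha10 => by
        rw [hm a (by revert a; decide)]
        funext i
        simp; omega)
    have h7 : s'.mem 7 = s.mem 7 := by
      rw [hm 7 (by decide)]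
      funext i
      simp
    have hq : a / 2 ^ k ≤ a := Nat.div_le_self _ _
    have hq' : a / 2 ^ (k + 1) ≤ a := Nat.div_le_self _ _
    have hd : a / 2 ^ k / 2 = a / 2 ^ (k + 1) := by rw [Nat.div_div_eq_div_mul, pow_succ]
    have gq : b / 2 ^ k ≤ b := Nat.div_le_self _ _
    have gq' : b / 2 ^ (k + 1) ≤ b := Nat.div_le_self _ _
    have gd : b / 2 ^ k / 2 = b / 2 ^ (k + 1) := by rw [Nat.div_div_eq_div_mul, pow_succ]
    obtain ⟨g1, g2⟩ := hG k hk
    rw [two_mul] at g1 g2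
    rcases Nat.mod_two_eq_zero_or_one (a / 2 ^ k + b / 2 ^ k) with hx | hx
    all_goals
      simp [kerInner, seqs, ok_opInt_seq, ok_opNum_seq, ok_skip, IntOp.eval, NumOp.eval, hb'.r1,
        hb'.r3, h1, h2, h3, h4, hd, gd, h7, hx, Finset.sum_range_succ, g1, g2]
      try omega
  · have e : ∀ r, r ≠ 21 → r ≠ 22 → r ≠ 23 → r ≠ 24 → r ≠ 26 → s'.reg r = s.reg r :=
      fun r h1 h2 h3 h4 h5 => by
        rw [hF.1 r (by simp [regs_forN, kerInner, seqs, Prog.regs, *])]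
        simp [*]
    have hv := h.2.2
    rw [← gammaDot_decode] at hv
    simp [ok_opInt_seq, ok_expNum_seq, ok_skip, IntOp.eval, e 1, e 4, e 20, e 25, hs.r1, hs.r4,
      ha, hb, hv]
    repeat' refine And.intro ?_ ?_
    any_goals omega
    intro a' b' hb' hlt
    by_cases hab' : a' = a ∧ b' = b
    · obtain ⟨rfl, rfl⟩ := hab'
      simp [pairPhase]
    · have hne : a' * strCount p + b' ≠ a * strCount p + b := fun h =>
        hab' (index_inj hb' hbN h)
      have := hT a' b' hb' (by omega)
      simp [hne, hF.2 22 (by decide), this]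

theorem ok_kernel {p D : ℕ} {γ : ℕ → ℝ} {s : Store} (hp : 1 ≤ p) (hs : Base p D s)
    (hG : GammaTable p D γ (2 * p + 1) s) :
    Ok (sizeBound p) (2 + strCount p * (5 + strCount p * (13 + (2 * p + 1) * 11)))
      (forN 20 4 (forN 25 4 kerBody)) s (KerTable p D γ (strCount p) 0) := by
  have hN := strCount_ge hp
  have hW := sizeBound_ge hp
  refine Ok.forN (T := 2 + strCount p * (13 + (2 * p + 1) * 11))
    (fun k s' => KerTable p D γ k 0 s') (by decide) (by decide)
    (by decide) (by decide) hs.r2 hs.r4 (by omega) (fun a b hb hlt => by omega)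
    (fun k hk s' hI h1 hr ha => ?_) (fun s' h _ => h) (le_of_eq (by ring))
  have hb : Base p D s' := hs.congr
    (fun r hr8 => hr r (by omega) (by revert r; decide))
    (fun a ha15 ha10 => ha a (by revert a; decide))
  refine Ok.forN (T := 10 + (2 * p + 1) * 11)
    (fun l s' => KerTable p D γ k l s') (by decide) (by decide)
    (by decide) (by decide) hb.r2 hb.r4 (by omega) hI
    (fun l hl s'' hI' h1' hr' ha' => ?_) (fun s'' h _ => ?_) (le_of_eq (by ring))
  · have hb' : Base p D s'' := hb.congr
      (fun r hr8 => hr' r (by omega) (by revert r; decide))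
      (fun a ha15 ha10 => ha' a (by revert a; decide))
    refine (ok_kerBody hp hb' ?_ ?_ hk h1' hl hI').mono le_rfl fun s'' h _ => h
    · intro j hj
      rw [ha' 7 (by decide), ha 7 (by decide)]
      exact hG j hj
    · rw [hr' 20 (by decide) (by decide), h1]
  · exact fun a b hb hlt => h a b hb (by omega)

/-! ### The recursion -/

/-- Add one term of the recursion to the accumulator. -/
def recInner : Prog := seqs
  [.opInt .mul 24 20 4, .opInt .add 24 24 25, .opInt .mul 26 27 4, .opInt .add 26 26 25,
    .opNum .mul ⟨16, 1⟩ ⟨4, 26⟩ ⟨22, 24⟩, .opNum .mul ⟨16, 1⟩ ⟨16, 1⟩ ⟨8, 25⟩,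
    .opNum .add ⟨15, 1⟩ ⟨15, 1⟩ ⟨16, 1⟩]

/-- Compute the next row at the string encoded by register `20`. -/
def recBody : Prog := seqs
  [.setNum ⟨15, 1⟩ 0 0, forN 25 4 recInner, .opInt .add 26 27 2, .opInt .mul 26 26 4,
    .opInt .add 26 26 20, .opNum .pow ⟨4, 26⟩ ⟨15, 1⟩ ⟨0, 1⟩]

/-- The table `4` holds the rows up to number `j`, and the first `k` entries of the next one. -/
def RowTable (p D : ℕ) (γ β : ℕ → ℝ) (j k : ℕ) (s : Store) : Prop :=
  ∀ i n, n < strCount p → (i ≤ j ∨ i = j + 1 ∧ n < k) →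
    s.mem 4 (i * strCount p + n) = treeH p D γ β i (decode p n)

theorem ok_rowInit {p D : ℕ} {γ β : ℕ → ℝ} {s : Store} (hp : 1 ≤ p) (hs : Base p D s) :
    Ok (sizeBound p) (2 + strCount p * 5) (forN 20 4 (seqs [.setNum ⟨4, 20⟩ 1 0])) s
      (RowTable p D γ β 0 0) := by
  have hN := strCount_ge hp
  have hW := sizeBound_ge hp
  refine Ok.forN (T := 2) (fun k s' => ∀ n < k, s'.mem 4 n = 1) (by decide) (by decide)
    (by decide) (by decide) hs.r2 hs.r4 (by omega) (fun j hj => absurd hj (Nat.not_lt_zero j))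
    (fun k hk s' hI h1 hr ha => ?_) (fun s' h _ => ?_) le_rfl
  · simp [seqs, ok_setNum_seq, ok_skip, h1]
    exact ⟨by omega, fun n hn hne => hI n (by omega)⟩
  · intro i n hn hi
    obtain rfl : i = 0 := by omega
    rw [zero_mul, zero_add, h n hn, treeH]

/-- With weights and phases tabulated, each term takes a constant number of steps. The D-th power is
a single instruction, so the cost does not depend on D. -/
theorem ok_recBody {p D j a : ℕ} {γ β : ℕ → ℝ} {s : Store} (hp : 1 ≤ p) (hs : Base p D s)
    (hS : StrTable p β (strCount p) s) (hK : KerTable p D γ (strCount p) 0 s)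
    (hD : s.mem 0 0 = D) (hj : s.reg 27 = j) (hjp : j < p)
    (ha : s.reg 20 = a) (haN : a < strCount p) (hT : RowTable p D γ β j a s) :
    Ok (sizeBound p) (10 + strCount p * 12) recBody s (RowTable p D γ β j (a + 1)) := by
  have hN := strCount_ge hp
  have hW := sizeBound_ge hp
  rw [recBody]
  simp only [seqs, ok_setNum_seq]
  simp [hs.r1]
  repeat' refine And.intro ?_ ?_
  any_goals omega
  refine Ok.seq (T₁ := 2 + strCount p * 12) (T₂ := 6)
    (Ok.forN (T := 9) (m := strCount p) (fun k s' => s'.mem 15 0 = ∑ b ∈ Finset.range k,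
      f β (decode p b) * (treeH p D γ β j (decode p b) *
        pairPhase D γ (decode p b) (decode p a)))
      (by decide) (by decide) (by decide) (by decide) (by simp [hs.r2]) (by simp [hs.r4])
      (by omega) (by simp [hs.r1]) ?_ (fun s' h _ => h) le_rfl) (fun s' h hF => ?_) (by omega)
  · intro k hk s' h1 h4 hr hm
    have hb : Base p D s' := hs.congr
      (fun r hr8 => (hr r (by omega) (by revert r; decide)).trans (by simp))
      (fun a ha15 ha10 => by
        rw [hm a (by revert a; decide)]
        funext i
        simp; omega)
    have h20 : s'.reg 20 = a := by rw [hr 20 (by decide) (by decide)]; simpa using ha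
    have h27 : s'.reg 27 = j := by rw [hr 27 (by decide) (by decide)]; simpa using hj
    have e1 : s'.mem 4 (j * strCount p + k) = treeH p D γ β j (decode p k) := by
      rw [hm 4 (by decide)]
      simpa using hT j k hk (Or.inl le_rfl)
    have e2 : s'.mem 22 (a * strCount p + k) = pairPhase D γ (decode p a) (decode p k) := by
      rw [hm 22 (by decide)]
      simpa using hK a k hk (Or.inl haN)
    have e3 : s'.mem 8 k = f β (decode p k) := by
      rw [hm 8 (by decide)]
      simpa using (hS k hk).1
    have b1 := index_lt_sizeBound haN hk
    have b2 := index_lt_sizeBound (by omega : j < strCount p) hk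
    simp [recInner, seqs, ok_opInt_seq, ok_opNum_seq, ok_skip, IntOp.eval, NumOp.eval, hb.r1,
      hb.r4, h1, h4, h20, h27, e1, e2, e3, Finset.sum_range_succ]
    repeat' refine And.intro ?_ ?_
    any_goals omega
    -- The table is read at (a, b), while the recursion is stated with the phase of (b, a).
    rw [pairPhase, pairPhase, gammaDot_comm]
    ring
  · have e : ∀ r, r ≠ 16 → r ≠ 24 → r ≠ 25 → r ≠ 26 → s'.reg r = s.reg r :=
      fun r h1 h2 h3 h4 => by
        rw [hF.1 r (by simp [regs_forN, recInner, seqs, Prog.regs, *])]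
        simp [*]
    have b1 := index_lt_sizeBound (by omega : j + 1 < strCount p) haN
    rw [← sum_str fun b => f β b * (treeH p D γ β j b * pairPhase D γ b (decode p a))] at h
    have hD' : s'.mem 0 0 = D := by
      rw [hF.2 0 (by decide)]
      simpa using hD
    simp [ok_opInt_seq, ok_opNum_seq, ok_skip, IntOp.eval, NumOp.eval, e 1, e 2, e 4, e 20, e 27,
      hs.r1, hs.r2, hs.r4, ha, hj, h, hD']
    repeat' refine And.intro ?_ ?_
    any_goals omega
    intro i n hn hlt
    by_cases hin : i = j + 1 ∧ n = a
    · obtain ⟨rfl, rfl⟩ := hin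
      -- The principal power with a natural number as exponent is the ordinary power, so no branch
      -- of the logarithm enters.
      simp [treeH_succ]
    · have hne : i * strCount p + n ≠ (j + 1) * strCount p + a := fun h =>
        hin (index_inj hn haN h)
      have := hT i n hn (by omega)
      simp [hne, hF.2 4 (by decide), this]

theorem ok_recursion {p D : ℕ} {γ β : ℕ → ℝ} {s : Store} (hp : 1 ≤ p) (hs : Base p D s)
    (hS : StrTable p β (strCount p) s) (hK : KerTable p D γ (strCount p) 0 s)
    (hD : s.mem 0 0 = D) (hT : RowTable p D γ β 0 0 s) :
    Ok (sizeBound p) (2 + p * (5 + strCount p * (13 + strCount p * 12)))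
      (forN 27 0 (forN 20 4 recBody)) s (RowTable p D γ β p 0) := by
  have hN := strCount_ge hp
  have hW := sizeBound_ge hp
  refine Ok.forN (T := 2 + strCount p * (13 + strCount p * 12))
    (fun j s' => RowTable p D γ β j 0 s') (by decide) (by decide)
    (by decide) (by decide) hs.r2 hs.r0 (by omega) hT
    (fun j hj s' hI h1 hr hm => ?_) (fun s' h _ => h) (le_of_eq (by ring))
  have hb : Base p D s' := hs.congr
    (fun r hr8 => hr r (by omega) (by revert r; decide))
    (fun a ha15 ha10 => hm a (by revert a; decide))
  refine Ok.forN (T := 10 + strCount p * 12)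
    (fun a s' => RowTable p D γ β j a s') (by decide) (by decide)
    (by decide) (by decide) hb.r2 hb.r4 (by omega) hI
    (fun a ha s'' hI' h1' hr' hm' => ?_) (fun s'' h _ => ?_) (le_of_eq (by ring))
  · have hb' : Base p D s'' := hb.congr
      (fun r hr8 => hr' r (by omega) (by revert r; decide))
      (fun a ha15 ha10 => hm' a (by revert a; decide))
    refine (ok_recBody hp hb' ?_ ?_ ?_ ?_ hj h1' ha hI').mono le_rfl fun s'' h _ => h
    · intro n hn
      rw [hm' 8 (by decide), hm' 9 (by decide), hm' 18 (by decide), hm' 19 (by decide),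
        hm 8 (by decide), hm 9 (by decide), hm 18 (by decide), hm 19 (by decide)]
      exact hS n hn
    · intro a b h h'
      rw [hm' 22 (by decide), hm 22 (by decide)]
      exact hK a b h h'
    · rw [hm' 0 (by decide), hm 0 (by decide), hD]
    · rw [hr' 27 (by decide) (by decide), h1]
  · exact fun i n hn hlt => h i n hn (by omega)

/-! ### The edge expectation values and the energy -/

/-- Add one term of the bilinear form to the accumulator. -/
def formInner (tbl : ℕ) : Prog := seqs
  [.opInt .mul 24 20 4, .opInt .add 24 24 25, .opInt .mul 26 0 4, .opInt .add 28 26 25,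
    .opInt .add 26 26 20, .opNum .mul ⟨16, 1⟩ ⟨tbl, 20⟩ ⟨tbl, 25⟩,
    .opNum .mul ⟨17, 1⟩ ⟨4, 26⟩ ⟨4, 28⟩, .opNum .mul ⟨17, 1⟩ ⟨22, 24⟩ ⟨17, 1⟩,
    .opNum .mul ⟨16, 1⟩ ⟨16, 1⟩ ⟨17, 1⟩, .opNum .add ⟨15, 1⟩ ⟨15, 1⟩ ⟨16, 1⟩]

/-- Evaluate the bilinear form for the weights in the table `tbl`. -/
def formProg (tbl : ℕ) : Prog := seqs
  [.setNum ⟨15, 1⟩ 0 0, forN 20 4 (forN 25 4 (formInner tbl))]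

theorem arrs_formProg (tbl : ℕ) : (formProg tbl).arrs = [15, 16, 17, 17, 16, 15] := rfl

theorem regs_formProg (tbl : ℕ) : (formProg tbl).regs =
    [20, 25, 24, 24, 26, 28, 26, 25, 20] := rfl

/-- All three edge values are the same bilinear form for different weight tables, so one routine
serves them; the trigonometric sums are recovered by symmetry. -/
theorem ok_formProg {p D tbl : ℕ} {γ β : ℕ → ℝ} {w : Str p → ℂ} {s : Store} (hp : 1 ≤ p)
    (hs : Base p D s) (ht : tbl < 32) (ht' : tbl < 15 ∨ 17 < tbl)
    (hw : ∀ n < strCount p, s.mem tbl n = w (decode p n))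
    (hK : KerTable p D γ (strCount p) 0 s) (hT : RowTable p D γ β p 0 s) :
    Ok (sizeBound p) (4 + strCount p * (5 + strCount p * 15)) (formProg tbl) s
      fun s' => s'.mem 15 0 = edgeForm p D γ β w := by
  have hN := strCount_ge hp
  have hW := sizeBound_ge hp
  let t : ℕ → ℕ → ℂ := fun a b => w (decode p a) * w (decode p b) *
    (pairPhase D γ (decode p a) (decode p b) *
      (treeH p D γ β p (decode p a) * treeH p D γ β p (decode p b)))
  have hform : edgeForm p D γ β w =
      ∑ a ∈ Finset.range (strCount p), ∑ b ∈ Finset.range (strCount p), t a b := by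
    rw [edgeForm, sum_str]
    exact Finset.sum_congr rfl fun a _ => sum_str _
  rw [formProg]
  simp only [seqs, ok_setNum_seq]
  simp [hs.r1]
  repeat' refine And.intro ?_ ?_
  any_goals omega
  refine Ok.seq (T₁ := 2 + strCount p * (5 + strCount p * 15)) (T₂ := 1)
    (Ok.forN (T := 2 + strCount p * 15) (m := strCount p)
      (fun k s' => s'.mem 15 0 =
        ∑ a ∈ Finset.range k, ∑ b ∈ Finset.range (strCount p), t a b)
      (by decide) (by decide) (by simp [regs_forN, formInner, seqs, Prog.regs])
      (by simp [regs_forN, formInner, seqs, Prog.regs]) (by simp [hs.r2]) (by simp [hs.r4])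
      (by omega) (by simp [hs.r1]) (fun k hk s' hI h20 hr hm => ?_) (fun s' h _ => h)
      (le_of_eq (by ring))) (fun s' h hF => ?_) (by omega)
  · have hb : Base p D s' := hs.congr
      (fun r hr8 => (hr r (by omega)
        (by simp [regs_forN, formInner, seqs, Prog.regs]; omega)).trans (by simp))
      (fun a ha15 ha10 => by
        rw [hm a (by simp [arrs_forN, formInner, seqs, Prog.arrs]; omega)]
        funext i
        simp; omega)
    -- The accumulator holds the complete rows before k and the first l terms of row k.
    refine Ok.forN (T := 12) (m := strCount p)
      (fun l s'' => s''.mem 15 0 = ∑ a ∈ Finset.range k, ∑ b ∈ Finset.range (strCount p), t a b +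
        ∑ b ∈ Finset.range l, t k b)
      (by decide) (by decide) (by simp [formInner, seqs, Prog.regs])
      (by simp [formInner, seqs, Prog.regs]) hb.r2 hb.r4
      (by omega) (by simp [hI]) (fun l hl s'' hI' h25 hr' hm' => ?_) (fun s'' h _ => ?_) le_rfl
    · have hb' : Base p D s'' := hb.congr
        (fun r hr8 => hr' r (by omega) (by simp [formInner, seqs, Prog.regs]; omega))
        (fun a ha15 ha10 => hm' a (by simp [formInner, seqs, Prog.arrs]; omega))
      have hmem : ∀ a, a < 15 ∨ 17 < a → s''.mem a = s.mem a := fun a ha => by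
        rw [hm' a (by simp [formInner, seqs, Prog.arrs]; omega),
          hm a (by simp [arrs_forN, formInner, seqs, Prog.arrs]; omega)]
        funext i
        simp; omega
      have h20' : s''.reg 20 = k := by
        rw [hr' 20 (by decide) (by simp [formInner, seqs, Prog.regs]), h20]
      have b1 := index_lt_sizeBound hk hl
      have b2 := index_lt_sizeBound (by omega : p < strCount p) hk
      have b3 := index_lt_sizeBound (by omega : p < strCount p) hl
      have e1 : s''.mem 4 (p * strCount p + k) = treeH p D γ β p (decode p k) := by
        rw [hmem 4 (by omega), hT p k hk (Or.inl le_rfl)]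
      have e2 : s''.mem 4 (p * strCount p + l) = treeH p D γ β p (decode p l) := by
        rw [hmem 4 (by omega), hT p l hl (Or.inl le_rfl)]
      have e3 : s''.mem 22 (k * strCount p + l) = pairPhase D γ (decode p k) (decode p l) := by
        rw [hmem 22 (by omega), hK k l hl (Or.inl hk)]
      have e4 : s''.mem tbl k = w (decode p k) := by rw [hmem tbl ht', hw k hk]
      have e5 : s''.mem tbl l = w (decode p l) := by rw [hmem tbl ht', hw l hl]
      have i1 : tbl ≠ 15 := by omega
      have i2 : tbl ≠ 16 := by omega
      have i3 : tbl ≠ 17 := by omega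
      simp [formInner, seqs, ok_opInt_seq, ok_opNum_seq, ok_skip, IntOp.eval, NumOp.eval, hb'.r0,
        hb'.r1, hb'.r4, hI', h25, h20', e1, e2, e3, e4, e5, ht, Finset.sum_range_succ]
      repeat' refine And.intro ?_ ?_
      any_goals omega
      simp only [t]
      ring
    · show s''.mem 15 0 = _
      rw [Finset.sum_range_succ]
      exact h
  · rw [ok_skip]
    exact ⟨le_rfl, h.trans hform.symm⟩

/-- The final part of the program: all four values. -/
def finish : Prog := seqs
  [formProg 9, .opNum .add ⟨3, 2⟩ ⟨15, 1⟩ ⟨11, 1⟩, formProg 19,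
    -- The subtraction from zero is the sign in `sumYY_eq`. Operands address through registers: ⟨3,
    -- 3⟩ is cell 2, as register 3 holds 2. Registers 10, 11, 12 receive the addresses of the three
    -- Pauli coefficients, and register 10 also points at the last output cell.
    .opNum .sub ⟨3, 3⟩ ⟨11, 1⟩ ⟨15, 1⟩, formProg 18, .setInt 10 3, .setInt 11 4, .setInt 12 5,
    .opNum .add ⟨3, 10⟩ ⟨15, 1⟩ ⟨11, 1⟩,
    .opNum .mul ⟨16, 1⟩ ⟨0, 10⟩ ⟨3, 2⟩, .opNum .mul ⟨17, 1⟩ ⟨0, 11⟩ ⟨3, 3⟩,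
    .opNum .add ⟨16, 1⟩ ⟨16, 1⟩ ⟨17, 1⟩, .opNum .mul ⟨17, 1⟩ ⟨0, 12⟩ ⟨3, 10⟩,
    .opNum .add ⟨16, 1⟩ ⟨16, 1⟩ ⟨17, 1⟩, .opNum .mul ⟨16, 1⟩ ⟨0, 2⟩ ⟨16, 1⟩,
    .opNum .mul ⟨17, 1⟩ ⟨0, 3⟩ ⟨0, 2⟩, .opNum .add ⟨3, 1⟩ ⟨17, 1⟩ ⟨16, 1⟩]

theorem ok_finish {p D m : ℕ} {cI cX cY cZ : ℝ} {γ β : ℕ → ℝ} {s : Store} (hp : 1 ≤ p)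
    (hs : Base p D s) (hS : StrTable p β (strCount p) s)
    (hK : KerTable p D γ (strCount p) 0 s) (hT : RowTable p D γ β p 0 s)
    (h0 : s.mem 0 = (inputStore p D m cI cX cY cZ γ β).mem 0) :
    Ok (sizeBound p) (30 + 3 * (4 + strCount p * (5 + strCount p * 15))) finish s
      fun s' => IsOutput s' p D m cI cX cY cZ γ β := by
  have hN := strCount_ge hp
  have hW := sizeBound_ge hp
  generalize hX : 4 + strCount p * (5 + strCount p * 15) = X
  refine Ok.seq (T₂ := 30 + 2 * X)
    (ok_formProg (w := f' β) hp hs (by norm_num) (by norm_num) (fun n hn => (hS n hn).2.1) hK hT)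
    (fun s₁ h₁ hF₁ => ?_) (by omega)
  rw [Frame, regs_formProg, arrs_formProg] at hF₁
  obtain ⟨hr₁, hm₁⟩ := hF₁
  have hb₁ : Base p D s₁ := hs.congr (fun r hr => hr₁ r (by simp; omega))
    (fun a h1 h2 => hm₁ a (by simp; omega))
  rw [seqs, ok_opNum_seq]
  simp [NumOp.eval, hb₁.r1, hb₁.r2, hb₁.zero, h₁]
  repeat' refine And.intro ?_ ?_
  any_goals omega
  set s₂ := s₁.set ⟨3, 2⟩ (edgeForm p D γ β (f' β)) with hs₂
  have hm₂ : ∀ a, a ≠ 3 → a < 15 ∨ 17 < a → s₂.mem a = s.mem a := fun a h1 h2 => by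
    rw [← hm₁ a (by simp; omega)]
    funext i
    simp [hs₂, h1]
  have hb₂ : Base p D s₂ := hs.congr (fun r hr => hr₁ r (by simp; omega))
    (fun a h1 h2 => hm₂ a (by omega) (by omega))
  refine Ok.seq (T₁ := X) (T₂ := 28 + X)
    (hX ▸ ok_formProg (w := fun a => midEntry a * f' β a) hp hb₂ (by norm_num) (by norm_num)
      (fun n hn => by rw [hm₂ 19 (by omega) (by omega)]; exact (hS n hn).2.2.2)
      (fun a b h1 h2 => by rw [hm₂ 22 (by omega) (by omega)]; exact hK a b h1 h2)
      (fun i n h1 h2 => by rw [hm₂ 4 (by omega) (by omega)]; exact hT i n h1 h2))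
    (fun s₃ h₃ hF₃ => ?_) (by omega)
  rw [Frame, regs_formProg, arrs_formProg] at hF₃
  obtain ⟨hr₃, hm₃⟩ := hF₃
  have hb₃ : Base p D s₃ := hb₂.congr (fun r hr => hr₃ r (by simp; omega))
    (fun a h1 h2 => hm₃ a (by simp; omega))
  rw [seqs, ok_opNum_seq]
  simp [NumOp.eval, hb₃.r1, hb₃.r3, hb₃.zero, h₃]
  repeat' refine And.intro ?_ ?_
  any_goals omega
  set s₄ := s₃.set ⟨3, 3⟩ (-edgeForm p D γ β fun a => midEntry a * f' β a) with hs₄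
  have hm₄ : ∀ a, a ≠ 3 → a < 15 ∨ 17 < a → s₄.mem a = s.mem a := fun a h1 h2 => by
    rw [← hm₂ a h1 h2, ← hm₃ a (by simp; omega)]
    funext i
    simp [hs₄, h1]
  have hb₄ : Base p D s₄ := hb₃.congr (fun _ _ => rfl)
    (fun a h1 h2 => by funext i; simp [hs₄]; omega)
  refine Ok.seq (T₁ := X) (T₂ := 25)
    (hX ▸ ok_formProg (w := fun a => midEntry a * f β a) hp hb₄ (by norm_num) (by norm_num)
      (fun n hn => by rw [hm₄ 18 (by omega) (by omega)]; exact (hS n hn).2.2.1)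
      (fun a b h1 h2 => by rw [hm₄ 22 (by omega) (by omega)]; exact hK a b h1 h2)
      (fun i n h1 h2 => by rw [hm₄ 4 (by omega) (by omega)]; exact hT i n h1 h2))
    (fun s₅ h₅ hF₅ => ?_) (by omega)
  rw [Frame, regs_formProg, arrs_formProg] at hF₅
  obtain ⟨hr₅, hm₅⟩ := hF₅
  have hb₅ : Base p D s₅ := hb₄.congr (fun r hr => hr₅ r (by simp; omega))
    (fun a h1 h2 => hm₅ a (by simp; omega))
  have e1 : s₅.mem 3 1 = edgeForm p D γ β (f' β) := by
    rw [hm₅ 3 (by simp), hs₄, Store.set_mem, if_neg (by simp [hb₃.r3]), hm₃ 3 (by simp), hs₂,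
      Store.set_mem, if_pos (by simp [hb₁.r2])]
  have e2 : s₅.mem 3 2 = -edgeForm p D γ β fun a => midEntry a * f' β a := by
    rw [hm₅ 3 (by simp), hs₄, Store.set_mem, if_pos (by simp [hb₃.r3])]
  have e0 : s₅.mem 0 = (inputStore p D m cI cX cY cZ γ β).mem 0 := by
    rw [hm₅ 0 (by simp), hm₄ 0 (by omega) (by omega), h0]
  simp [seqs, ok_setInt_seq, ok_opNum_seq, ok_skip, NumOp.eval, hb₅.r1, hb₅.r2, hb₅.r3,
    hb₅.zero, h₅, e0, e1, e2]
  repeat' refine And.intro ?_ ?_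
  any_goals omega
  · simp [hb₅.r1, energyValue, sumXX_eq, sumYY_eq, sumZZ_eq, inputStore]
  · simp [hb₅.r1, sumXX_eq, e1]
  · simp [hb₅.r1, sumYY_eq, e2]
  · simp [hb₅.r1, sumZZ_eq]
  · intro j hj n hn
    have := hT j n hn (Or.inl hj)
    simpa [hm₅ 4, hm₄ 4, strCount] using this

/-! ### The assembled program and its cost -/

/-- The program. -/
def program : Prog := seqs
  [setup, forN 10 6 rotBody, forN 10 5 gammaBody, forN 20 4 strBody,
    forN 20 4 (forN 25 4 kerBody), forN 20 4 (seqs [.setNum ⟨4, 20⟩ 1 0]),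
    forN 27 0 (forN 20 4 recBody), finish]

/-- Two stages dominate: the phase table, with N² entries at O(p) each, and the recursion, with p
rounds of N² terms at O(1). The constant 1000 is generous. -/
theorem ok_program {p D m : ℕ} (hp : 1 ≤ p) (cI cX cY cZ : ℝ) (γ β : ℕ → ℝ) :
    Ok (sizeBound p) (1000 * (p * sizeBound p)) program (inputStore p D m cI cX cY cZ γ β)
      fun s' => IsOutput s' p D m cI cX cY cZ γ β := by
  set s₀ := inputStore p D m cI cX cY cZ γ β with hs₀
  refine Ok.mono (T := (40 + 15 * p) + ((2 + 2 * p * 28) + ((2 + (2 * p + 1) * 18) +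
    ((2 + strCount p * (23 + 2 * p * 22)) +
    ((2 + strCount p * (5 + strCount p * (13 + (2 * p + 1) * 11))) + ((2 + strCount p * 5) +
    ((2 + p * (5 + strCount p * (13 + strCount p * 12))) +
    ((30 + 3 * (4 + strCount p * (5 + strCount p * 15))) + 1)))))))) ?_ ?_ fun s' h _ => h
  · refine Ok.seq (ok_setup hp cI cX cY cZ γ β) (fun s₁ hb₁ hF₁ => ?_) le_rfl
    refine Ok.seq (ok_rotTables (β := β) hp hb₁ fun i h1 h2 => by
      rw [hF₁.2 2 (by decide)]; simp [hs₀, inputStore, h1, h2]) (fun s₂ hR₂ hF₂ => ?_) le_rfl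
    have hb₂ : Base p D s₂ := hb₁.of_frame hF₂ (by decide) (by decide)
    refine Ok.seq (ok_gammaTable (γ := γ) hp hb₂ (fun i h1 h2 => by
      rw [hF₂.2 1 (by decide), hF₁.2 1 (by decide)]; simp [hs₀, inputStore, h1, h2]) (by
      rw [hF₂.2 1 (by decide), hF₁.2 1 (by decide)]; simp [hs₀, inputStore]))
      (fun s₃ hG₃ hF₃ => ?_) le_rfl
    have hb₃ : Base p D s₃ := hb₂.of_frame hF₃ (by decide) (by decide)
    have hR₃ : RotTable p β (2 * p) s₃ := fun j hj => by
      rw [hF₃.2 5 (by decide), hF₃.2 6 (by decide)]; exact hR₂ j hj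
    refine Ok.seq (ok_strTable hp hb₃ hR₃) (fun s₄ hS₄ hF₄ => ?_) le_rfl
    have hb₄ : Base p D s₄ := hb₃.of_frame hF₄ (by decide) (by decide)
    have hG₄ : GammaTable p D γ (2 * p + 1) s₄ := fun j hj => by
      rw [hF₄.2 7 (by decide)]; exact hG₃ j hj
    refine Ok.seq (ok_kernel hp hb₄ hG₄) (fun s₅ hK₅ hF₅ => ?_) le_rfl
    have hb₅ : Base p D s₅ := hb₄.of_frame hF₅ (by decide) (by decide)
    refine Ok.seq (ok_rowInit (γ := γ) (β := β) hp hb₅) (fun s₆ hT₆ hF₆ => ?_) le_rfl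
    have hb₆ : Base p D s₆ := hb₅.of_frame hF₆ (by decide) (by decide)
    have hS₆ : StrTable p β (strCount p) s₆ := fun n hn => by
      rw [hF₆.2 8 (by decide), hF₆.2 9 (by decide), hF₆.2 18 (by decide), hF₆.2 19 (by decide),
        hF₅.2 8 (by decide), hF₅.2 9 (by decide), hF₅.2 18 (by decide), hF₅.2 19 (by decide)]
      exact hS₄ n hn
    have hK₆ : KerTable p D γ (strCount p) 0 s₆ := fun a b h1 h2 => by
      rw [hF₆.2 22 (by decide)]; exact hK₅ a b h1 h2
    have h0₆ : s₆.mem 0 = s₀.mem 0 := by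
      rw [hF₆.2 0 (by decide), hF₅.2 0 (by decide), hF₄.2 0 (by decide), hF₃.2 0 (by decide),
        hF₂.2 0 (by decide), hF₁.2 0 (by decide)]
    refine Ok.seq (ok_recursion hp hb₆ hS₆ hK₆ (by rw [h0₆]; rfl) hT₆)
      (fun s₇ hT₇ hF₇ => ?_) le_rfl
    have hb₇ : Base p D s₇ := hb₆.of_frame hF₇ (by decide) (by decide)
    refine Ok.seq (ok_finish hp hb₇ (fun n hn => ?_) (fun a b h1 h2 => ?_) hT₇ ?_)
      (fun s₈ h₈ _ => by rw [seqs, ok_skip]; exact ⟨le_rfl, h₈⟩) le_rfl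
    · rw [hF₇.2 8 (by decide), hF₇.2 9 (by decide), hF₇.2 18 (by decide), hF₇.2 19 (by decide)]
      exact hS₆ n hn
    · rw [hF₇.2 22 (by decide)]; exact hK₆ a b h1 h2
    · rw [hF₇.2 0 (by decide), h0₆]
  -- The total is a combination of 1, p, N, pN, N² and pN², and each of these is at most pN².
  · rw [sizeBound]
    have hN : 1 ≤ strCount p := Nat.one_le_two_pow
    generalize strCount p = N at hN
    have h1 : p ≤ p * (N * N) := Nat.le_mul_of_pos_right _ (by positivity)
    have h2 : N * N ≤ p * (N * N) := Nat.le_mul_of_pos_left _ hp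
    have h3 : N ≤ N * N := Nat.le_mul_of_pos_left _ hN
    have h4 : p * N ≤ p * (N * N) := Nat.mul_le_mul_left _ h3
    nlinarith

theorem sizeBound_eq (p : ℕ) : sizeBound p = 4 * 16 ^ p := by
  rw [sizeBound, strCount, ← pow_add, show 2 * p + 1 + (2 * p + 1) = 2 + 4 * p by ring, pow_add,
    pow_mul]
  norm_num

end MCAnsatz

end

/-! ### The main theorem -/

open MCAnsatz
theorem mainTheorem1 :
    -- the energy, and the three edge expectation values
    (∀ (V : Type*) [Fintype V] [DecidableEq V] (G : SimpleGraph V) [DecidableRel G.Adj]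
      (p D : ℕ) (_hp : 1 ≤ p) (_hD : 1 ≤ D)
      (_hreg : G.IsRegularOfDegree (D + 1)) (_hgirth : ((2 * p + 1 : ℕ) : ℕ∞) < G.egirth)
      (γ β : ℕ → ℝ) (cI cX cY cZ : ℝ) (L R : V) (_hLR : G.Adj L R),
      expectation G D p γ β (hamiltonian G cI cX cY cZ) =
          (cI : ℂ) * G.edgeFinset.card + G.edgeFinset.card *
            ((cX : ℂ) * expectation G D p γ β (onQubits {L, R} pauliX)
              + (cY : ℂ) * expectation G D p γ β (onQubits {L, R} pauliY)
              + (cZ : ℂ) * expectation G D p γ β (onQubits {L, R} pauliZ)) ∧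
      expectation G D p γ β (onQubits {L, R} pauliX) = sumXX p D γ β ∧
      expectation G D p γ β (onQubits {L, R} pauliY) = sumYY p D γ β ∧
      expectation G D p γ β (onQubits {L, R} pauliZ) = sumZZ p D γ β) ∧
    -- the two forms of the recursion agree
    (∀ (p D : ℕ) (_hp : 1 ≤ p) (_hD : 1 ≤ D) (γ β : ℕ → ℝ) (m : ℕ) (a : Str p),
      treeH p D γ β (m + 1) a =
        (∑ b : Str p, treeH p D γ β m b *
          (Real.cos (1 / Real.sqrt D * gammaDot γ a b) : ℂ) * f β b) ^ D) ∧
    -- time and space needed to evaluate the iteration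
    (∃ (prog : Prog) (K : ℕ), ∀ (p D m : ℕ) (_hp : 1 ≤ p) (_hD : 1 ≤ D)
      (cI cX cY cZ : ℝ) (γ β : ℕ → ℝ),
      IsOutput (prog.run (inputStore p D m cI cX cY cZ γ β)) p D m cI cX cY cZ γ β ∧
      prog.time (inputStore p D m cI cX cY cZ γ β) ≤ K * (p * 16 ^ p) ∧
      prog.space (inputStore p D m cI cX cY cZ γ β) ≤ K * 16 ^ p ∧
      prog.peak (inputStore p D m cI cX cY cZ γ β) ≤ K * 16 ^ p) := by
  -- Since N² = 4·16^p, the time bound needs 1000·4; the cell bound needs only 32·4 and the integer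
  -- bound 4.
  refine ⟨?_, ?_, program, 4000, ?_⟩
  · intro V _ _ G _ p D hp hD hreg hg γ β cI cX cY cZ L R hLR
    obtain ⟨hX, hY, hZ⟩ := expectation_pauli G hp hreg hLR hg γ β
    refine ⟨?_, hX, hY, hZ⟩
    rw [hX, hY, hZ]
    exact expectation_hamiltonian G hp hreg hg γ β cI cX cY cZ
  · intro p D _ _ γ β m a
    exact treeH_succ_cos p D γ β m a
  · intro p D m hp _ cI cX cY cZ γ β
    obtain ⟨h1, h2, h3, h4⟩ := (ok_program (D := D) (m := m) hp cI cX cY cZ γ β).spec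
    rw [sizeBound_eq] at h2 h3 h4
    refine ⟨h1, h2.trans (le_of_eq (by ring)), h3.trans ?_, h4.trans ?_⟩ <;> omega
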